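/- **Setting.** Let $G$ be a group of prime order $q$, written additively, with elements represented by $w$-bit words. Privacy Pass set-up $\mathsf{PP.SetUp}$ outputs a generator $g$; key generation picks $\mathsf{esk}$ uniformly in $\mathbb{Z}_q^*$ and sets $\mathsf{epk}=\mathsf{esk}\cdot g$; a token $(n,\sigma)$ is valid if $\sigma=\mathsf{esk}\cdot \mathsf{H}(n)$, where $\mathsf H$ is a fixed public function from nonces to $G$. Let $\mathsf{Com}$, $\mathsf{Sig}$ and $\mathsf{Sym}$ be a commitment, a signature and a symmetric encryption scheme, and let $\mathsf{Hash}$ be a random oracle with values in $\mathbb{Z}_q$. The proof $\mathsf{NIZKDLEQ}(P_1,Q_1,P_2,Q_2,\mathsf{sk})$ is $(c,s)$ with $k$ uniform in $\mathbb{Z}_q^*$, $c=\mathsf{Hash}(q,P_1,Q_1,P_2,Q_2,kP_1,kP_2)$ and $s=k-c\cdot \mathsf{sk} \bmod q$. **Game $\mathsf{ScIntegrity}(\mathcal A)$.** The adversary gets $(q,g)$ and outputs a verification key $\mathsf{pk}$ and a state. Then $(\mathsf{esk},\mathsf{epk})$ and $B$ signature key pairs $(\mathsf{sgk}^j,\mathsf{vk}^j)$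 are generated and a counter $\mathsf{ctr}$ is set to $0$. The adversary continues from its state with $\mathsf{epk}$ and the following oracles (it can query $\mathsf{Hash}$ throughout). - $\mathsf{OVerify}(n,\sigma)$ tells whether $\sigma=\mathsf{esk}\cdot\mathsf H(n)$. - $\mathsf{OIssueTag}(j,h)$ computes commitments with openings $(\mathsf{com}_s,\mathsf{op}_s)$ to $\mathsf{vk}^j$ and $(\mathsf{com}_r,\mathsf{op}_r)$ to $h$, stores them under a fresh index $i$ and returns $(\mathsf{com}_s,\mathsf{com}_r,i)$. - $\mathsf{OReport}(i,t)$, for a tag $t=(\mathsf{com}_s',\mathsf{com}_r',\tau,y,\mathsf{ct},\mathsf{pp},Q,G',X,\sigma)$, aborts the game if the index $i$ does not exist or has already been reported. It returns an error, without any other effect, if $t$ is malformed, $\tau$ is not close to the current time, $\mathsf{com}_s'\neq\mathsf{com}_s$, $\mathsf{com}_r'\neq\mathsf{com}_r$, $\sigma$ is not a valid signature under $\mathsf{pk}$ on the rest of $t$, or $X\neq \mathsf{esk}\cdot G'$. Otherwise it sets $R=\mathsf{esk}\cdot Q$ and $\pi=\mathsf{NIZKDLEQ}(G',X,Q,R,\mathsf{esk})$,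 increments $\mathsf{ctr}$, marks $i$ as reported and returns $(\mathsf{op}_s,\mathsf{op}_r,\pi,R)$. Finally $\mathcal A$ outputs $(n_1,\sigma_1),\dots,(n_x,\sigma_x)$. It wins if the game was not aborted, $x>\mathsf{ctr}$, the $n_i$ are pairwise different and all tokens are valid. **Game $\mathsf{OMUF}(\mathcal B)$.** The adversary gets $(q,g)$ and $\mathsf{epk}$, an oracle $\mathsf{OSign}(Q)$ that increments $\mathsf{ctr}$ and returns $\mathsf{esk}\cdot Q$, and the additional oracle $\mathsf{OVer}(G',X)=1_{X=\mathsf{esk}\cdot G'}$. It outputs $(n_1,\sigma_1),\dots,(n_x,\sigma_x)$ and wins if $x>\mathsf{ctr}$, the $n_i$ are pairwise different and all tokens are valid. Adversaries are randomized programs of a machine on $w$-bit words with associative arrays, for which word operations, group and scalar operations, uniform sampling, the public algorithms of the schemes and oracle queries are elementary steps (the operands of variable-length tuples are counted too). The complexity of an adversary is the time after which it is stopped (it loses if it has not finished by then) plus the length of its program. $\mathsf{Adv}$ denotes the probability of winning. **Theorem.** There is an absolute constant $C$ such that, for all data as above and every adversary $\mathcal A$ with complexity $T$ against $\mathsf{ScIntegrity}$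 in the random oracle model, there is an adversary $\mathcal B$ with complexity at most $C\cdot T$ against $\mathsf{OMUF}$ with the additional oracle $\mathsf{OVer}$, such that $$\mathsf{Adv}^{\mathsf{ScIntegrity}}_{\mathcal A}\le \mathsf{Adv}^{\mathsf{OMUF}}_{\mathcal B}+\frac1q .$$ -/

import Mathlib

open scoped ENNReal

noncomputable section

namespace Sandi

/-! # Machine model

Adversaries are programs of a randomized word machine.  Machine words have `w` bits.  The memory
consists of named associative arrays indexed by finite tuples of words (every cell is initially
`0`); the cell of array `r` with the empty index is called register `r`. -/

/-- Memory contents: array name, index tuple, value. -/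
abbrev Store (w : ℕ) : Type := ℕ → List (BitVec w) → BitVec w

/-- Memory in which every cell is zero. -/
def Store.zero (w : ℕ) : Store w := fun _ _ => 0

def Store.reg {w : ℕ} (m : Store w) (r : ℕ) : BitVec w := m r []

def Store.set {w : ℕ} (m : Store w) (a : ℕ) (i : List (BitVec w)) (v : BitVec w) : Store w :=
  fun b j => if b = a ∧ j = i then v else m b j

/-- Write a list of words into a list of registers (missing words count as `0`). -/
def Store.setRegs {w : ℕ} : Store w → List ℕ → List (BitVec w) → Store w
  | m, [], _ => m
  | m, r :: rs, vs => Store.setRegs (m.set r [] (vs.headD 0)) rs vs.tail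

/-- Arithmetic and logical instructions on machine words. -/
inductive WordOp
  | add | sub | mul | div | mod | and | or | xor | shl | shr | eq | lt

def WordOp.eval {w : ℕ} : WordOp → BitVec w → BitVec w → BitVec w
  | .add, a, b => a + b
  | .sub, a, b => a - b
  | .mul, a, b => a * b
  | .div, a, b => a / b
  | .mod, a, b => a % b
  | .and, a, b => a &&& b
  | .or, a, b => a ||| b
  | .xor, a, b => a ^^^ b
  | .shl, a, b => a <<< b.toNat
  | .shr, a, b => a >>> b.toNat
  | .eq, a, b => if a = b then 1 else 0
  | .lt, a, b => if a.toNat < b.toNat then 1 else 0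

/-- Names of the public algorithms that every party can run locally. -/
inductive PubOp
  | groupValid | groupAdd | groupNeg | groupSmul
  | scalarAdd | scalarNeg | scalarMul | scalarInv
  | randWord | randScalar | randUnit
  | hashToGroup
  | comCommit | comOpen
  | sigKeyGen | sigSign | sigVerify
  | symKeyGen | symEnc | symDec
  | timeFresh

/-- Programs with oracle names in `O`. -/
inductive Cmd (w : ℕ) (O : Type) : Type
  /-- do nothing -/
  | skip
  /-- put a constant into register `r` -/
  | const (r : ℕ) (v : BitVec w)
  /-- `r := f a b` for registers `r`, `a`, `b` -/
  | word (f : WordOp) (r a b : ℕ)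
  /-- `r := arr[idx]`, the index tuple being read from the registers `idx` -/
  | load (r arr : ℕ) (idx : List ℕ)
  /-- `arr[idx] := r` -/
  | store (arr : ℕ) (idx : List ℕ) (r : ℕ)
  /-- run the public algorithm `f` on the registers `args`, results into the registers `out` -/
  | pub (f : PubOp) (out args : List ℕ)
  /-- query the oracle `o` on the registers `args`, results into the registers `out` -/
  | call (o : O) (out args : List ℕ)
  | seq (c d : Cmd w O)
  /-- branch on register `r` being nonzero -/
  | ite (r : ℕ) (c d : Cmd w O)
  /-- repeat while register `r` is nonzero -/
  | loop (r : ℕ) (c : Cmd w O)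

/-- Length of a program: the number of instructions and of operands in tuples. -/
def Cmd.size {w : ℕ} {O : Type} : Cmd w O → ℕ
  | .skip => 1
  | .const _ _ => 1
  | .word _ _ _ _ => 1
  | .load _ _ idx => 1 + idx.length
  | .store _ idx _ => 1 + idx.length
  | .pub _ out args => 1 + out.length + args.length
  | .call _ out args => 1 + out.length + args.length
  | .seq c d => 1 + c.size + d.size
  | .ite _ c d => 1 + c.size + d.size
  | .loop _ c => 1 + c.size

/-- Behaviour of the oracles of a game whose internal state has type `σ`. -/
abbrev Handler (w : ℕ) (O σ : Type) : Type :=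
  O → List (BitVec w) → σ → PMF (List (BitVec w) × σ)

/-- Spend `k` of the remaining `t` time units; `none` means that the time is used up. -/
def spend {α : Type} (k t : ℕ) (f : ℕ → PMF (Option α)) : PMF (Option α) :=
  if t < k then PMF.pure none else f (t - k)

/-- Repeat `body` while `test` holds; every evaluation of `test` costs one time unit.  The first
number bounds the evaluations of `test`, the second is the remaining time. -/
def repeatWhile {S : Type} (test : S → Bool) (body : ℕ → S → PMF (Option (ℕ × S))) :
    ℕ → ℕ → S → PMF (Option (ℕ × S))
  | 0, _, _ => PMF.pure none
  | n + 1, t, s =>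
    spend 1 t fun t₁ =>
      if test s then
        (body t₁ s).bind fun
          | none => PMF.pure none
          | some (t₂, s₂) => repeatWhile test body n t₂ s₂
      else PMF.pure (some (t₁, s))

/-- Execution of a program with `t` time units left, on a memory and a game state.  The result is
the time left with the new memory and game state, or `none` if the time does not suffice. -/
def Cmd.exec {w : ℕ} {O σ : Type} (pub : PubOp → List (BitVec w) → PMF (List (BitVec w)))
    (orc : Handler w O σ) :
    Cmd w O → ℕ → Store w × σ → PMF (Option (ℕ × Store w × σ))
  | .skip, t, s => spend 1 t fun t₁ => PMF.pure (some (t₁, s))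
  | .const r v, t, s => spend 1 t fun t₁ => PMF.pure (some (t₁, s.1.set r [] v, s.2))
  | .word f r a b, t, s => spend 1 t fun t₁ =>
      PMF.pure (some (t₁, s.1.set r [] (f.eval (s.1.reg a) (s.1.reg b)), s.2))
  | .load r arr idx, t, s => spend (1 + idx.length) t fun t₁ =>
      PMF.pure (some (t₁, s.1.set r [] (s.1 arr (idx.map s.1.reg)), s.2))
  | .store arr idx r, t, s => spend (1 + idx.length) t fun t₁ =>
      PMF.pure (some (t₁, s.1.set arr (idx.map s.1.reg) (s.1.reg r), s.2))
  | .pub f out args, t, s => spend (1 + out.length + args.length) t fun t₁ =>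
      (pub f (args.map s.1.reg)).bind fun ans =>
        PMF.pure (some (t₁, s.1.setRegs out ans, s.2))
  | .call o out args, t, s => spend (1 + out.length + args.length) t fun t₁ =>
      (orc o (args.map s.1.reg) s.2).bind fun ans =>
        PMF.pure (some (t₁, s.1.setRegs out ans.1, ans.2))
  | .seq c d, t, s =>
      (c.exec pub orc t s).bind fun
        | none => PMF.pure none
        | some (t₁, s₁) => d.exec pub orc t₁ s₁
  | .ite r c d, t, s => spend 1 t fun t₁ =>
      if s.1.reg r ≠ 0 then c.exec pub orc t₁ s else d.exec pub orc t₁ s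
  | .loop r c, t, s =>
      repeatWhile (fun s => decide (s.1.reg r ≠ 0)) (c.exec pub orc) t t s

/-! # Building blocks of the scheme

Keys, messages, commitments, openings, ciphertexts, signatures, nonces and time stamps are
machine words.  Only the interfaces of the following three schemes matter here, so no security
or correctness property of them is imposed. -/

structure Commitment (w : ℕ) where
  /-- message to commitment and opening -/
  commit : BitVec w → PMF (BitVec w × BitVec w)
  /-- commitment, opening, message -/
  opens : BitVec w → BitVec w → BitVec w → Bool

structure Signature (w : ℕ) where
  /-- signing key and verification key -/
  keyGen : PMF (BitVec w × BitVec w)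
  /-- signing key, message -/
  sign : BitVec w → List (BitVec w) → PMF (BitVec w)
  /-- verification key, signature, message -/
  verify : BitVec w → BitVec w → List (BitVec w) → Bool

structure SymEncryption (w : ℕ) where
  keyGen : PMF (BitVec w)
  enc : BitVec w → List (BitVec w) → PMF (BitVec w)
  dec : BitVec w → BitVec w → List (BitVec w)

/-- An instance of the system over a group `G` (of prime order `q`, written additively). -/
structure System (w q : ℕ) (G : Type) [AddCommGroup G] where
  /-- representation of group elements by machine words -/
  enc : G ↪ BitVec w
  /-- the generator produced by the set-up algorithm of Privacy Pass -/
  setup : PMF G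
  setup_generates : ∀ g ∈ setup.support, AddSubgroup.zmultiples g = ⊤
  /-- the hash function of Privacy Pass, from nonces to the group -/
  hashG : BitVec w → G
  com : Commitment w
  sig : Signature w
  sym : SymEncryption w
  /-- number of signature key pairs of the sender -/
  numKeys : ℕ
  /-- the time stamps that the sender accepts as close to the current time; the security game has
  no clock, so the current time is fixed -/
  fresh : BitVec w → Bool

/-- Truth values as machine words. -/
def bit {w : ℕ} (b : Bool) : BitVec w := if b then 1 else 0

/-- Scalars as machine words. -/
def scalarWord (w : ℕ) {q : ℕ} (k : ZMod q) : BitVec w := BitVec.ofNat w k.val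

/-- The scalar represented by a machine word. -/
def wordScalar {w : ℕ} (q : ℕ) (x : BitVec w) : ZMod q := (x.toNat : ZMod q)

/-- Multiplication of a group element by a scalar. -/
def mulG {q : ℕ} {G : Type} [AddCommGroup G] (k : ZMod q) (P : G) : G := k.val • P

namespace System

variable {w q : ℕ} [Fact q.Prime] {G : Type} [AddCommGroup G]

/-- The group element represented by a machine word, if there is one. -/
def decode (S : System w q G) (x : BitVec w) : Option G := Function.partialInv S.enc x

/-- The public algorithms.  Malformed inputs give the empty answer. -/
def pub (S : System w q G) : PubOp → List (BitVec w) → PMF (List (BitVec w))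
  | .groupValid, [x] => PMF.pure [bit (S.decode x).isSome]
  | .groupAdd, [x, y] =>
      match S.decode x, S.decode y with
      | some P, some Q => PMF.pure [S.enc (P + Q)]
      | _, _ => PMF.pure []
  | .groupNeg, [x] =>
      match S.decode x with
      | some P => PMF.pure [S.enc (-P)]
      | none => PMF.pure []
  | .groupSmul, [k, x] =>
      match S.decode x with
      | some P => PMF.pure [S.enc (mulG (wordScalar q k) P)]
      | none => PMF.pure []
  | .scalarAdd, [a, b] => PMF.pure [scalarWord w (wordScalar q a + wordScalar q b)]
  | .scalarNeg, [a] => PMF.pure [scalarWord w (-wordScalar q a)]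
  | .scalarMul, [a, b] => PMF.pure [scalarWord w (wordScalar q a * wordScalar q b)]
  | .scalarInv, [a] => PMF.pure [scalarWord w (wordScalar q a)⁻¹]
  | .randWord, [] =>
      (PMF.uniformOfFintype (Fin (2 ^ w))).bind fun x => PMF.pure [BitVec.ofFin x]
  | .randScalar, [] =>
      (PMF.uniformOfFintype (ZMod q)).bind fun k => PMF.pure [scalarWord w k]
  | .randUnit, [] =>
      (PMF.uniformOfFintype (ZMod q)ˣ).bind fun k => PMF.pure [scalarWord w (k : ZMod q)]
  | .hashToGroup, [n] => PMF.pure [S.enc (S.hashG n)]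
  | .comCommit, [m] => (S.com.commit m).bind fun p => PMF.pure [p.1, p.2]
  | .comOpen, [c, o, m] => PMF.pure [bit (S.com.opens c o m)]
  | .sigKeyGen, [] => S.sig.keyGen.bind fun p => PMF.pure [p.1, p.2]
  | .sigSign, sk :: m => (S.sig.sign sk m).bind fun x => PMF.pure [x]
  | .sigVerify, pk :: x :: m => PMF.pure [bit (S.sig.verify pk x m)]
  | .symKeyGen, [] => S.sym.keyGen.bind fun k => PMF.pure [k]
  | .symEnc, k :: m => (S.sym.enc k m).bind fun c => PMF.pure [c]
  | .symDec, [k, c] => PMF.pure (S.sym.dec k c)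
  | .timeFresh, [x] => PMF.pure [bit (S.fresh x)]
  | _, _ => PMF.pure []

/-! # Privacy Pass keys and tokens -/

/-- Secret key `esk`, uniform in the nonzero residues; the public key is `esk · g`. -/
def ppKeyGen (_S : System w q G) (g : G) : PMF (ZMod q × G) :=
  (PMF.uniformOfFintype (ZMod q)ˣ).bind fun k => PMF.pure ((k : ZMod q), mulG (k : ZMod q) g)

/-- Token verification: `x = esk · Hash(n)`. -/
def ppVerify (S : System w q G) (esk : ZMod q) (n x : BitVec w) : Bool :=
  decide (x = S.enc (mulG esk (S.hashG n)))

/-- Tests `X = esk · P` for words `P`, `X`. -/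
def testKey (S : System w q G) (esk : ZMod q) (P X : BitVec w) : Bool :=
  match S.decode P with
  | some P₁ => decide (X = S.enc (mulG esk P₁))
  | none => false

/-- The `i`-th nonce and the `i`-th token of the output of an adversary. -/
def outNonce (m : Store w) (i : ℕ) : BitVec w := m 1 [BitVec.ofNat w i]
def outToken (m : Store w) (i : ℕ) : BitVec w := m 2 [BitVec.ofNat w i]

/-- The common winning condition: the output (`x` in register `0`, the nonces in array `1`, the
tokens in array `2`) consists of more than `ctr` valid tokens with pairwise distinct nonces. -/
def Wins (S : System w q G) (esk : ZMod q) (ctr : ℕ) (m : Store w) : Prop :=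
  ctr < (m.reg 0).toNat ∧
  (∀ i < (m.reg 0).toNat, ∀ j < (m.reg 0).toNat, i ≠ j → outNonce m i ≠ outNonce m j) ∧
  ∀ i < (m.reg 0).toNat, S.ppVerify esk (outNonce m i) (outToken m i) = true

end System

/-! # Random oracle and proofs of equality of discrete logarithms -/

/-- The answers that the random oracle has given so far. -/
abbrev HashTable (w q : ℕ) : Type := List (BitVec w) → Option (ZMod q)

section Hash

variable {w q : ℕ} [Fact q.Prime] {G : Type} [AddCommGroup G]

/-- Random oracle with values in the residues modulo `q`, sampled lazily. -/
def hashQuery (x : List (BitVec w)) (H : HashTable w q) : PMF (ZMod q × HashTable w q) :=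
  match H x with
  | some c => PMF.pure (c, H)
  | none => (PMF.uniformOfFintype (ZMod q)).bind fun c =>
      PMF.pure (c, fun y => if y = x then some c else H y)

/-- The proof `(c, s)` that `Q₁ = sk · P₁` and `Q₂ = sk · P₂`. -/
def System.nizkDleq (S : System w q G) (P₁ Q₁ P₂ Q₂ : G) (sk : ZMod q) (H : HashTable w q) :
    PMF ((ZMod q × ZMod q) × HashTable w q) :=
  (PMF.uniformOfFintype (ZMod q)ˣ).bind fun k =>
  (hashQuery [BitVec.ofNat w q, S.enc P₁, S.enc Q₁, S.enc P₂, S.enc Q₂,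
      S.enc (mulG (k : ZMod q) P₁), S.enc (mulG (k : ZMod q) P₂)] H).bind fun r =>
  PMF.pure ((r.1, (k : ZMod q) - r.1 * sk), r.2)

end Hash

/-! # The score integrity game -/

/-- State of the sender in a tag issuance. -/
structure Session (w : ℕ) where
  vk : BitVec w
  receiver : BitVec w
  comS : BitVec w
  opS : BitVec w
  comR : BitVec w
  opR : BitVec w
  reported : Bool

/-- An endorsement tag, as sent by the accountability server.  The public parameters in it are
the two words `ppQ` and `ppG`. -/
structure Tag (w : ℕ) where
  comS : BitVec w
  comR : BitVec w
  time : BitVec w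
  rep : BitVec w
  ct : BitVec w
  ppQ : BitVec w
  ppG : BitVec w
  Q : BitVec w
  gen : BitVec w
  X : BitVec w
  sigma : BitVec w

/-- The part of a tag that is signed. -/
def Tag.message {w : ℕ} (t : Tag w) : List (BitVec w) :=
  [t.comS, t.comR, t.time, t.rep, t.ct, t.ppQ, t.ppG, t.Q, t.gen, t.X]

/-- State of the score integrity game. -/
structure ScState (w q : ℕ) where
  table : HashTable w q
  sessions : List (Session w)
  ctr : ℕ
  aborted : Bool

inductive HashOracle
  | hash

inductive ScOracle
  | hash | verify | issueTag | report

namespace System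

variable {w q : ℕ} [Fact q.Prime] {G : Type} [AddCommGroup G]

/-- First part of the tag issuance by the sender: the commitments. -/
def tagIssueFirst (S : System w q G) (vk receiver : BitVec w) : PMF (Session w) :=
  (S.com.commit vk).bind fun a =>
  (S.com.commit receiver).bind fun b =>
  PMF.pure { vk := vk, receiver := receiver, comS := a.1, opS := a.2, comR := b.1, opR := b.2,
             reported := false }

open Classical in
/-- Second part of the tag issuance by the sender, upon receipt of a tag: the proof and the blind
token `R`, or `none` (an error). -/
def tagIssueSecond (S : System w q G) (pk : BitVec w) (esk : ZMod q) (se : Session w)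
    (t : Tag w) (H : HashTable w q) :
    PMF (Option ((ZMod q × ZMod q) × G) × HashTable w q) :=
  match S.decode t.Q, S.decode t.gen, S.decode t.X with
  | some Q, some P, some X =>
    if S.fresh t.time = true ∧ se.comS = t.comS ∧ se.comR = t.comR ∧
        S.sig.verify pk t.sigma t.message = true ∧ X = mulG esk P then
      (S.nizkDleq P X Q (mulG esk Q) esk H).bind fun r =>
        PMF.pure (some (r.1, mulG esk Q), r.2)
    else PMF.pure (none, H)
  | _, _, _ => PMF.pure (none, H)

/-- Signature key pairs (signing key, verification key), sampled independently. -/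
def sigKeys (S : System w q G) : ℕ → PMF (List (BitVec w × BitVec w))
  | 0 => PMF.pure []
  | n + 1 => S.sig.keyGen.bind fun k => (S.sigKeys n).bind fun ks => PMF.pure (k :: ks)

/-- The oracle of the first phase: the random oracle. -/
def hashHandler (w q : ℕ) [Fact q.Prime] : Handler w HashOracle (HashTable w q)
  | .hash, x, H => (hashQuery x H).bind fun r => PMF.pure ([scalarWord w r.1], r.2)

/-- Oracle that starts the issuance of a tag for the `j`-th key (counted from `0`). -/
def issueTag (S : System w q G) (keys : List (BitVec w × BitVec w)) :
    List (BitVec w) → ScState w q → PMF (List (BitVec w) × ScState w q)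
  | [j, receiver], st =>
    match keys[j.toNat]? with
    | none => PMF.pure ([], st)
    | some key =>
      (S.tagIssueFirst key.2 receiver).bind fun se =>
      PMF.pure ([se.comS, se.comR, BitVec.ofNat w st.sessions.length],
        { st with sessions := st.sessions ++ [se] })
  | _, st => PMF.pure ([], st)

/-- Oracle that completes the issuance with index `i` for the tag supplied by the adversary.  The
answer is `1` followed by the openings, the proof and the blind token, or `0` for an error. -/
def report (S : System w q G) (pk : BitVec w) (esk : ZMod q) :
    List (BitVec w) → ScState w q → PMF (List (BitVec w) × ScState w q)
  | [i, comS, comR, time, rep, ct, ppQ, ppG, Q, gen, X, sigma], st =>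
    match st.sessions[i.toNat]? with
    | none => PMF.pure ([], { st with aborted := true })
    | some se =>
      if se.reported then PMF.pure ([], { st with aborted := true })
      else
        (S.tagIssueSecond pk esk se ⟨comS, comR, time, rep, ct, ppQ, ppG, Q, gen, X, sigma⟩
            st.table).bind fun r =>
        match r.1 with
        | none => PMF.pure ([0], { st with table := r.2 })
        | some (proof, R) =>
          PMF.pure ([1, se.opS, se.opR, scalarWord w proof.1, scalarWord w proof.2, S.enc R],
            { st with
              table := r.2
              sessions := st.sessions.set i.toNat { se with reported := true }
              ctr := st.ctr + 1 })
  | _, st => PMF.pure ([0], st)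

/-- The oracles of the score integrity game. -/
def scHandler (S : System w q G) (pk : BitVec w) (esk : ZMod q)
    (keys : List (BitVec w × BitVec w)) : Handler w ScOracle (ScState w q)
  | .hash, x, st => (hashQuery x st.table).bind fun r =>
      PMF.pure ([scalarWord w r.1], { st with table := r.2 })
  | .verify, [n, x], st => PMF.pure ([bit (S.ppVerify esk n x)], st)
  | .verify, _, st => PMF.pure ([], st)
  | .issueTag, x, st => S.issueTag keys x st
  | .report, x, st => S.report pk esk x st

end System

/-- An adversary in the score integrity game: a program for each of its two phases, and the number
of time units after which it is stopped.  The second phase starts with the memory that the first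
one has left. -/
structure ScAdversary (w : ℕ) where
  first : Cmd w HashOracle
  second : Cmd w ScOracle
  time : ℕ

/-- Complexity: running time plus length of the programs (counting the length is the usual
convention that keeps precomputed tables from being free). -/
def ScAdversary.complexity {w : ℕ} (A : ScAdversary w) : ℕ :=
  A.time + A.first.size + A.second.size

namespace System

variable {w q : ℕ} [Fact q.Prime] {G : Type} [AddCommGroup G]

open Classical in
/-- The score integrity game.  The adversary gets the public parameters `g`, `q` in the registers
`0`, `1`; it leaves the verification key `pk` of the server in register `0`, where it then gets the
public key of the sender. An adversary that runs out of time loses. -/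
def scIntegrity (S : System w q G) (A : ScAdversary w) : PMF Bool :=
  S.setup.bind fun g =>
  (A.first.exec S.pub (hashHandler w q) A.time
      ((Store.zero w).setRegs [0, 1] [S.enc g, BitVec.ofNat w q], fun _ => none)).bind fun
  | none => PMF.pure false
  | some (t, m, H) =>
    (S.ppKeyGen g).bind fun key =>
    (S.sigKeys S.numKeys).bind fun keys =>
    (A.second.exec S.pub (S.scHandler (m.reg 0) key.1 keys) t
        (m.set 0 [] (S.enc key.2),
          { table := H, sessions := [], ctr := 0, aborted := false })).bind fun
    | none => PMF.pure false
    | some (_, mem, st) => PMF.pure (decide (st.aborted = false ∧ S.Wins key.1 st.ctr mem))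

/-- Probability that the adversary wins the score integrity game. -/
def scIntegrityAdv (S : System w q G) (A : ScAdversary w) : ℝ≥0∞ := S.scIntegrity A true

end System

/-! # The one-more unforgeability game of Privacy Pass, with the additional test oracle -/

inductive OmufOracle
  | ver | sign

/-- An adversary in the one-more unforgeability game: a program, and the number of time units after
which it is stopped. -/
structure OmufAdversary (w : ℕ) where
  main : Cmd w OmufOracle
  time : ℕ

/-- Complexity: running time plus length of the program. -/
def OmufAdversary.complexity {w : ℕ} (B : OmufAdversary w) : ℕ := B.time + B.main.size

namespace System

variable {w q : ℕ} [Fact q.Prime] {G : Type} [AddCommGroup G]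

/-- The oracles `OVer` and `OSign`; the game state is the number of signing queries. -/
def omufHandler (S : System w q G) (esk : ZMod q) : Handler w OmufOracle ℕ
  | .ver, [P, X], n => PMF.pure ([bit (S.testKey esk P X)], n)
  | .ver, _, n => PMF.pure ([], n)
  | .sign, [Q], n =>
    match S.decode Q with
    | some Q₁ => PMF.pure ([S.enc (mulG esk Q₁)], n + 1)
    | none => PMF.pure ([], n + 1)
  | .sign, _, n => PMF.pure ([], n + 1)

open Classical in
/-- The one-more unforgeability game.  The adversary gets the public parameters `g`, `q` and the
public key in the registers `0`, `1`, `2`. An adversary that runs out of time loses. -/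
def omuf (S : System w q G) (B : OmufAdversary w) : PMF Bool :=
  S.setup.bind fun g =>
  (S.ppKeyGen g).bind fun key =>
  (B.main.exec S.pub (S.omufHandler key.1) B.time
      ((Store.zero w).setRegs [0, 1, 2] [S.enc g, BitVec.ofNat w q, S.enc key.2], 0)).bind fun
  | none => PMF.pure false
  | some (_, mem, ctr) => PMF.pure (decide (S.Wins key.1 ctr mem))

/-- Probability that the adversary wins the one-more unforgeability game. -/
def omufAdv (S : System w q G) (B : OmufAdversary w) : ℝ≥0∞ := S.omuf B true

end System

end Sandi

end

/-!
The reduction runs the adversary `A` against score integrity inside the one-more unforgeability game: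
`OVerify` and the test `X = esk • G'` are answered by `OVer`, the blind token by one call of `OSign`
(so the two counters agree), and the signature keys, of which there may be arbitrarily many, are
sampled when they are used first.  What remains are the proofs of equality of discrete logarithms,
which have to be produced without `esk`: the challenge `c` and the response `s` are drawn first, and
the random oracle is programmed at the point that belongs to the nonce `k = s + c * esk`.

If a program runs for `T` steps, then the random oracle has at most `T` entries, and one such attempt
fails with probability about `T / q` (the point is taken, or `k = 0`).  Accumulated over the reports,
this would exceed the permitted loss `1 / q`.  The comparison is therefore made in two parts.
After three attempts (`three_attempts_le`) the total failure contributes only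
`reportError q T = ((T + 1) / q) ^ 3` per report, hence at most `1 / q` altogether when `q > 4 * T ^ 2`.
Successful attempts yield no outcome with more than `1 / reportFactor q T` times its probability in
the genuine game.  Over the whole run this factor is at most `1 / (1 - 4 * T ^ 2 / q)`, and it is paid
for by an attack on `esk`: before the simulation, the reduction looks for the discrete logarithm of
a random shift of the public key with `2 * T` baby steps and `2 * T` giant steps.  This takes time
`O(T)`, it fails with probability at most `1 - 4 * T ^ 2 / q` (`searchCode_run`), and if it succeeds,
then the reduction computes one token without any signing query, and wins.  So the product of both
is at most `1` (`search_failure_le`), and the reduction loses with a probability at most `1 / q` above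
that with which `A` loses (`reduction_loss_le`).  If
`q ≤ 4 * T ^ 2`, then the search always succeeds.

The comparison of the simulated with the genuine execution is `Simulates.expect_exec_le`, an induction
over programs for expectations of arbitrary tests; the hypotheses on the individual oracles are
`hashCode_simulates`, `verifyCode_run`, `issueCode_run` and `reportCode_run`.  The memory of `A`
occupies the arrays with names below some `N`, and the reduction uses the names from `N` on.
-/

noncomputable section

namespace Sandi

/-! ### Expectations -/

/-- Expectation of a nonnegative function under a discrete distribution. -/
def expect {α : Type} (p : PMF α) (f : α → ℝ≥0∞) : ℝ≥0∞ := ∑' a, p a * f a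

section Expect

variable {α β : Type}

@[simp] theorem expect_pure (a : α) (f : α → ℝ≥0∞) : expect (PMF.pure a) f = f a := by
  classical
  unfold expect
  rw [tsum_eq_single a]
  · simp
  · intro b hb; simp [PMF.pure_apply, hb]

@[simp] theorem expect_bind (p : PMF α) (k : α → PMF β) (f : β → ℝ≥0∞) :
    expect (p.bind k) f = expect p fun a => expect (k a) f := by
  unfold expect
  simp only [PMF.bind_apply, ← ENNReal.tsum_mul_right, ← ENNReal.tsum_mul_left]
  rw [ENNReal.tsum_comm]
  simp only [mul_assoc]

theorem expect_mono_support {p : PMF α} {f g : α → ℝ≥0∞} (h : ∀ a ∈ p.support, f a ≤ g a) :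
    expect p f ≤ expect p g := by
  refine ENNReal.tsum_le_tsum fun a => ?_
  by_cases ha : p a = 0
  · simp [ha]
  · gcongr; exact h a ((PMF.mem_support_iff _ _).2 ha)

theorem expect_mono {p : PMF α} {f g : α → ℝ≥0∞} (h : ∀ a, f a ≤ g a) :
    expect p f ≤ expect p g :=
  expect_mono_support fun a _ => h a

@[simp] theorem expect_const (p : PMF α) (c : ℝ≥0∞) : expect p (fun _ => c) = c := by
  unfold expect
  rw [ENNReal.tsum_mul_right, p.tsum_coe, one_mul]

theorem expect_add (p : PMF α) (f g : α → ℝ≥0∞) :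
    expect p (fun a => f a + g a) = expect p f + expect p g := by
  unfold expect
  simp only [mul_add, ENNReal.tsum_add]

theorem expect_mul_left (p : PMF α) (c : ℝ≥0∞) (f : α → ℝ≥0∞) :
    expect p (fun a => c * f a) = c * expect p f := by
  unfold expect
  rw [← ENNReal.tsum_mul_left]
  exact tsum_congr fun a => by ring

theorem expect_le_one {p : PMF α} {f : α → ℝ≥0∞} (h : ∀ a, f a ≤ 1) : expect p f ≤ 1 :=
  (expect_mono h).trans (expect_const p 1).le

theorem one_le_expect {p : PMF α} {f : α → ℝ≥0∞} (h : ∀ a, 1 ≤ f a) : 1 ≤ expect p f :=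
  (expect_const p 1).ge.trans (expect_mono h)

theorem expect_comm (p : PMF α) (p' : PMF β) (f : α → β → ℝ≥0∞) :
    expect p (fun a => expect p' (f a)) = expect p' fun b => expect p fun a => f a b := by
  unfold expect
  simp only [← ENNReal.tsum_mul_left]
  rw [ENNReal.tsum_comm]
  exact tsum_congr fun b => tsum_congr fun a => by ring

theorem expect_uniform [Fintype α] [Nonempty α] (f : α → ℝ≥0∞) :
    expect (PMF.uniformOfFintype α) f = (Fintype.card α : ℝ≥0∞)⁻¹ * ∑ a, f a := by
  unfold expect
  rw [tsum_fintype, Finset.mul_sum]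
  simp

end Expect

/-! ### Loop-free programs -/

section Programs

variable {w : ℕ} {O O' σ σ' : Type}

/-- Programs without loops. -/
def Cmd.LoopFree : Cmd w O → Prop
  | .seq c d => c.LoopFree ∧ d.LoopFree
  | .ite _ c d => c.LoopFree ∧ d.LoopFree
  | .loop _ _ => False
  | _ => True

/-- Effect of a loop-free program when time is not accounted for (a loop is given no effect). -/
def Cmd.run (pub : PubOp → List (BitVec w) → PMF (List (BitVec w))) (orc : Handler w O σ) :
    Cmd w O → Store w × σ → PMF (Store w × σ)
  | .skip, s => PMF.pure s
  | .const r v, s => PMF.pure (s.1.set r [] v, s.2)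
  | .word f r a b, s => PMF.pure (s.1.set r [] (f.eval (s.1.reg a) (s.1.reg b)), s.2)
  | .load r arr idx, s => PMF.pure (s.1.set r [] (s.1 arr (idx.map s.1.reg)), s.2)
  | .store arr idx r, s => PMF.pure (s.1.set arr (idx.map s.1.reg) (s.1.reg r), s.2)
  | .pub f out args, s =>
      (pub f (args.map s.1.reg)).bind fun ans => PMF.pure (s.1.setRegs out ans, s.2)
  | .call o out args, s =>
      (orc o (args.map s.1.reg) s.2).bind fun ans => PMF.pure (s.1.setRegs out ans.1, ans.2)
  | .seq c d, s => (c.run pub orc s).bind (d.run pub orc)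
  | .ite r c d, s => if s.1.reg r ≠ 0 then c.run pub orc s else d.run pub orc s
  | .loop _ _, s => PMF.pure s

theorem expect_spend {α : Type} {k t : ℕ} (h : k ≤ t) (f : ℕ → PMF (Option α))
    (Φ : Option α → ℝ≥0∞) : expect (spend k t f) Φ = expect (f (t - k)) Φ := by
  simp [spend, Nat.not_lt.2 h]

/-- A loop-free program that has at least as many time units as its length completes, and uses no
more time than that. -/
theorem Cmd.expect_exec_le_run (pub : PubOp → List (BitVec w) → PMF (List (BitVec w)))
    (orc : Handler w O σ) (c : Cmd w O) (hc : c.LoopFree) :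
    ∀ (t : ℕ) (s : Store w × σ) (Φ : Option (ℕ × Store w × σ) → ℝ≥0∞)
      (Ψ : Store w × σ → ℝ≥0∞), c.size ≤ t →
      (∀ t' s', t ≤ t' + c.size → Φ (some (t', s')) ≤ Ψ s') →
      expect (c.exec pub orc t s) Φ ≤ expect (c.run pub orc s) Ψ := by
  induction c with
  | skip =>
    intro t s Φ Ψ ht h
    simp only [Cmd.size] at ht h
    simpa [Cmd.exec, Cmd.run, expect_spend ht] using h _ _ (by omega)
  | const =>
    intro t s Φ Ψ ht h
    simp only [Cmd.size] at ht h
    simpa [Cmd.exec, Cmd.run, expect_spend ht] using h _ _ (by omega)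
  | word =>
    intro t s Φ Ψ ht h
    simp only [Cmd.size] at ht h
    simpa [Cmd.exec, Cmd.run, expect_spend ht] using h _ _ (by omega)
  | load =>
    intro t s Φ Ψ ht h
    simp only [Cmd.size] at ht h
    simpa [Cmd.exec, Cmd.run, expect_spend ht] using h _ _ (by omega)
  | store =>
    intro t s Φ Ψ ht h
    simp only [Cmd.size] at ht h
    simpa [Cmd.exec, Cmd.run, expect_spend ht] using h _ _ (by omega)
  | pub f out args =>
    intro t s Φ Ψ ht h
    simp only [Cmd.size] at ht h
    simp only [Cmd.exec, Cmd.run, expect_spend ht, expect_bind, expect_pure]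
    exact expect_mono fun a => h _ _ (by omega)
  | call o out args =>
    intro t s Φ Ψ ht h
    simp only [Cmd.size] at ht h
    simp only [Cmd.exec, Cmd.run, expect_spend ht, expect_bind, expect_pure]
    exact expect_mono fun a => h _ _ (by omega)
  | seq c d ihc ihd =>
    intro t s Φ Ψ ht h
    simp only [Cmd.size] at ht h
    simp only [Cmd.exec, Cmd.run, expect_bind]
    refine ihc hc.1 t s _ _ (by omega) fun t' s' ht' => ?_
    exact ihd hc.2 t' s' _ _ (by omega) fun t₂ s₂ ht₂ => h _ _ (by omega)
  | ite r c d ihc ihd =>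
    intro t s Φ Ψ ht h
    simp only [Cmd.size] at ht h
    simp only [Cmd.exec, Cmd.run, expect_spend (show 1 ≤ t by omega)]
    split_ifs
    · exact ihc hc.1 _ s _ _ (by omega) fun t' s' ht' => h _ _ (by omega)
    · exact ihd hc.2 _ s _ _ (by omega) fun t' s' ht' => h _ _ (by omega)
  | loop => exact hc.elim

/-! ### Translation of programs

The memory of the translated program consists of the memory of the given one, in the arrays with
names below `N`, and of private arrays.  The private arrays with names from `N` to `N + 19` persist
between two oracle calls; those with names from `N + 20` on are scratch space. -/

/-- All names of arrays and registers in the program are below `N`. -/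
def Cmd.Below (N : ℕ) : Cmd w O → Prop
  | .skip => True
  | .const r _ => r < N
  | .word _ r a b => r < N ∧ a < N ∧ b < N
  | .load r arr idx => r < N ∧ arr < N ∧ ∀ a ∈ idx, a < N
  | .store arr idx r => arr < N ∧ (∀ a ∈ idx, a < N) ∧ r < N
  | .pub _ out args => (∀ a ∈ out, a < N) ∧ ∀ a ∈ args, a < N
  | .call _ out args => (∀ a ∈ out, a < N) ∧ ∀ a ∈ args, a < N
  | .seq c d => c.Below N ∧ d.Below N
  | .ite r c d => r < N ∧ c.Below N ∧ d.Below N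
  | .loop r c => r < N ∧ c.Below N

theorem exists_list_lt (l : List ℕ) : ∃ N, ∀ a ∈ l, a < N :=
  ⟨l.sum + 1, fun a ha => Nat.lt_succ_of_le (List.single_le_sum (by simp) a ha)⟩

theorem Cmd.Below.mono {N M : ℕ} (h : N ≤ M) : ∀ {c : Cmd w O}, c.Below N → c.Below M := by
  intro c
  induction c with
  | seq c d ihc ihd => exact fun hc => ⟨ihc hc.1, ihd hc.2⟩
  | ite r c d ihc ihd => exact fun hc => ⟨hc.1.trans_le h, ihc hc.2.1, ihd hc.2.2⟩
  | loop r c ih => exact fun hc => ⟨hc.1.trans_le h, ih hc.2⟩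
  | _ => simp only [Cmd.Below]; grind

theorem Cmd.exists_below (c : Cmd w O) : ∃ N, c.Below N := by
  induction c with
  | skip => exact ⟨0, trivial⟩
  | const r => exact ⟨r + 1, Nat.lt_succ_self r⟩
  | word f r a b => exact ⟨r + a + b + 1, by simp only [Cmd.Below]; omega⟩
  | load r arr idx =>
    obtain ⟨N, hN⟩ := exists_list_lt idx
    exact ⟨r + arr + N + 1, by omega, by omega, fun a ha => by have := hN a ha; omega⟩
  | store arr idx r =>
    obtain ⟨N, hN⟩ := exists_list_lt idx
    exact ⟨r + arr + N + 1, by omega, fun a ha => by have := hN a ha; omega, by omega⟩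
  | pub f out args =>
    obtain ⟨N, hN⟩ := exists_list_lt out
    obtain ⟨M, hM⟩ := exists_list_lt args
    exact ⟨N + M, fun a ha => by have := hN a ha; omega, fun a ha => by have := hM a ha; omega⟩
  | call f out args =>
    obtain ⟨N, hN⟩ := exists_list_lt out
    obtain ⟨M, hM⟩ := exists_list_lt args
    exact ⟨N + M, fun a ha => by have := hN a ha; omega, fun a ha => by have := hM a ha; omega⟩
  | seq c d ihc ihd =>
    obtain ⟨N, hN⟩ := ihc
    obtain ⟨M, hM⟩ := ihd
    exact ⟨N + M, hN.mono (by omega), hM.mono (by omega)⟩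
  | ite r c d ihc ihd =>
    obtain ⟨N, hN⟩ := ihc
    obtain ⟨M, hM⟩ := ihd
    exact ⟨r + 1 + N + M, by omega, hN.mono (by omega), hM.mono (by omega)⟩
  | loop r c ih =>
    obtain ⟨N, hN⟩ := ih
    exact ⟨r + 1 + N, by omega, hN.mono (by omega)⟩

/-- The two memories have the same contents in the arrays with names below `N`. -/
def AgreeBelow (N : ℕ) (m m' : Store w) : Prop := ∀ a < N, ∀ i, m' a i = m a i

theorem AgreeBelow.refl (N : ℕ) (m : Store w) : AgreeBelow N m m := fun _ _ _ => rfl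

theorem AgreeBelow.trans {N : ℕ} {m₁ m₂ m₃ : Store w} (h : AgreeBelow N m₁ m₂)
    (h' : AgreeBelow N m₂ m₃) : AgreeBelow N m₁ m₃ :=
  fun a ha i => (h' a ha i).trans (h a ha i)

theorem AgreeBelow.mono {N M : ℕ} {m m' : Store w} (h : AgreeBelow M m m') (hNM : N ≤ M) :
    AgreeBelow N m m' :=
  fun a ha i => h a (ha.trans_le hNM) i

theorem AgreeBelow.reg {N : ℕ} {m m' : Store w} (h : AgreeBelow N m m') {a : ℕ} (ha : a < N) :
    m'.reg a = m.reg a := h a ha []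

theorem AgreeBelow.map_reg {N : ℕ} {m m' : Store w} (h : AgreeBelow N m m') {l : List ℕ}
    (hl : ∀ a ∈ l, a < N) : l.map m'.reg = l.map m.reg :=
  List.map_congr_left fun a ha => h.reg (hl a ha)

theorem AgreeBelow.set {N : ℕ} {m m' : Store w} (h : AgreeBelow N m m') (a : ℕ)
    (i : List (BitVec w)) (v : BitVec w) : AgreeBelow N (m.set a i v) (m'.set a i v) := by
  intro b hb j
  simp only [Store.set]
  split_ifs
  · rfl
  · exact h b hb j

theorem AgreeBelow.setRegs {N : ℕ} : ∀ (out : List ℕ) (ans : List (BitVec w)) {m m' : Store w},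
    AgreeBelow N m m' → AgreeBelow N (m.setRegs out ans) (m'.setRegs out ans)
  | [], _, _, _, h => h
  | r :: rs, ans, _, _, h => AgreeBelow.setRegs rs ans.tail (h.set r [] _)

theorem Store.set_above {m : Store w} {r a : ℕ} {i j : List (BitVec w)} {v : BitVec w}
    (h : a ≠ r) : (m.set r i v) a j = m a j := by
  simp [Store.set, h]

theorem Store.setRegs_above : ∀ (out : List ℕ) (ans : List (BitVec w)) {m : Store w} {a : ℕ}
    {j : List (BitVec w)}, a ∉ out → (m.setRegs out ans) a j = m a j
  | [], _, _, _, _, _ => rfl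
  | r :: rs, ans, m, a, j, h => by
    rw [Store.setRegs, Store.setRegs_above rs ans.tail (fun h' => h (List.mem_cons_of_mem _ h'))]
    exact Store.set_above fun h' => h (by rw [h']; exact List.mem_cons_self)

/-- Copy the registers `src, src + 1, …` (`k` of them) into the registers `out`; if `out` is
longer, the remaining registers become zero. -/
def copyOut : ℕ → ℕ → List ℕ → Cmd w O
  | _, _, [] => .skip
  | src, 0, r :: rs => .seq (.const r 0) (copyOut src 0 rs)
  | src, k + 1, r :: rs => .seq (.load r src []) (copyOut (src + 1) k rs)

theorem copyOut_loopFree : ∀ (out : List ℕ) (src k : ℕ),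
    (copyOut (w := w) (O := O) src k out).LoopFree
  | [], _, _ => trivial
  | _ :: rs, src, 0 => ⟨trivial, copyOut_loopFree rs src 0⟩
  | _ :: rs, src, k + 1 => ⟨trivial, copyOut_loopFree rs (src + 1) k⟩

theorem copyOut_size : ∀ (out : List ℕ) (src k : ℕ),
    (copyOut (w := w) (O := O) src k out).size = 1 + 2 * out.length
  | [], _, _ => by simp [copyOut, Cmd.size]
  | _ :: rs, src, 0 => by simp [copyOut, Cmd.size, copyOut_size rs]; ring
  | _ :: rs, src, k + 1 => by simp [copyOut, Cmd.size, copyOut_size rs]; ring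

/-- The registers `src, …, src + k - 1` hold the answer `ans`, missing words counting as `0`. -/
def HoldsAnswer (src k : ℕ) (ans : List (BitVec w)) (m : Store w) : Prop :=
  ans.length ≤ k ∧ ∀ j < k, m.reg (src + j) = ans.getD j 0

theorem copyOut_run (pub : PubOp → List (BitVec w) → PMF (List (BitVec w)))
    (orc : Handler w O σ) : ∀ (out : List ℕ) (src k : ℕ) (ans : List (BitVec w)) (m : Store w)
    (s : σ), (∀ r ∈ out, r < src) → HoldsAnswer src k ans m →
    (copyOut src k out).run pub orc (m, s) = PMF.pure (m.setRegs out ans, s)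
  | [], _, _, _, _, _, _, _ => rfl
  | r :: rs, src, 0, ans, m, s, hlt, h => by
    obtain rfl : ans = [] := List.length_eq_zero_iff.1 (Nat.le_zero.1 h.1)
    simp only [copyOut, Cmd.run, PMF.pure_bind, Store.setRegs]
    exact copyOut_run pub orc rs src 0 [] _ s (fun a ha => hlt a (List.mem_cons_of_mem _ ha))
      ⟨le_rfl, fun j hj => absurd hj (Nat.not_lt_zero j)⟩
  | r :: rs, src, k + 1, ans, m, s, hlt, h => by
    simp only [copyOut, Cmd.run, PMF.pure_bind, Store.setRegs]
    have h0 : m src (List.map m.reg []) = ans.headD 0 := by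
      have := h.2 0 (Nat.succ_pos k)
      cases ans <;> simpa [Store.reg] using this
    rw [h0]
    have hr := hlt r List.mem_cons_self
    refine copyOut_run pub orc rs (src + 1) k ans.tail _ s
      (fun a ha => (hlt a (List.mem_cons_of_mem _ ha)).trans (Nat.lt_succ_self _))
      ⟨?_, fun j hj => ?_⟩
    · have := h.1
      simp only [List.length_tail]; omega
    · have := h.2 (j + 1) (Nat.succ_lt_succ hj)
      have h' : (m.set r [] (ans.headD 0)).reg (src + 1 + j) = m.reg (src + (j + 1)) := by
        rw [show src + 1 + j = src + (j + 1) by ring]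
        exact Store.set_above (by omega)
      rw [h', this]
      cases ans <;> simp

end Programs

section Simulation

variable {w : ℕ} {O O' ι κ σ σ' : Type}

/-- Number of private arrays and registers that persist between two oracle calls. -/
abbrev numPersistent : ℕ := 20

/-- Number of registers that hold the answer of a simulated oracle call. -/
abbrev numAnswers : ℕ := 6

/-- The program `c` with every oracle call replaced by the program `core` that simulates it; that
program leaves the answer in the registers `N + 20`, …, `N + 25`. -/
def Cmd.translate (N : ℕ) (core : O → List ℕ → Cmd w O') : Cmd w O → Cmd w O'
  | .skip => .skip
  | .const r v => .const r v
  | .word f r a b => .word f r a b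
  | .load r arr idx => .load r arr idx
  | .store arr idx r => .store arr idx r
  | .pub f out args => .pub f out args
  | .call o out args => .seq (core o args) (copyOut (N + numPersistent) numAnswers out)
  | .seq c d => .seq (c.translate N core) (d.translate N core)
  | .ite r c d => .ite r (c.translate N core) (d.translate N core)
  | .loop r c => .loop r (c.translate N core)

/-- The private memory: the invariant `Inv` depends only on the persistent private arrays, and
survives the passing of time. -/
def PrivateInv (N : ℕ) (Inv : ℕ → σ → κ → Store w → σ' → Prop) : Prop :=
  ∀ {t t' s k m m' n}, Inv t s k m n → (∀ a, N ≤ a → a < N + numPersistent → ∀ i, m' a i = m a i) →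
    t' ≤ t → Inv t' s k m' n

/-- A property of game states that, once true, remains true. -/
def Persistent (h : ι → Handler w O σ) (dead : σ → Prop) : Prop :=
  ∀ (i : ι) (o : O) (x : List (BitVec w)) (s : σ) (F : List (BitVec w) × σ → ℝ≥0∞), dead s →
    (∀ a s', dead s' → 1 ≤ F (a, s')) → 1 ≤ expect (h i o x s) F

/-- The programs `core` simulate the oracles `h` by means of the oracles `h'`.  The handler `h` has
a hidden parameter of type `ι`; `R k` is its distribution given the state `k` of a lazy sampler.
If a test `Ψ` exceeds a test `F` by at most `ε` in corresponding states after the call, then the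
expected value of `Ψ` after the simulated call, multiplied by `lam`, exceeds that of `F` after the
genuine call by at most `ε + η`.  Genuine calls may also lead to dead states, which have no
counterpart in the simulation, and where `F` is at least `1`. -/
def Simulates (pub : PubOp → List (BitVec w) → PMF (List (BitVec w))) (h : ι → Handler w O σ)
    (h' : Handler w O' σ') (R : κ → PMF ι) (N : ℕ) (Inv : ℕ → σ → κ → Store w → σ' → Prop)
    (dead : σ → Prop) (core : O → List ℕ → Cmd w O') (lam η : ℝ≥0∞) : Prop :=
  ∀ (o : O) (args : List ℕ), (∀ a ∈ args, a < N) →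
  ∀ (t : ℕ) (s : σ) (k : κ) (m : Store w) (n : σ'), Inv (t + 1) s k m n →
  ∀ (Ψ : Store w × σ' → ℝ≥0∞) (F : ι → List (BitVec w) × σ → ℝ≥0∞) (ε : ℝ≥0∞), (∀ x, Ψ x ≤ 1) →
  (∀ i a s', dead s' → 1 ≤ F i (a, s')) →
  (∀ k' s' m' n' ans, AgreeBelow N m m' → HoldsAnswer (N + numPersistent) numAnswers ans m' →
    Inv t s' k' m' n' → Ψ (m', n') ≤ expect (R k') (fun i => F i (ans, s')) + ε) →
  lam * expect ((core o args).run pub h' (m, n)) Ψ ≤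
    expect (R k) (fun i => expect (h i o (args.map m.reg) s) (F i)) + ε + η

theorem one_le_expect_spend {α : Type} (k t : ℕ) (p : ℕ → PMF (Option α)) (f : Option α → ℝ≥0∞)
    (h0 : 1 ≤ f none) (h : ∀ t, 1 ≤ expect (p t) f) : 1 ≤ expect (spend k t p) f := by
  unfold spend
  split_ifs
  · simpa using h0
  · exact h _

theorem one_le_expect_repeatWhile {dead : σ → Prop} {test : Store w × σ → Bool}
    {body : ℕ → Store w × σ → PMF (Option (ℕ × Store w × σ))}
    {f : Option (ℕ × Store w × σ) → ℝ≥0∞} (h0 : 1 ≤ f none)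
    (h1 : ∀ t m s, dead s → 1 ≤ f (some (t, m, s)))
    (hbody : ∀ (t : ℕ) (m : Store w) (s : σ) (f : Option (ℕ × Store w × σ) → ℝ≥0∞), dead s →
      1 ≤ f none → (∀ t m s, dead s → 1 ≤ f (some (t, m, s))) → 1 ≤ expect (body t (m, s)) f) :
    ∀ (l t : ℕ) (m : Store w) (s : σ), dead s →
      1 ≤ expect (repeatWhile test body l t (m, s)) f
  | 0, _, _, _, _ => by simpa [repeatWhile] using h0
  | l + 1, t, m, s, hs => by
    refine one_le_expect_spend _ _ _ _ h0 fun t => ?_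
    split_ifs
    · simp only [expect_bind]
      exact hbody t m s _ hs (by simpa using h0) fun t m s hs =>
        one_le_expect_repeatWhile h0 h1 hbody l t m s hs
    · simpa using h1 _ _ _ hs

theorem Persistent.one_le_expect_exec {h : ι → Handler w O σ} {dead : σ → Prop}
    (hdead : Persistent h dead) (pub : PubOp → List (BitVec w) → PMF (List (BitVec w))) (i : ι)
    (c : Cmd w O) :
    ∀ (t : ℕ) (m : Store w) (s : σ) (f : Option (ℕ × Store w × σ) → ℝ≥0∞), dead s → 1 ≤ f none →
      (∀ t m s, dead s → 1 ≤ f (some (t, m, s))) → 1 ≤ expect (c.exec pub (h i) t (m, s)) f := by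
  induction c with
  | pub g out args =>
    intro t m s f hs h0 h1
    refine one_le_expect_spend _ _ _ _ h0 fun t => ?_
    simp only [expect_bind, expect_pure]
    exact one_le_expect fun a => h1 _ _ _ hs
  | call o out args =>
    intro t m s f hs h0 h1
    refine one_le_expect_spend _ _ _ _ h0 fun t => ?_
    simp only [expect_bind, expect_pure]
    exact hdead i o _ s _ hs fun a s' hs' => h1 _ _ _ hs'
  | seq c d ihc ihd =>
    intro t m s f hs h0 h1
    simp only [Cmd.exec, expect_bind]
    refine ihc t m s _ hs (by simpa using h0) fun t m s hs => ?_
    exact ihd t m s f hs h0 h1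
  | ite r c d ihc ihd =>
    intro t m s f hs h0 h1
    refine one_le_expect_spend _ _ _ _ h0 fun t => ?_
    split_ifs
    · exact ihc _ _ _ _ hs h0 h1
    · exact ihd _ _ _ _ hs h0 h1
  | loop r c ih =>
    intro t m s f hs h0 h1
    exact one_le_expect_repeatWhile h0 h1 (fun t m s f hs h0 h1 => ih t m s f hs h0 h1) t t m s hs
  | _ =>
    intro t m s f hs h0 h1
    refine one_le_expect_spend _ _ _ _ h0 fun t => ?_
    simpa using h1 _ _ _ hs

section

variable {pub : PubOp → List (BitVec w) → PMF (List (BitVec w))} {h : ι → Handler w O σ}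
  {h' : Handler w O' σ'} {R : κ → PMF ι} {N : ℕ} {Inv : ℕ → σ → κ → Store w → σ' → Prop}
  {dead : σ → Prop} {core : O → List ℕ → Cmd w O'} {lam η : ℝ≥0∞} {K e : ℕ}

/-- The comparison of tests on the results of two programs, of which the first has the time `t`
left, and the second one `K` times as much and `e` more. -/
structure Compare (R : κ → PMF ι) (N : ℕ) (Inv : ℕ → σ → κ → Store w → σ' → Prop)
    (dead : σ → Prop) (lam η : ℝ≥0∞) (K e : ℕ)
    (Φ : Option (ℕ × Store w × σ') → ℝ≥0∞)
    (f : ι → Option (ℕ × Store w × σ) → ℝ≥0∞) : Prop where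
  le_one : ∀ x, Φ x ≤ 1
  le_none : ∀ i, 1 ≤ f i none
  le_dead : ∀ i t m s, dead s → 1 ≤ f i (some (t, m, s))
  le_some : ∀ t tB s k m mB n, K * t + e ≤ tB → AgreeBelow N m mB → Inv t s k mB n →
    lam ^ t * Φ (some (tB, mB, n)) ≤ expect (R k) (fun i => f i (some (t, m, s))) + η * t

theorem Compare.le_of_none {Φ : Option (ℕ × Store w × σ') → ℝ≥0∞}
    {f : ι → Option (ℕ × Store w × σ) → ℝ≥0∞} (hc : Compare R N Inv dead lam η K e Φ f)
    (hlam : lam ≤ 1) (t : ℕ) (k : κ) (p : PMF (Option (ℕ × Store w × σ'))) (x : ℝ≥0∞) :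
    lam ^ t * expect p Φ ≤ expect (R k) (fun i => f i none) + x :=
  calc lam ^ t * expect p Φ ≤ 1 * 1 :=
        mul_le_mul' (pow_le_one₀ zero_le hlam) (expect_le_one hc.le_one)
    _ = 1 := one_mul 1
    _ ≤ expect (R k) (fun i => f i none) := one_le_expect hc.le_none
    _ ≤ _ := le_self_add

/-- An elementary step, which takes `c` units of time in both programs. -/
theorem Compare.step {Φ : Option (ℕ × Store w × σ') → ℝ≥0∞}
    {f : ι → Option (ℕ × Store w × σ) → ℝ≥0∞} (hc : Compare R N Inv dead lam η K e Φ f)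
    (hlam : lam ≤ 1) (hK : 1 ≤ K) {c t tB : ℕ} (ht : K * t + e ≤ tB) (k : κ)
    (p : ℕ → PMF (Option (ℕ × Store w × σ'))) (p' : ι → ℕ → PMF (Option (ℕ × Store w × σ)))
    (hstep : ∀ t' tB', t' ≤ t → K * t' + e ≤ tB' →
      lam ^ t' * expect (p tB') Φ ≤ expect (R k) (fun i => expect (p' i t') (f i)) + η * t') :
    lam ^ t * expect (spend c tB p) Φ ≤
      expect (R k) (fun i => expect (spend c t (p' i)) (f i)) + η * t := by
  by_cases hct : t < c
  · simp only [spend, hct, if_true, expect_pure]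
    exact hc.le_of_none hlam _ _ _ _
  · have hle : c ≤ t := not_lt.1 hct
    have htB : t ≤ tB :=
      (Nat.le_mul_of_pos_left _ hK).trans ((Nat.le_add_right _ _).trans ht)
    have hKt : K * (t - c) + e ≤ tB - c := by
      rw [Nat.mul_sub]
      have : c ≤ K * c := Nat.le_mul_of_pos_left _ hK
      have : K * c ≤ K * t := Nat.mul_le_mul_left _ hle
      omega
    simp only [expect_spend hle, expect_spend (hle.trans htB)]
    calc lam ^ t * expect (p (tB - c)) Φ ≤ lam ^ (t - c) * expect (p (tB - c)) Φ :=
          mul_le_mul' (pow_le_pow_of_le_one zero_le hlam (Nat.sub_le _ _)) le_rfl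
      _ ≤ _ := hstep (t - c) (tB - c) (Nat.sub_le _ _) hKt
      _ ≤ _ := by gcongr; exact Nat.sub_le _ _

/-- Simulation of the oracle calls of a program, accumulated over its execution.  Every call takes at
least one of the `t` time units, hence the exponent of `lam` and the factor of `η`. -/
theorem Simulates.expect_exec_le (hsim : Simulates pub h h' R N Inv dead core lam η)
    (hInv : PrivateInv N Inv) (hdead : Persistent h dead) (hlam : lam ≤ 1) (hK : 1 ≤ K)
    (hfree : ∀ o args, (core o args).LoopFree)
    (hsize : ∀ o args, (core o args).size + 4 ≤ K * (1 + args.length)) (hK2 : 2 ≤ K)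
    (c : Cmd w O) (hcN : c.Below N) :
    ∀ (t tB : ℕ) (s : σ) (k : κ) (m mB : Store w) (n : σ')
      (Φ : Option (ℕ × Store w × σ') → ℝ≥0∞) (f : ι → Option (ℕ × Store w × σ) → ℝ≥0∞),
      K * t + e ≤ tB → AgreeBelow N m mB → Inv t s k mB n → Compare R N Inv dead lam η K e Φ f →
      lam ^ t * expect ((c.translate N core).exec pub h' tB (mB, n)) Φ ≤
        expect (R k) (fun i => expect (c.exec pub (h i) t (m, s)) (f i)) + η * t := by
  induction c with
  | skip =>
    intro t tB s k m mB n Φ f ht hag hi hc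
    refine hc.step hlam hK ht k _ _ fun t' tB' htt' ht' => ?_
    simp only [expect_pure]
    exact hc.le_some _ _ _ _ _ _ _ ht' hag (hInv hi (fun _ _ _ _ => rfl) htt')
  | const r v =>
    intro t tB s k m mB n Φ f ht hag hi hc
    refine hc.step hlam hK ht k _ _ fun t' tB' htt' ht' => ?_
    simp only [expect_pure]
    have hr : r < N := hcN
    exact hc.le_some _ _ _ _ _ _ _ ht' (hag.set r [] v)
      (hInv hi (fun a ha _ j => Store.set_above (by omega)) htt')
  | word g r a b =>
    intro t tB s k m mB n Φ f ht hag hi hc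
    refine hc.step hlam hK ht k _ _ fun t' tB' htt' ht' => ?_
    simp only [expect_pure]
    obtain ⟨hr, ha, hb⟩ := hcN
    rw [hag.reg ha, hag.reg hb]
    exact hc.le_some _ _ _ _ _ _ _ ht' (hag.set r [] _)
      (hInv hi (fun a ha _ j => Store.set_above (by omega)) htt')
  | load r arr idx =>
    intro t tB s k m mB n Φ f ht hag hi hc
    refine hc.step hlam hK ht k _ _ fun t' tB' htt' ht' => ?_
    simp only [expect_pure]
    obtain ⟨hr, ha, hidx⟩ := hcN
    rw [hag.map_reg hidx, hag arr ha]
    exact hc.le_some _ _ _ _ _ _ _ ht' (hag.set r [] _)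
      (hInv hi (fun a ha _ j => Store.set_above (by omega)) htt')
  | store arr idx r =>
    intro t tB s k m mB n Φ f ht hag hi hc
    refine hc.step hlam hK ht k _ _ fun t' tB' htt' ht' => ?_
    simp only [expect_pure]
    obtain ⟨ha, hidx, hr⟩ := hcN
    rw [hag.map_reg hidx, hag.reg hr]
    exact hc.le_some _ _ _ _ _ _ _ ht' (hag.set _ _ _)
      (hInv hi (fun a ha _ j => Store.set_above (by omega)) htt')
  | pub g out args =>
    intro t tB s k m mB n Φ f ht hag hi hc
    refine hc.step hlam hK ht k _ _ fun t' tB' htt' ht' => ?_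
    simp only [expect_pure, expect_bind]
    obtain ⟨hout, hargs⟩ := hcN
    rw [hag.map_reg hargs, expect_comm, ← expect_mul_left, ← expect_const (pub g _) (η * t'),
      ← expect_add]
    refine expect_mono fun ans => ?_
    exact hc.le_some _ _ _ _ _ _ _ ht' (hag.setRegs _ _)
      (hInv hi (fun a ha _ j => Store.setRegs_above _ _ fun h' => by
        have := hout a h'; omega) htt')
  | call o out args =>
    intro t tB s k m mB n Φ f ht hag hi hc
    obtain ⟨hout, hargs⟩ := hcN
    by_cases hct : t < 1 + out.length + args.length
    · simp only [Cmd.exec, spend, hct, if_true, expect_pure]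
      exact hc.le_of_none hlam _ _ _ _
    obtain ⟨u, rfl⟩ := Nat.exists_eq_add_of_le (not_lt.1 hct)
    set cost := 1 + out.length + args.length with hcost
    have hblock : ((core o args).seq (copyOut (N + numPersistent) numAnswers out)).size
        ≤ K * cost := by
      have h1 := hsize o args
      have h2 : 2 * out.length ≤ K * out.length := Nat.mul_le_mul_right _ hK2
      simp only [Cmd.size, copyOut_size, hcost]
      calc _ ≤ K * (1 + args.length) + K * out.length := by omega
        _ = _ := by ring
    have hKtB : K * cost + (K * u + e) ≤ tB := by rw [← add_assoc, ← mul_add]; exact ht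
    -- the least favourable amount of time that the simulated call can leave
    let Ψ : Store w × σ' → ℝ≥0∞ := fun x => ⨆ t' : {t' : ℕ // K * u + e ≤ t'}, Φ (some (t'.1, x))
    have hΨ : ∀ x, Ψ x ≤ 1 := fun x => iSup_le fun t' => hc.le_one _
    have hrun := Cmd.expect_exec_le_run pub h'
      ((core o args).seq (copyOut (N + numPersistent) numAnswers out))
      ⟨hfree o args, copyOut_loopFree _ _ _⟩ tB (mB, n) Φ Ψ (by omega)
      (fun t' s' ht' => le_iSup (fun t' : {t' : ℕ // K * u + e ≤ t'} => Φ (some (t'.1, s')))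
        ⟨t', by omega⟩)
    have hi' : Inv (u + 1) s k mB n := hInv hi (fun _ _ _ _ => rfl) (by omega)
    have hcore := hsim o args hargs u s k mB n hi'
      (fun x => lam ^ u * expect ((copyOut (N + numPersistent) numAnswers out).run pub h' x) Ψ)
      (fun i a => f i (some (u, m.setRegs out a.1, a.2))) (η * u)
      (fun x => mul_le_one' (pow_le_one₀ zero_le hlam) (expect_le_one hΨ))
      (fun i a s' hs' => hc.le_dead _ _ _ _ hs')
      (by
        intro k' s' m' n' ans hag' hans hinv'
        simp only [copyOut_run pub h' out _ _ ans m' n'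
          (fun r hr => (hout r hr).trans_le (Nat.le_add_right _ _)) hans, expect_pure, Ψ]
        rw [ENNReal.mul_iSup]
        refine iSup_le fun t' => ?_
        exact hc.le_some _ _ _ _ _ _ _ t'.2 ((hag.trans hag').setRegs _ _)
          (hInv hinv' (fun a ha _ j => Store.setRegs_above _ _ fun h' => by
            have := hout a h'; omega) le_rfl))
    rw [expect_mul_left] at hcore
    have hexec : ∀ i, expect ((Cmd.call o out args).exec pub (h i) (cost + u) (m, s)) (f i) =
        expect (h i o (args.map mB.reg) s) fun a => f i (some (u, m.setRegs out a.1, a.2)) := by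
      intro i
      simp only [Cmd.exec]
      rw [expect_spend (by omega)]
      simp only [expect_bind, expect_pure, hag.map_reg hargs, ← hcost, Nat.add_sub_cancel_left]
    simp only [hexec]
    calc lam ^ (cost + u) * _ ≤ lam ^ (1 + u) * expect (((core o args).seq
            (copyOut (N + numPersistent) numAnswers out)).run pub h' (mB, n)) Ψ :=
          mul_le_mul' (pow_le_pow_of_le_one zero_le hlam (by omega)) hrun
      _ = lam * (lam ^ u * expect ((core o args).run pub h' (mB, n)) fun x =>
            expect ((copyOut (N + numPersistent) numAnswers out).run pub h' x) Ψ) := by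
          simp only [Cmd.run, expect_bind]
          ring
      _ ≤ _ := hcore
      _ ≤ _ := by
        rw [add_assoc]
        gcongr
        push_cast
        calc η * u + η = η * (1 + u) := by ring
          _ ≤ _ := by
            gcongr
            simp [hcost, add_assoc]
  | seq c d ihc ihd =>
    intro t tB s k m mB n Φ f ht hag hi hc
    simp only [Cmd.translate, Cmd.exec, expect_bind]
    refine ihc hcN.1 t tB s k m mB n _ _ ht hag hi ⟨?_, ?_, ?_, ?_⟩
    · rintro (_ | ⟨t, m, s⟩)
      · simpa using hc.le_one _
      · exact expect_le_one hc.le_one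
    · intro i; simpa using hc.le_none i
    · intro i t m s hs
      exact hdead.one_le_expect_exec pub i d t m s (f i) hs (hc.le_none i) (hc.le_dead i)
    · intro t tB s k m mB n ht hag hi
      exact ihd hcN.2 t tB s k m mB n Φ f ht hag hi hc
  | ite r c d ihc ihd =>
    intro t tB s k m mB n Φ f ht hag hi hc
    refine hc.step hlam hK ht k _ _ fun t' tB' htt' ht' => ?_
    simp only [hag.reg hcN.1]
    have hi' := hInv hi (fun _ _ _ _ => rfl) htt'
    by_cases hr : m.reg r ≠ 0
    · simp only [hr, if_true, not_false_eq_true, ne_eq]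
      exact ihc hcN.2.1 _ _ _ _ _ _ _ _ _ ht' hag hi' hc
    · simp only [hr, if_false]
      exact ihd hcN.2.2 _ _ _ _ _ _ _ _ _ ht' hag hi' hc
  | loop r c ih =>
    intro t tB s k m mB n Φ f ht hag hi hc
    simp only [Cmd.translate, Cmd.exec]
    have htB : t ≤ tB :=
      (Nat.le_mul_of_pos_left _ hK).trans ((Nat.le_add_right _ _).trans ht)
    -- the bounds on the number of rounds need not agree with the times left
    suffices H : ∀ (l lB t tB : ℕ) (s : σ) (k : κ) (m mB : Store w) (n : σ'), l ≤ lB →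
        K * t + e ≤ tB → AgreeBelow N m mB → Inv t s k mB n →
        lam ^ t * expect (repeatWhile (fun s => decide (s.1.reg r ≠ 0))
          ((c.translate N core).exec pub h') lB tB (mB, n)) Φ ≤
        expect (R k) (fun i => expect (repeatWhile (fun s => decide (s.1.reg r ≠ 0))
          (c.exec pub (h i)) l t (m, s)) (f i)) + η * t from
      H t tB t tB s k m mB n htB ht hag hi
    intro l
    induction l with
    | zero =>
      intro lB t tB s k m mB n hl ht hag hi
      simp only [repeatWhile, expect_pure]
      exact hc.le_of_none hlam _ _ _ _
    | succ l ihl =>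
      intro lB t tB s k m mB n hl ht hag hi
      obtain ⟨lB, rfl⟩ : ∃ l', lB = l' + 1 := ⟨lB - 1, by omega⟩
      simp only [repeatWhile]
      refine hc.step hlam hK ht k _ _ fun t' tB' htt' ht' => ?_
      have hi' := hInv hi (fun _ _ _ _ => rfl) htt'
      simp only [hag.reg hcN.1]
      by_cases hr : m.reg r ≠ 0
      · simp only [hr, if_true, decide_true, expect_bind, ne_eq, not_false_eq_true]
        refine ih hcN.2 t' tB' s k m mB n _ _ ht' hag hi' ⟨?_, ?_, ?_, ?_⟩
        · rintro (_ | ⟨t, m, s⟩)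
          · simpa using hc.le_one _
          · exact expect_le_one hc.le_one
        · intro i; simpa using hc.le_none i
        · intro i t m s hs
          exact one_le_expect_repeatWhile (hc.le_none i) (hc.le_dead i)
            (fun t m s f hs h0 h1 => hdead.one_le_expect_exec pub i c t m s f hs h0 h1) l t m s hs
        · intro t tB s k m mB n ht hag hi
          exact ihl lB t tB s k m mB n (by omega) ht hag hi
      · simp only [hr, if_false, decide_false, expect_pure, Bool.false_eq_true]
        exact hc.le_some _ _ _ _ _ _ _ ht' hag hi'

end

end Simulation

/-! ### Scalars and group elements -/

section Group

variable {w q : ℕ} {G : Type} [AddCommGroup G]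

@[simp] theorem System.decode_enc (S : System w q G) (P : G) : S.decode (S.enc P) = some P :=
  Function.partialInv_left S.enc.injective P

theorem System.enc_of_decode (S : System w q G) {x : BitVec w} {P : G} (h : S.decode x = some P) :
    x = S.enc P :=
  ((S.enc.injective.isPartialInv P x).1 h).symm

theorem mulG_zero_right (k : ZMod q) : mulG k (0 : G) = 0 := by simp [mulG]

theorem System.order_le (S : System w q G) (hG : Nat.card G = q) : q ≤ 2 ^ w := by
  have := Nat.card_le_card_of_injective S.enc S.enc.injective
  rwa [hG, Nat.card_congr (BitVec.equivFin (m := w)).toEquiv, Nat.card_fin] at this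

variable [Fact q.Prime]

theorem System.wordScalar_scalarWord (S : System w q G) (hG : Nat.card G = q) (k : ZMod q) :
    wordScalar q (scalarWord w k) = k := by
  have h : k.val < 2 ^ w := (ZMod.val_lt k).trans_le (S.order_le hG)
  simp [wordScalar, scalarWord, BitVec.toNat_ofNat, Nat.mod_eq_of_lt h]

theorem System.width_pos (S : System w q G) (hG : Nat.card G = q) : 0 < w := by
  rcases Nat.eq_zero_or_pos w with rfl | h
  · have := S.order_le hG
    have := (Fact.out : q.Prime).two_le
    simp at *
    omega
  · exact h

theorem nsmul_eq_mulG (hG : Nat.card G = q) (n : ℕ) (P : G) : n • P = mulG (n : ZMod q) P := by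
  subst hG
  rw [mulG, ZMod.val_natCast, mod_natCard_nsmul]

theorem mulG_add_mulG (hG : Nat.card G = q) (a b : ZMod q) (P : G) :
    mulG a P + mulG b P = mulG (a + b) P := by
  simp only [mulG]
  rw [← add_nsmul, nsmul_eq_mulG hG]
  simp [mulG]

theorem mulG_mulG (hG : Nat.card G = q) (a b : ZMod q) (P : G) :
    mulG a (mulG b P) = mulG (a * b) P := by
  simp only [mulG]
  rw [← mul_nsmul', nsmul_eq_mulG hG]
  simp [mulG]

theorem mulG_zero_left (P : G) : mulG (0 : ZMod q) P = 0 := by simp [mulG]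

theorem mulG_one (P : G) : mulG (1 : ZMod q) P = P := by
  have : Fact (1 < q) := ⟨(Fact.out : q.Prime).one_lt⟩
  simp [mulG, ZMod.val_one]

theorem mulG_eq_zero (hG : Nat.card G = q) {k : ZMod q} {P : G} (hP : P ≠ 0) :
    mulG k P = 0 ↔ k = 0 := by
  refine ⟨fun h => ?_, fun h => by rw [h, mulG_zero_left]⟩
  by_contra hk
  apply hP
  rw [← mulG_one (q := q) P, ← inv_mul_cancel₀ hk, ← mulG_mulG hG, h, mulG_zero_right]

theorem mulG_injective (hG : Nat.card G = q) {P : G} (hP : P ≠ 0) :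
    Function.Injective fun k : ZMod q => mulG k P := by
  intro a b hab
  have h : mulG (a - b) P = 0 := by
    have := mulG_add_mulG hG (a - b) b P
    rw [sub_add_cancel] at this
    exact left_eq_add.1 (hab.symm.trans this.symm |>.trans (add_comm _ _))
  exact sub_eq_zero.1 ((mulG_eq_zero hG hP).1 h)

theorem ne_zero_of_generates (hG : Nat.card G = q) {g : G} (hg : AddSubgroup.zmultiples g = ⊤) :
    g ≠ 0 := by
  rintro rfl
  have h1 : Nat.card (⊤ : AddSubgroup G) = 1 := by rw [← hg]; simp
  rw [AddSubgroup.card_top, hG] at h1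
  exact (Fact.out : q.Prime).one_lt.ne' h1

end Group

/-! ### Simulation of the proofs of equality of discrete logarithms -/

section Nizk

variable {w q : ℕ} [Fact q.Prime]

/-- The random oracle table with an answer added. -/
def HashTable.insert (H : HashTable w q) (x : List (BitVec w)) (c : ZMod q) : HashTable w q :=
  fun y => if y = x then some c else H y

/-- One attempt to simulate a proof without the secret key `sk`: the challenge `c` and the response
`s` are given, and the random oracle is programmed to answer `c` at the point `pt k` that belongs
to `k = s + c · sk`.  If the table has an entry there, then the attempt fails, unless the point does
not depend on `k` at all (`deg`), where the answer in the table serves as the challenge.  The attempt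
also fails if the proof would belong to `k = 0`. -/
def nizkAttempt (pt : ZMod q → List (BitVec w)) (deg : Bool) (sk : ZMod q) (H : HashTable w q)
    (c s : ZMod q) : Option ((ZMod q × ZMod q) × HashTable w q) :=
  match H (pt (s + c * sk)) with
  | some c' => if deg = true ∧ s + c' * sk ≠ 0 then some ((c', s), H) else none
  | none => if s + c * sk ≠ 0 then some ((c, s), H.insert (pt (s + c * sk)) c) else none

/-- Expected value of an attempt whose success is worth `a`, and whose failure is worth `b`. -/
def attemptValue (pt : ZMod q → List (BitVec w)) (deg : Bool) (sk : ZMod q) (H : HashTable w q)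
    (a : (ZMod q × ZMod q) × HashTable w q → ℝ≥0∞) (b : ℝ≥0∞) : ℝ≥0∞ :=
  expect (PMF.uniformOfFintype (ZMod q)) fun c =>
  expect (PMF.uniformOfFintype (ZMod q)) fun s => (nizkAttempt pt deg sk H c s).elim b a

/-- Expected value `a` of a genuine proof whose nonce is `k`. -/
def proofValue (pt : ZMod q → List (BitVec w)) (sk : ZMod q) (H : HashTable w q)
    (a : (ZMod q × ZMod q) × HashTable w q → ℝ≥0∞) (k : ZMod q) : ℝ≥0∞ :=
  expect (hashQuery (pt k) H) fun r => a ((r.1, k - r.1 * sk), r.2)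

variable {pt : ZMod q → List (BitVec w)} {deg : Bool} {sk : ZMod q} {H : HashTable w q}

theorem attemptValue_eq (a : (ZMod q × ZMod q) × HashTable w q → ℝ≥0∞) (b : ℝ≥0∞) :
    attemptValue pt deg sk H a b =
      attemptValue pt deg sk H a 0 + b * attemptValue pt deg sk H (fun _ => 0) 1 := by
  simp only [attemptValue, ← expect_mul_left, ← expect_add]
  congr 1; funext c; congr 1; funext s
  cases nizkAttempt pt deg sk H c s <;> simp

/-- The probability that an attempt fails. -/
def failProb (pt : ZMod q → List (BitVec w)) (deg : Bool) (sk : ZMod q) (H : HashTable w q) :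
    ℝ≥0∞ := attemptValue pt deg sk H (fun _ => 0) 1

theorem success_add_failProb :
    attemptValue pt deg sk H (fun _ => 1) 0 + failProb pt deg sk H = 1 := by
  have h := attemptValue_eq (pt := pt) (deg := deg) (sk := sk) (H := H) (fun _ => 1) 1
  rw [one_mul] at h
  rw [failProb, ← h, attemptValue]
  have : ∀ c s, (nizkAttempt pt deg sk H c s).elim (1 : ℝ≥0∞) (fun _ => 1) = 1 := by
    intro c s; cases nizkAttempt pt deg sk H c s <;> rfl
  simp [this]

/-- The points of the proofs with nonce `k` are pairwise different, or all the same. -/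
def PointSpec (pt : ZMod q → List (BitVec w)) (deg : Bool) : Prop :=
  if deg then ∀ k k', pt k = pt k' else Function.Injective pt

theorem card_cast_ne_zero : (q : ℝ≥0∞) ≠ 0 := by
  exact_mod_cast (Fact.out : q.Prime).ne_zero

theorem expect_scalar_le (f : ZMod q → ℝ≥0∞) (s : Finset (ZMod q)) (hf : ∀ k, f k ≤ 1)
    (hs : ∀ k, k ∉ s → f k = 0) :
    expect (PMF.uniformOfFintype (ZMod q)) f ≤ (s.card : ℝ≥0∞) / q := by
  rw [expect_uniform, ZMod.card, mul_comm, ← div_eq_mul_inv]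
  gcongr
  rw [← Finset.sum_subset (Finset.subset_univ s) fun k _ hk => hs k hk]
  calc ∑ k ∈ s, f k ≤ ∑ _k ∈ s, 1 := Finset.sum_le_sum fun k _ => hf k
    _ = s.card := by simp

theorem failProb_le (hpt : PointSpec pt deg) (D : Finset (List (BitVec w)))
    (hD : ∀ x, x ∉ D → H x = none) : failProb pt deg sk H ≤ ((D.card + 1 : ℕ) : ℝ≥0∞) / q := by
  classical
  unfold failProb attemptValue
  refine (expect_mono (g := fun _ => ((D.card + 1 : ℕ) : ℝ≥0∞) / q) fun c => ?_).trans_eq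
    (expect_const _ _)
  have hle : ∀ s, (nizkAttempt pt deg sk H c s).elim (1 : ℝ≥0∞) (fun _ => 0) ≤ 1 := by
    intro s; cases nizkAttempt pt deg sk H c s <;> simp
  by_cases hdeg : deg = true
  · -- for a given challenge only one response belongs to `k = 0`
    have hconst : ∀ k, pt k = pt 0 := fun k => by
      rw [PointSpec, if_pos hdeg] at hpt; exact hpt k 0
    refine (expect_scalar_le _ {-((H (pt 0)).getD c * sk)} hle fun s hs => ?_).trans ?_
    · rw [Finset.mem_singleton] at hs
      unfold nizkAttempt
      rw [hconst]
      cases hH : H (pt 0) with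
      | none =>
        have : s + c * sk ≠ 0 := fun h => hs (by rw [hH]; exact eq_neg_of_add_eq_zero_left h)
        simp [this]
      | some c' =>
        have : s + c' * sk ≠ 0 := fun h => hs (by rw [hH]; exact eq_neg_of_add_eq_zero_left h)
        simp [this, hdeg]
    · rw [Finset.card_singleton]
      gcongr
      omega
  · have hinj : Function.Injective fun s => pt (s + c * sk) := by
      rw [PointSpec, if_neg hdeg] at hpt
      exact hpt.comp (add_left_injective _)
    refine (expect_scalar_le _ (insert (-(c * sk)) (D.preimage _ hinj.injOn)) hle
      fun s hs => ?_).trans ?_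
    · simp only [Finset.mem_insert, Finset.mem_preimage, not_or] at hs
      have : s + c * sk ≠ 0 := fun h => hs.1 (eq_neg_of_add_eq_zero_left h)
      unfold nizkAttempt
      rw [hD _ hs.2]
      simp [this]
    · gcongr
      refine (Finset.card_insert_le _ _).trans (Nat.succ_le_succ ?_)
      exact Finset.card_le_card_of_injOn (fun s => pt (s + c * sk))
        (fun s hs => (Finset.mem_preimage (hf := hinj.injOn)).1 hs) hinj.injOn

theorem expect_units (f : ZMod q → ℝ≥0∞) :
    expect (PMF.uniformOfFintype (ZMod q)ˣ) (fun k => f k) =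
      ((q - 1 : ℕ) : ℝ≥0∞)⁻¹ * ∑ k, if k ≠ 0 then f k else 0 := by
  rw [expect_uniform, ZMod.card_units]
  congr 1
  rw [← Finset.sum_filter]
  refine Finset.sum_bij (fun k _ => (k : ZMod q)) (fun k _ => by simp) (fun a _ b _ h => Units.ext h)
    (fun b hb => ⟨Units.mk0 b (by simpa using hb), by simp, rfl⟩) (fun _ _ => rfl)

/-- Successful attempts are not more probable than the same genuine proofs, up to a factor that
accounts for the exclusion of `k = 0`. -/
theorem attemptValue_le (hpt : PointSpec pt deg)
    (a : (ZMod q × ZMod q) × HashTable w q → ℝ≥0∞) :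
    attemptValue pt deg sk H a 0 ≤ (((q - 1 : ℕ) : ℝ≥0∞) / q) *
      expect (PMF.uniformOfFintype (ZMod q)ˣ) fun k => proofValue pt sk H a k := by
  have hq1 : ((q - 1 : ℕ) : ℝ≥0∞) ≠ 0 := by
    have := (Fact.out : q.Prime).two_le
    exact_mod_cast (by omega : q - 1 ≠ 0)
  have hR : (((q - 1 : ℕ) : ℝ≥0∞) / q) *
      expect (PMF.uniformOfFintype (ZMod q)ˣ) (fun k => proofValue pt sk H a k) =
      (q : ℝ≥0∞)⁻¹ * ∑ k, if k ≠ 0 then proofValue pt sk H a k else 0 := by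
    rw [expect_units (proofValue pt sk H a), ← mul_assoc]
    congr 1
    rw [div_eq_mul_inv, mul_comm, ← mul_assoc,
      ENNReal.inv_mul_cancel hq1 (ENNReal.natCast_ne_top _), one_mul]
  rw [hR]
  -- sum over `k` in place of the response
  have hshift : ∀ (c : ZMod q) (F : ZMod q → ℝ≥0∞),
      expect (PMF.uniformOfFintype (ZMod q)) F =
        expect (PMF.uniformOfFintype (ZMod q)) fun k => F (k - c * sk) := by
    intro c F
    simp only [expect_uniform]
    congr 1
    exact (Equiv.sum_comp (Equiv.subRight (c * sk)) F).symm
  have hE : ∀ F : ZMod q → ℝ≥0∞, expect (PMF.uniformOfFintype (ZMod q)) F =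
      (q : ℝ≥0∞)⁻¹ * ∑ k, F k := fun F => by rw [expect_uniform, ZMod.card]
  by_cases hex : deg = true ∧ ∃ c', H (pt 0) = some c'
  · obtain ⟨hdeg, c', hc'⟩ := hex
    have hconst : ∀ k, H (pt k) = some c' := fun k => by
      rw [PointSpec, if_pos hdeg] at hpt; rw [hpt k 0, hc']
    have : attemptValue pt deg sk H a 0 = expect (PMF.uniformOfFintype (ZMod q)) fun _ =>
        expect (PMF.uniformOfFintype (ZMod q)) fun s =>
          if s + c' * sk ≠ 0 then a ((c', s), H) else 0 := by
      unfold attemptValue nizkAttempt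
      congr 1; funext c; congr 1; funext s
      rw [hconst]
      by_cases h : s + c' * sk = 0 <;> simp [h, hdeg]
    rw [this, expect_const, hshift c', hE]
    gcongr with k
    simp only [sub_add_cancel]
    split_ifs
    · simp [proofValue, hashQuery, hconst]
    · exact le_rfl
  · have : ∀ c s, (nizkAttempt pt deg sk H c s).elim 0 a ≤
        if s + c * sk ≠ 0 then (if H (pt (s + c * sk)) = none then
          a ((c, s), H.insert (pt (s + c * sk)) c) else 0) else 0 := by
      intro c s
      unfold nizkAttempt
      cases hH : H (pt (s + c * sk)) with
      | none => by_cases h : s + c * sk = 0 <;> simp [h]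
      | some c' =>
        have hdeg : deg ≠ true := fun hdeg => hex ⟨hdeg, c', by
          rw [PointSpec, if_pos hdeg] at hpt; rw [hpt 0 (s + c * sk), hH]⟩
        simp [hdeg]
    calc attemptValue pt deg sk H a 0 ≤ expect (PMF.uniformOfFintype (ZMod q)) fun c =>
          expect (PMF.uniformOfFintype (ZMod q)) fun s =>
          if s + c * sk ≠ 0 then (if H (pt (s + c * sk)) = none then
            a ((c, s), H.insert (pt (s + c * sk)) c) else 0) else 0 :=
          expect_mono fun c => expect_mono fun s => this c s
      _ = expect (PMF.uniformOfFintype (ZMod q)) fun k =>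
          if k ≠ 0 then (if H (pt k) = none then expect (PMF.uniformOfFintype (ZMod q)) fun c =>
            a ((c, k - c * sk), H.insert (pt k) c) else 0) else 0 := by
          rw [show (fun c => expect (PMF.uniformOfFintype (ZMod q)) fun s =>
            if s + c * sk ≠ 0 then (if H (pt (s + c * sk)) = none then
              a ((c, s), H.insert (pt (s + c * sk)) c) else 0) else 0) =
            fun c => expect (PMF.uniformOfFintype (ZMod q)) fun k =>
            if k ≠ 0 then (if H (pt k) = none then
              a ((c, k - c * sk), H.insert (pt k) c) else 0) else 0 from
            funext fun c => by rw [hshift c]; simp only [sub_add_cancel]]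
          rw [expect_comm]
          congr 1; funext k
          split_ifs <;> simp
      _ ≤ _ := by
          rw [hE]
          gcongr with k
          split_ifs with h1 h2
          · simp only [proofValue, hashQuery, h2, expect_bind, expect_pure]
            exact le_rfl
          · exact zero_le
          · exact le_rfl

/-- The probability of an outcome in the simulation of a proof, multiplied by this factor, is at most
its probability in a genuine proof up to `reportError q T`, when the random oracle table has at most
`T` entries. -/
def reportFactor (q T : ℕ) : ℝ≥0∞ := ((q - 1 - T : ℕ) : ℝ≥0∞) / ((q - 1 : ℕ) : ℝ≥0∞)

theorem reportFactor_le_one (q T : ℕ) : reportFactor q T ≤ 1 := by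
  refine ENNReal.div_le_of_le_mul ?_
  rw [one_mul]
  exact_mod_cast Nat.sub_le _ _

/-- Bound for the probability that three attempts fail. -/
def reportError (q T : ℕ) : ℝ≥0∞ := (((T + 1 : ℕ) : ℝ≥0∞) / q) ^ 3

/-- Three attempts compared with a genuine proof.  An attempt succeeds with a probability `u`, which
is at least `(q - 1 - T) / q`.  By `attemptValue_le` its value is at most `(q - 1) / q` times that of a
genuine proof, so multiplication by `reportFactor q T` leaves at most `u` times the latter, and the
probabilities `u`, `u * ρ`, `u * ρ ^ 2` that the first success is in the respective attempt add up to
at most `1`. -/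
theorem three_attempts_le (hpt : PointSpec pt deg) {T : ℕ} (D : Finset (List (BitVec w)))
    (hDT : D.card ≤ T) (hD : ∀ x, x ∉ D → H x = none)
    (a : (ZMod q × ZMod q) × HashTable w q → ℝ≥0∞) :
    reportFactor q T * attemptValue pt deg sk H a
      (attemptValue pt deg sk H a (attemptValue pt deg sk H a 1)) ≤
    (expect (PMF.uniformOfFintype (ZMod q)ˣ) fun k => proofValue pt sk H a k) +
      reportError q T := by
  have hq0 : (q : ℝ≥0∞) ≠ 0 := card_cast_ne_zero
  have hqt : (q : ℝ≥0∞) ≠ ⊤ := ENNReal.natCast_ne_top _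
  have h2 := (Fact.out : q.Prime).two_le
  have hq1 : ((q - 1 : ℕ) : ℝ≥0∞) ≠ 0 := by exact_mod_cast (by omega : q - 1 ≠ 0)
  have hle := attemptValue_le (sk := sk) (H := H) hpt a
  have hfail : failProb pt deg sk H ≤ ((T + 1 : ℕ) : ℝ≥0∞) / q :=
    (failProb_le hpt D hD).trans (by gcongr)
  have hsum := success_add_failProb (pt := pt) (deg := deg) (sk := sk) (H := H)
  have heq : ∀ b, attemptValue pt deg sk H a b =
      attemptValue pt deg sk H a 0 + b * failProb pt deg sk H := fun b => attemptValue_eq a b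
  rw [heq (attemptValue _ _ _ _ _ _), heq (attemptValue _ _ _ _ _ _), heq 1]
  set R := expect (PMF.uniformOfFintype (ZMod q)ˣ) fun k => proofValue pt sk H a k
  set τ := attemptValue pt deg sk H a 0
  set u := attemptValue pt deg sk H (fun _ => 1) 0
  set ρ := failProb pt deg sk H
  have hu : ((q - 1 - T : ℕ) : ℝ≥0∞) / q ≤ u := by
    by_contra! hlt
    have hu' : u ≠ ⊤ := (hlt.trans_le le_top).ne
    have h3 : u + ρ < ((q - 1 - T : ℕ) : ℝ≥0∞) / q + ((T + 1 : ℕ) : ℝ≥0∞) / q :=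
      ENNReal.add_lt_add_of_lt_of_le (ne_top_of_le_ne_top ENNReal.one_ne_top
        (hsum ▸ le_add_self)) hlt hfail
    rw [hsum, ← ENNReal.add_div] at h3
    rcases Nat.lt_or_ge (q - 1) T with hT | hT
    · rw [Nat.sub_eq_zero_of_le hT.le] at hlt
      simp at hlt
    · rw [← Nat.cast_add, show q - 1 - T + (T + 1) = q by omega, ENNReal.div_self hq0 hqt] at h3
      exact lt_irrefl _ h3
  have hlamτ : reportFactor q T * τ ≤ u * R :=
    calc reportFactor q T * τ ≤ reportFactor q T * (((q - 1 : ℕ) : ℝ≥0∞) / q * R) := by gcongr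
      _ = ((q - 1 - T : ℕ) : ℝ≥0∞) / q * R := by
        rw [reportFactor, ← mul_assoc, ENNReal.div_eq_inv_mul, ENNReal.div_eq_inv_mul,
          ENNReal.div_eq_inv_mul]
        congr 1
        calc _ = (((q - 1 : ℕ) : ℝ≥0∞)⁻¹ * ((q - 1 : ℕ) : ℝ≥0∞)) *
              ((q : ℝ≥0∞)⁻¹ * ((q - 1 - T : ℕ) : ℝ≥0∞)) := by ring
          _ = _ := by rw [ENNReal.inv_mul_cancel hq1 (ENNReal.natCast_ne_top _), one_mul]
      _ ≤ u * R := by gcongr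
  have hlam1 := reportFactor_le_one q T
  have hgeom : u + u * ρ + u * ρ ^ 2 ≤ 1 :=
    calc u + u * ρ + u * ρ ^ 2 ≤ u + (u + (u + ρ) * ρ) * ρ := by
          calc u + u * ρ + u * ρ ^ 2 ≤ u + u * ρ + u * ρ ^ 2 + ρ ^ 3 := le_self_add
            _ = _ := by ring
      _ = 1 := by rw [hsum, one_mul, hsum, one_mul, hsum]
  calc reportFactor q T * (τ + (τ + (τ + 1 * ρ) * ρ) * ρ)
      = reportFactor q T * τ * (1 + ρ + ρ ^ 2) + reportFactor q T * ρ ^ 3 := by ring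
    _ ≤ u * R * (1 + ρ + ρ ^ 2) + 1 * (((T + 1 : ℕ) : ℝ≥0∞) / q) ^ 3 := by gcongr
    _ = (u + u * ρ + u * ρ ^ 2) * R + reportError q T := by rw [reportError]; ring
    _ ≤ 1 * R + reportError q T := by gcongr
    _ = _ := by rw [one_mul]

end Nizk

/-! ### The simulated random oracle -/

section Memory

variable {w : ℕ}

theorem Store.reg_set (m : Store w) (a : ℕ) (i : List (BitVec w)) (v : BitVec w) (r : ℕ) :
    (m.set a i v).reg r = if r = a ∧ [] = i then v else m.reg r := rfl

theorem Store.set_apply (m : Store w) (a : ℕ) (i : List (BitVec w)) (v : BitVec w) (b : ℕ)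
    (j : List (BitVec w)) : (m.set a i v) b j = if b = a ∧ j = i then v else m b j := rfl

theorem eq_add_iff_false {N a k : ℕ} (h : a < N) : (a = N + k) ↔ False := by
  simp only [iff_false]; omega

theorem eq_add_iff_false_of_le {N a k j : ℕ} (h : a < N + k) (hkj : k ≤ j) :
    (a = N + j) ↔ False := by
  simp only [iff_false]; omega

theorem map_reg_set {N k : ℕ} {args : List ℕ} (hargs : ∀ a ∈ args, a < N) (m : Store w)
    (i : List (BitVec w)) (v : BitVec w) :
    args.map (m.set (N + k) i v).reg = args.map m.reg :=
  List.map_congr_left fun a ha => by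
    simp [Store.reg_set, eq_add_iff_false (hargs a ha)]

theorem one_ne_zero_word (hw : 0 < w) : ¬ (1#w = 0#w) := by
  intro h
  have := congrArg BitVec.toNat h
  simp at this
  omega

theorem bit_eq_zero {b : Bool} (hw : 0 < w) : (bit b : BitVec w) = 0 ↔ b = false := by
  have : (1 : BitVec w) ≠ 0 := one_ne_zero_word hw
  cases b <;> simp_all [bit]

theorem bit_and_bit (a b : Bool) : (bit a &&& bit b : BitVec w) = bit (a && b) := by
  cases a <;> cases b <;> simp [bit]

/-- The array `N + 4` marks the points where the random oracle table has an entry, and the array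
`N + 5` holds the entries. -/
structure MemTable {q : ℕ} (N : ℕ) (H : HashTable w q) (m : Store w) : Prop where
  isDefined : ∀ x, m (N + 4) x = bit (H x).isSome
  value : ∀ x c, H x = some c → m (N + 5) x = scalarWord w c

theorem MemTable.congr {q N : ℕ} {H : HashTable w q} {m m' : Store w} (h : MemTable N H m)
    (h4 : ∀ x, m' (N + 4) x = m (N + 4) x) (h5 : ∀ x, m' (N + 5) x = m (N + 5) x) :
    MemTable N H m' :=
  ⟨fun x => (h4 x).trans (h.isDefined x), fun x c hc => (h5 x).trans (h.value x c hc)⟩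

theorem MemTable.insert {q N : ℕ} {H : HashTable w q} {m m' : Store w} (h : MemTable N H m)
    (x : List (BitVec w)) (c : ZMod q)
    (h4 : ∀ y, m' (N + 4) y = if y = x then 1 else m (N + 4) y)
    (h5 : ∀ y, m' (N + 5) y = if y = x then scalarWord w c else m (N + 5) y) :
    MemTable N (H.insert x c) m' := by
  refine ⟨fun y => ?_, fun y d hd => ?_⟩
  · rw [h4, HashTable.insert]
    split_ifs
    · simp [bit]
    · exact h.isDefined y
  · rw [h5]
    rw [HashTable.insert] at hd
    split_ifs at hd ⊢
    · rw [Option.some.inj hd]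
    · exact h.value y d hd

end Memory

section HashCode

variable {w q : ℕ} [Fact q.Prime] {G : Type} [AddCommGroup G]

/-- Lazy sampling of the random oracle at the point held by the registers `args`. -/
def hashCode (N : ℕ) (args : List ℕ) : Cmd w OmufOracle :=
  .seq (.load (N + 30) (N + 4) args) <|
  .ite (N + 30) (.load (N + 20) (N + 5) args) <|
  .seq (.pub .randScalar [N + 20] []) <|
  .seq (.store (N + 5) args (N + 20)) <|
  .seq (.const (N + 30) 1) (.store (N + 4) args (N + 30))

theorem hashCode_run (S : System w q G) (hG : Nat.card G = q) (esk : ZMod q) {N : ℕ}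
    {args : List ℕ} (hargs : ∀ a ∈ args, a < N) {H : HashTable w q} {m : Store w} (n : ℕ)
    (hm : MemTable N H m) (Ψ : Store w × ℕ → ℝ≥0∞) (F : ZMod q × HashTable w q → ℝ≥0∞)
    (hF : ∀ c H' m', MemTable N H' m' → m'.reg (N + 20) = scalarWord w c →
      (∀ a < N + 30, a ≠ N + 4 → a ≠ N + 5 → a ≠ N + 20 → ∀ i, m' a i = m a i) →
      (∀ D : Finset (List (BitVec w)), (∀ x ∉ D, H x = none) →
        ∃ D' : Finset (List (BitVec w)), D'.card ≤ D.card + 1 ∧ ∀ x ∉ D', H' x = none) →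
      Ψ (m', n) ≤ F (c, H')) :
    expect ((hashCode N args).run S.pub (S.omufHandler esk) (m, n)) Ψ ≤
      expect (hashQuery (args.map m.reg) H) F := by
  classical
  have hw := S.width_pos hG
  simp only [hashCode, Cmd.run, PMF.pure_bind, Store.reg_set, and_self, if_true, hm.isDefined,
    ne_eq, bit_eq_zero hw]
  cases hH : H (args.map m.reg) with
  | some c =>
    simp only [Option.isSome_some, if_true, expect_pure, map_reg_set hargs, hashQuery, hH,
      not_false_eq_true, Bool.true_eq_false]
    refine hF c H _ (hm.congr ?_ ?_) ?_ ?_ fun D hD => ⟨D, by omega, hD⟩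
    · intro x; simp [Store.set_apply]
    · intro x; simp [Store.set_apply]
    · simp [Store.reg_set, Store.set_apply, hm.value _ _ hH]
    · intro a h1 h2 h3 h4 i
      simp [Store.set_apply, h4, show a ≠ N + 30 by omega]
  | none =>
    simp only [System.pub, Option.isSome_none, not_true, if_false, List.map_nil, expect_bind,
      expect_pure, Store.setRegs, hashQuery, hH, map_reg_set hargs]
    refine expect_mono fun c => ?_
    refine hF c (H.insert (args.map m.reg) c) _ (hm.insert _ _ ?_ ?_) ?_ ?_ fun D hD =>
      ⟨insert (args.map m.reg) D, Finset.card_insert_le _ _, fun x hx => ?_⟩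
    · intro x; simp [Store.set_apply, Store.reg_set]
    · intro x; simp [Store.set_apply, Store.reg_set]
    · simp [Store.reg_set]
    · intro a h1 h2 h3 h4 i
      simp [Store.set_apply, h2, h3, h4, show a ≠ N + 30 by omega]
    · simp only [Finset.mem_insert, not_or] at hx
      simp [HashTable.insert, hx.1, hD x hx.2]

/-- One attempt to simulate a proof.  The registers `gen`, `X`, `Q` hold the first three elements,
`N + 25` the fourth one, and `N + 32` tells whether the point of the random oracle is independent of
the nonce.  The challenge goes to `N + 23`, the response to `N + 24`, and success is recorded in
`N + 33`. -/
def attemptCode (S : System w q G) (N gen X Q : ℕ) : Cmd w OmufOracle :=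
  .seq (.pub .randScalar [N + 23] []) <|
  .seq (.pub .randScalar [N + 24] []) <|
  .seq (.pub .groupSmul [N + 34] [N + 24, gen]) <|
  .seq (.pub .groupSmul [N + 35] [N + 23, X]) <|
  .seq (.pub .groupAdd [N + 36] [N + 34, N + 35]) <|
  .seq (.pub .groupSmul [N + 34] [N + 24, Q]) <|
  .seq (.pub .groupSmul [N + 35] [N + 23, N + 25]) <|
  .seq (.pub .groupAdd [N + 37] [N + 34, N + 35]) <|
  .seq (.load (N + 38) (N + 4) [N + 2, gen, X, Q, N + 25, N + 36, N + 37]) <|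
  .seq (.ite (N + 38)
    (.seq (.load (N + 23) (N + 5) [N + 2, gen, X, Q, N + 25, N + 36, N + 37])
      (.load (N + 33) (N + 32) []))
    (.const (N + 33) 1)) <|
  .seq (.pub .groupSmul [N + 34] [N + 24, N + 1]) <|
  .seq (.pub .groupSmul [N + 35] [N + 23, N + 3]) <|
  .seq (.pub .groupAdd [N + 34] [N + 34, N + 35]) <|
  .seq (.const (N + 35) (S.enc 0)) <|
  .seq (.word .eq (N + 34) (N + 34) (N + 35)) <|
  .seq (.ite (N + 34) (.const (N + 33) 0) .skip) <|
  .ite (N + 33)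
    (.seq (.store (N + 5) [N + 2, gen, X, Q, N + 25, N + 36, N + 37] (N + 23)) <|
     .seq (.const (N + 34) 1)
      (.store (N + 4) [N + 2, gen, X, Q, N + 25, N + 36, N + 37] (N + 34)))
    .skip

/-- What an attempt to simulate a proof needs to find in the memory. -/
structure AttemptInput (S : System w q G) (esk : ZMod q) (g P₁ P₂ : G) (deg : Bool) (N gen X Q : ℕ)
    (m : Store w) : Prop where
  base : m.reg (N + 1) = S.enc g
  order : m.reg (N + 2) = BitVec.ofNat w q
  epk : m.reg (N + 3) = S.enc (mulG esk g)
  gen : m.reg gen = S.enc P₁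
  X : m.reg X = S.enc (mulG esk P₁)
  Q : m.reg Q = S.enc P₂
  R : m.reg (N + 25) = S.enc (mulG esk P₂)
  deg : m.reg (N + 32) = bit deg

/-- The point at which the random oracle is queried in a proof with nonce `k`. -/
def nizkPoint (S : System w q G) (esk : ZMod q) (P₁ P₂ : G) (k : ZMod q) : List (BitVec w) :=
  [BitVec.ofNat w q, S.enc P₁, S.enc (mulG esk P₁), S.enc P₂, S.enc (mulG esk P₂),
    S.enc (mulG k P₁), S.enc (mulG k P₂)]

theorem attemptCode_run (S : System w q G) (hG : Nat.card G = q) {esk : ZMod q} {g P₁ P₂ : G}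
    (hg : g ≠ 0) {deg : Bool} {N gen X Q : ℕ} (hgen : gen < N) (hX : X < N) (hQ : Q < N)
    {H : HashTable w q} {m : Store w} (n : ℕ)
    (hm : MemTable N H m) (hin : AttemptInput S esk g P₁ P₂ deg N gen X Q m)
    (Ψ : Store w × ℕ → ℝ≥0∞) (a : (ZMod q × ZMod q) × HashTable w q → ℝ≥0∞) (b : ℝ≥0∞)
    (ha : ∀ c s H' m', MemTable N H' m' → m'.reg (N + 23) = scalarWord w c →
      m'.reg (N + 24) = scalarWord w s → m'.reg (N + 33) = 1 →
      (∀ a < N + 33, a ≠ N + 4 → a ≠ N + 5 → a ≠ N + 23 → a ≠ N + 24 → ∀ i, m' a i = m a i) →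
      (∀ D : Finset (List (BitVec w)), (∀ x ∉ D, H x = none) →
        ∃ D' : Finset (List (BitVec w)), D'.card ≤ D.card + 1 ∧ ∀ x ∉ D', H' x = none) →
      Ψ (m', n) ≤ a ((c, s), H'))
    (hb : ∀ m', MemTable N H m' → m'.reg (N + 33) = 0 →
      (∀ a < N + 33, a ≠ N + 23 → a ≠ N + 24 → ∀ i, m' a i = m a i) → Ψ (m', n) ≤ b) :
    expect ((attemptCode S N gen X Q).run S.pub (S.omufHandler esk) (m, n)) Ψ ≤
      attemptValue (nizkPoint S esk P₁ P₂) deg esk H a b := by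
  classical
  have hw := S.width_pos hG
  have hsc := S.wordScalar_scalarWord hG
  simp only [attemptCode, Cmd.run, expect_bind, expect_pure, System.pub, List.map_nil,
    Store.setRegs, List.headD_cons, attemptValue]
  refine expect_mono fun c => expect_mono fun s => ?_
  have h10 : ¬ (1#w = 0#w) := one_ne_zero_word hw
  have hdeg : m (N + 32) [] = bit deg := hin.deg
  have hpt : ∀ k, [BitVec.ofNat w q, S.enc P₁, S.enc (mulG esk P₁), S.enc P₂, S.enc (mulG esk P₂),
    S.enc (mulG k P₁), S.enc (mulG k P₂)] = nizkPoint S esk P₁ P₂ k := fun _ => rfl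
  generalize hkdef : s + c * esk = k
  cases hH : H (nizkPoint S esk P₁ P₂ k) with
  | none =>
    rcases eq_or_ne k 0 with rfl | hk
    · simp [Store.reg_set, Store.set_apply, eq_add_iff_false hgen, eq_add_iff_false hX,
        eq_add_iff_false hQ, hin.base, hin.order, hin.epk, hin.gen, hin.X, hin.Q, hin.R, hsc,
        hm.isDefined, mulG_mulG hG, mulG_add_mulG hG, hpt, hH, bit, h10, WordOp.eval,
        mulG_eq_zero hG hg, nizkAttempt, hkdef]
      refine hb _ (hm.congr ?_ ?_) ?_ fun a h1 h2 h3 i => ?_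
      · intro x; simp [Store.set_apply]
      · intro x; simp [Store.set_apply]
      · simp [Store.reg_set]
      · simp [Store.set_apply, h2, h3, eq_add_iff_false_of_le h1]
    · simp [Store.reg_set, Store.set_apply, eq_add_iff_false hgen, eq_add_iff_false hX,
        eq_add_iff_false hQ, hin.base, hin.order, hin.epk, hin.gen, hin.X, hin.Q, hin.R, hsc,
        hm.isDefined, mulG_mulG hG, mulG_add_mulG hG, hpt, hH, bit, h10, WordOp.eval,
        mulG_eq_zero hG hg, hk, nizkAttempt, hkdef]
      refine ha c s _ _ (hm.insert _ _ ?_ ?_) ?_ ?_ ?_ (fun a h1 h2 h3 h4 h5 i => ?_) fun D hD =>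
        ⟨insert (nizkPoint S esk P₁ P₂ k) D, Finset.card_insert_le _ _, fun x hx => ?_⟩
      · intro x; simp [Store.set_apply]
      · intro x; simp [Store.set_apply]
      · simp [Store.reg_set]
      · simp [Store.reg_set]
      · simp [Store.reg_set]
      · simp [Store.set_apply, h2, h3, h4, h5, eq_add_iff_false_of_le h1]
      · simp only [Finset.mem_insert, not_or] at hx
        simp [HashTable.insert, hx.1, hD x hx.2]
  | some c' =>
    have hv := hm.value _ _ hH
    by_cases hk : s + c' * esk = 0
    · simp [Store.reg_set, Store.set_apply, eq_add_iff_false hgen, eq_add_iff_false hX,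
        eq_add_iff_false hQ, hin.base, hin.order, hin.epk, hin.gen, hin.X, hin.Q, hin.R, hsc,
        hm.isDefined, mulG_mulG hG, mulG_add_mulG hG, hpt, hH, bit, h10, WordOp.eval,
        mulG_eq_zero hG hg, hk, nizkAttempt, hkdef, hv, hdeg]
      refine hb _ (hm.congr ?_ ?_) ?_ fun a h1 h2 h3 i => ?_
      · intro x; simp [Store.set_apply]
      · intro x; simp [Store.set_apply]
      · simp [Store.reg_set]
      · simp [Store.set_apply, h2, h3, eq_add_iff_false_of_le h1]
    · cases deg with
      | false =>
        simp [Store.reg_set, Store.set_apply, eq_add_iff_false hgen, eq_add_iff_false hX,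
        eq_add_iff_false hQ, hin.base, hin.order, hin.epk, hin.gen, hin.X, hin.Q, hin.R, hsc,
        hm.isDefined, mulG_mulG hG, mulG_add_mulG hG, hpt, hH, bit, h10, WordOp.eval,
        mulG_eq_zero hG hg, hk, nizkAttempt, hkdef, hv, hdeg]
        refine hb _ (hm.congr ?_ ?_) ?_ fun a h1 h2 h3 i => ?_
        · intro x; simp [Store.set_apply]
        · intro x; simp [Store.set_apply]
        · simp [Store.reg_set]
        · simp [Store.set_apply, h2, h3, eq_add_iff_false_of_le h1]
      | true =>
        simp [Store.reg_set, Store.set_apply, eq_add_iff_false hgen, eq_add_iff_false hX,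
        eq_add_iff_false hQ, hin.base, hin.order, hin.epk, hin.gen, hin.X, hin.Q, hin.R, hsc,
        hm.isDefined, mulG_mulG hG, mulG_add_mulG hG, hpt, hH, bit, h10, WordOp.eval,
        mulG_eq_zero hG hg, hk, nizkAttempt, hkdef, hv, hdeg]
        refine ha c' s H _ ⟨?_, ?_⟩ ?_ ?_ ?_ (fun a h1 h2 h3 h4 h5 i => ?_) fun D hD =>
          ⟨D, by omega, hD⟩
        · intro x
          by_cases hx : x = nizkPoint S esk P₁ P₂ k
          · simp [Store.set_apply, hx, hH, bit]
          · simp [Store.set_apply, hx, hm.isDefined]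
        · intro x d hd
          by_cases hx : x = nizkPoint S esk P₁ P₂ k
          · rw [hx, hH] at hd
            simp [Store.set_apply, hx, Option.some.inj hd]
          · simp [Store.set_apply, hx, hm.value x d hd]
        · simp [Store.reg_set]
        · simp [Store.reg_set]
        · simp [Store.reg_set]
        · simp [Store.set_apply, h2, h3, h4, h5, eq_add_iff_false_of_le h1]

end HashCode

/-! ### Lazily sampled signature keys -/

section Keys

variable {w q : ℕ} {G : Type} [AddCommGroup G]

/-- Distribution of the list of `n` signature key pairs, given those that have been sampled. -/
def System.lazyKeys (S : System w q G) :
    ℕ → (ℕ → Option (BitVec w × BitVec w)) → PMF (List (BitVec w × BitVec w))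
  | 0, _ => PMF.pure []
  | n + 1, κ => ((κ 0).elim S.sig.keyGen PMF.pure).bind fun k =>
      (S.lazyKeys n fun j => κ (j + 1)).bind fun ks => PMF.pure (k :: ks)

theorem System.lazyKeys_none (S : System w q G) :
    ∀ n, S.lazyKeys n (fun _ => none) = S.sigKeys n
  | 0 => rfl
  | n + 1 => by rw [lazyKeys, sigKeys, S.lazyKeys_none n]; rfl

theorem System.mem_support_lazyKeys (S : System w q G) :
    ∀ {n : ℕ} {κ : ℕ → Option (BitVec w × BitVec w)} {ks : List (BitVec w × BitVec w)},
      ks ∈ (S.lazyKeys n κ).support →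
      ks.length = n ∧ ∀ j v, j < n → κ j = some v → ks[j]? = some v
  | 0, κ, ks, h => by
    simp only [lazyKeys, PMF.support_pure, Set.mem_singleton_iff] at h
    subst h
    simp
  | n + 1, κ, ks, h => by
    simp only [lazyKeys, PMF.support_bind, Set.mem_iUnion, PMF.support_pure,
      Set.mem_singleton_iff] at h
    obtain ⟨k, hk, ks', hks', rfl⟩ := h
    obtain ⟨h1, h2⟩ := S.mem_support_lazyKeys hks'
    refine ⟨by simp [h1], fun j v hj hv => ?_⟩
    cases j with
    | zero =>
      rw [hv] at hk
      simp only [Option.elim_some, PMF.support_pure, Set.mem_singleton_iff] at hk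
      simp [hk]
    | succ j => simpa using h2 j v (by omega) hv

/-- A key pair may be sampled when it is needed first. -/
theorem System.expect_lazyKeys_sample (S : System w q G) :
    ∀ (n : ℕ) (κ : ℕ → Option (BitVec w × BitVec w)) (j : ℕ) (_ : j < n) (_ : κ j = none)
      (F : List (BitVec w × BitVec w) → ℝ≥0∞), expect (S.lazyKeys n κ) F =
        expect S.sig.keyGen fun v => expect (S.lazyKeys n (Function.update κ j (some v))) F
  | 0, _, j, hj, _, _ => absurd hj (Nat.not_lt_zero j)
  | n + 1, κ, 0, _, h, F => by
    simp only [lazyKeys, h, Option.elim_none, expect_bind, Function.update_self, Option.elim_some,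
      expect_pure, Function.update_of_ne (Nat.succ_ne_zero _)]
  | n + 1, κ, j + 1, hj, h, F => by
    have h0 : ∀ v, Function.update κ (j + 1) (some v) 0 = κ 0 := fun v =>
      Function.update_of_ne (Nat.succ_ne_zero _).symm _ _
    have h1 : ∀ v, (fun i => Function.update κ (j + 1) (some v) (i + 1)) =
        Function.update (fun i => κ (i + 1)) j (some v) := by
      intro v; funext i
      simp [Function.update_apply]
    simp only [lazyKeys, expect_bind, h0, h1, expect_pure]
    rw [expect_comm S.sig.keyGen]
    congr 1; funext k
    exact S.expect_lazyKeys_sample n _ j (by omega) h _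

theorem expect_issueTag (S : System w q G) {j r : BitVec w} (st : ScState w q)
    {κ : ℕ → Option (BitVec w × BitVec w)} {v : BitVec w × BitVec w} (hj : j.toNat < S.numKeys)
    (hv : κ j.toNat = some v)
    (F : List (BitVec w × BitVec w) → List (BitVec w) × ScState w q → ℝ≥0∞) :
    (expect (S.tagIssueFirst v.2 r) fun se => expect (S.lazyKeys S.numKeys κ) fun i =>
      F i ([se.comS, se.comR, BitVec.ofNat w st.sessions.length],
        { st with sessions := st.sessions ++ [se] })) ≤
    expect (S.lazyKeys S.numKeys κ) fun i => expect (S.issueTag i [j, r] st) (F i) := by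
  rw [expect_comm]
  refine expect_mono_support fun i hi => ?_
  simp only [System.issueTag, (S.mem_support_lazyKeys hi).2 _ _ hj hv, expect_bind, expect_pure]
  exact le_rfl

end Keys

/-! ### The memory of the reduction -/

section Invariant

variable {w q : ℕ} {G : Type} [AddCommGroup G]

/-- The array `N + 6` marks the signature keys that have been sampled, and the array `N + 7` holds
their verification keys. -/
structure MemKeys (N : ℕ) (κ : ℕ → Option (BitVec w × BitVec w)) (m : Store w) : Prop where
  isDefined : ∀ j, m (N + 6) [j] = bit (κ j.toNat).isSome
  value : ∀ j v, κ j.toNat = some v → m (N + 7) [j] = v.2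

/-- The register `N + 8` holds the number of sessions, the array `N + 9` marks the sessions that
have not been reported, and the arrays from `N + 10` to `N + 13` hold the commitments and their
openings. -/
structure MemSessions (N : ℕ) (l : List (Session w)) (m : Store w) : Prop where
  count : m.reg (N + 8) = BitVec.ofNat w l.length
  live : ∀ i, m (N + 9) [i] = bit ((l[i.toNat]?).elim false fun se => !se.reported)
  comS : ∀ i se, l[i.toNat]? = some se → m (N + 10) [i] = se.comS
  comR : ∀ i se, l[i.toNat]? = some se → m (N + 11) [i] = se.comR
  opS : ∀ i se, l[i.toNat]? = some se → m (N + 12) [i] = se.opS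
  opR : ∀ i se, l[i.toNat]? = some se → m (N + 13) [i] = se.opR

/-- The registers with the generator, the group order, the public key of the sender and the
verification key of the server. -/
structure MemConsts (S : System w q G) (g : G) (esk : ZMod q) (pk : BitVec w) (N : ℕ)
    (m : Store w) : Prop where
  base : m.reg (N + 1) = S.enc g
  order : m.reg (N + 2) = BitVec.ofNat w q
  epk : m.reg (N + 3) = S.enc (mulG esk g)
  pk : m.reg (N + 14) = pk

/-- The state `st` of the score integrity game with the sampled signature keys `κ`, as represented
in the memory `m` and the state `n` of the one-more unforgeability game, when there are `t` of `T`
time units left. -/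
structure ScInv (S : System w q G) (g : G) (esk : ZMod q) (pk : BitVec w) (T N t : ℕ)
    (st : ScState w q) (κ : ℕ → Option (BitVec w × BitVec w)) (m : Store w) (n : ℕ) : Prop where
  consts : MemConsts S g esk pk N m
  table : MemTable N st.table m
  keys : MemKeys N κ m
  sessions : MemSessions N st.sessions m
  table_finite : ∃ D : Finset (List (BitVec w)), D.card + t ≤ T ∧ ∀ x ∉ D, st.table x = none
  sessions_length : st.sessions.length + t ≤ T
  ctr : n = st.ctr
  alive : st.aborted = false

theorem MemKeys.congr {N : ℕ} {κ : ℕ → Option (BitVec w × BitVec w)} {m m' : Store w}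
    (h : MemKeys N κ m) (h' : ∀ a, N + 6 ≤ a → a < N + 8 → ∀ i, m' a i = m a i) :
    MemKeys N κ m' :=
  ⟨fun j => by rw [h' _ (by omega) (by omega), h.isDefined],
    fun j v hv => by rw [h' _ (by omega) (by omega), h.value j v hv]⟩

theorem MemSessions.congr {N : ℕ} {l : List (Session w)} {m m' : Store w}
    (h : MemSessions N l m) (h' : ∀ a, N + 8 ≤ a → a < N + 14 → ∀ i, m' a i = m a i) :
    MemSessions N l m' :=
  ⟨(h' _ (by omega) (by omega) _).trans h.count,
    fun i => by rw [h' _ (by omega) (by omega), h.live],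
    fun i se hi => by rw [h' _ (by omega) (by omega), h.comS i se hi],
    fun i se hi => by rw [h' _ (by omega) (by omega), h.comR i se hi],
    fun i se hi => by rw [h' _ (by omega) (by omega), h.opS i se hi],
    fun i se hi => by rw [h' _ (by omega) (by omega), h.opR i se hi]⟩

theorem MemConsts.congr {S : System w q G} {g : G} {esk : ZMod q} {pk : BitVec w} {N : ℕ}
    {m m' : Store w} (h : MemConsts S g esk pk N m)
    (h' : ∀ a, (N + 1 ≤ a ∧ a < N + 4) ∨ a = N + 14 → ∀ i, m' a i = m a i) :
    MemConsts S g esk pk N m' :=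
  ⟨(h' _ (by omega) _).trans h.base, (h' _ (by omega) _).trans h.order,
    (h' _ (by omega) _).trans h.epk, (h' _ (by omega) _).trans h.pk⟩

theorem privateInv_scInv (S : System w q G) (g : G) (esk : ZMod q) (pk : BitVec w) (T N : ℕ) :
    PrivateInv N (ScInv S g esk pk T N) := by
  intro t t' s k m m' n h hm ht
  obtain ⟨D, hD, hD'⟩ := h.table_finite
  have := h.sessions_length
  exact
    { consts := h.consts.congr fun a ha => hm a (by omega) (by unfold numPersistent; omega)
      table := h.table.congr (hm _ (by omega) (by unfold numPersistent; omega))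
        (hm _ (by omega) (by unfold numPersistent; omega))
      keys := h.keys.congr fun a ha ha' => hm a (by omega) (by unfold numPersistent; omega)
      sessions := h.sessions.congr fun a ha ha' => hm a (by omega) (by unfold numPersistent; omega)
      table_finite := ⟨D, by omega, hD'⟩
      sessions_length := by omega
      ctr := h.ctr
      alive := h.alive }

theorem ScInv.congr {S : System w q G} {g : G} {esk : ZMod q} {pk : BitVec w} {T N t t' : ℕ}
    {st : ScState w q} {κ : ℕ → Option (BitVec w × BitVec w)} {m m' : Store w} {n : ℕ}
    (h : ScInv S g esk pk T N t st κ m n) (ht : t' ≤ t) (hm : AgreeBelow (N + 20) m m') :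
    ScInv S g esk pk T N t' st κ m' n :=
  privateInv_scInv S g esk pk T N h (fun a _ ha => hm a ha) ht

/-- Only the random oracle table has changed. -/
theorem ScInv.update_table {S : System w q G} {g : G} {esk : ZMod q} {pk : BitVec w} {T N t : ℕ}
    {st : ScState w q} {κ : ℕ → Option (BitVec w × BitVec w)} {m m' : Store w} {n : ℕ}
    (h : ScInv S g esk pk T N (t + 1) st κ m n) {H' : HashTable w q} (hH : MemTable N H' m')
    (hD : ∀ D : Finset (List (BitVec w)), (∀ x ∉ D, st.table x = none) →
      ∃ D' : Finset (List (BitVec w)), D'.card ≤ D.card + 1 ∧ ∀ x ∉ D', H' x = none)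
    (hm : ∀ a < N + 20, a ≠ N + 4 → a ≠ N + 5 → ∀ i, m' a i = m a i) :
    ScInv S g esk pk T N t { st with table := H' } κ m' n := by
  obtain ⟨D, hDT, hDn⟩ := h.table_finite
  obtain ⟨D', hD', hDn'⟩ := hD D hDn
  have := h.sessions_length
  exact
    { consts := h.consts.congr fun a ha => hm a (by omega) (by omega) (by omega)
      table := hH
      keys := h.keys.congr fun a ha ha' => hm a (by omega) (by omega) (by omega)
      sessions := h.sessions.congr fun a ha ha' => hm a (by omega) (by omega) (by omega)
      table_finite := ⟨D', by omega, hDn'⟩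
      sessions_length := by simp only; omega
      ctr := h.ctr
      alive := h.alive }

end Invariant

/-! ### Simulation of the oracles -/

section Oracles

variable {w q : ℕ} [Fact q.Prime] {G : Type} [AddCommGroup G]

/-- Simulation of the oracle `OVerify`. -/
def verifyCode (N : ℕ) : List ℕ → Cmd w OmufOracle
  | [a, b] => .seq (.pub .hashToGroup [N + 30] [a]) (.call .ver [N + 20] [N + 30, b])
  | _ => .skip

/-- Put into the register `N + 30` whether there is a signature key with the index in `j`.  If there
are at least `2 ^ w` keys, then their number is not a machine word, and every index occurs. -/
def keyIndexCode (S : System w q G) (N j : ℕ) : Cmd w OmufOracle :=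
  if 2 ^ w ≤ S.numKeys then .const (N + 30) 1
  else .seq (.const (N + 31) (BitVec.ofNat w S.numKeys)) (.word .lt (N + 30) j (N + 31))

/-- Sample the signature key with the index in `j`, unless this has been done. -/
def sampleKeyCode (N j : ℕ) : Cmd w OmufOracle :=
  .seq (.load (N + 31) (N + 6) [j]) <|
  .ite (N + 31) .skip <|
  .seq (.pub .sigKeyGen [N + 32, N + 33] []) <|
  .seq (.store (N + 7) [j] (N + 33)) <|
  .seq (.const (N + 31) 1) (.store (N + 6) [j] (N + 31))

/-- Start a session for the signature key with the index in `j` and the receiver in `r`. -/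
def openSessionCode (N j r : ℕ) : Cmd w OmufOracle :=
  .seq (.load (N + 34) (N + 7) [j]) <|
  .seq (.pub .comCommit [N + 20, N + 35] [N + 34]) <|
  .seq (.pub .comCommit [N + 21, N + 36] [r]) <|
  .seq (.load (N + 22) (N + 8) []) <|
  .seq (.store (N + 10) [N + 22] (N + 20)) <|
  .seq (.store (N + 11) [N + 22] (N + 21)) <|
  .seq (.store (N + 12) [N + 22] (N + 35)) <|
  .seq (.store (N + 13) [N + 22] (N + 36)) <|
  .seq (.const (N + 37) 1) <|
  .seq (.store (N + 9) [N + 22] (N + 37)) (.word .add (N + 8) (N + 8) (N + 37))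

/-- Simulation of the oracle `OIssueTag`.  A missing key gives the empty answer. -/
def issueCode (S : System w q G) (N : ℕ) : List ℕ → Cmd w OmufOracle
  | [j, r] => .seq (keyIndexCode S N j) <|
      .ite (N + 30) (.seq (sampleKeyCode N j) (openSessionCode N j r)) .skip
  | _ => .skip

theorem verifyCode_run (S : System w q G) {g : G} {esk : ZMod q}
    {pk : BitVec w} {T N t : ℕ} {args : List ℕ} (hargs : ∀ a ∈ args, a < N) {st : ScState w q}
    {κ : ℕ → Option (BitVec w × BitVec w)} {m : Store w} {n : ℕ}
    (hinv : ScInv S g esk pk T N (t + 1) st κ m n) (h0 : ∀ j < 6, m.reg (N + 20 + j) = 0)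
    (Ψ : Store w × ℕ → ℝ≥0∞) (F : List (BitVec w × BitVec w) → List (BitVec w) × ScState w q → ℝ≥0∞)
    (ε : ℝ≥0∞)
    (hF : ∀ κ' st' m' n' ans, AgreeBelow N m m' → HoldsAnswer (N + 20) 6 ans m' →
      ScInv S g esk pk T N t st' κ' m' n' →
      Ψ (m', n') ≤ expect (S.lazyKeys S.numKeys κ') (fun i => F i (ans, st')) + ε) :
    expect ((verifyCode N args).run S.pub (S.omufHandler esk) (m, n)) Ψ ≤
      expect (S.lazyKeys S.numKeys κ) (fun i =>
        expect (S.scHandler pk esk i .verify (args.map m.reg) st) (F i)) + ε := by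
  match args with
  | [] | [_] | _ :: _ :: _ :: _ =>
    simp only [verifyCode, Cmd.run, expect_pure, List.map, System.scHandler]
    exact hF _ _ _ _ _ (AgreeBelow.refl _ _) ⟨by simp, by simpa using h0⟩
      (hinv.congr (by omega) (AgreeBelow.refl _ _))
  | [a, b] =>
    have hb : b < N := hargs b (by simp)
    have htest : ∀ n x, S.testKey esk (S.enc (S.hashG n)) x = S.ppVerify esk n x := by
      intro n x; simp [System.testKey, System.ppVerify]
    simp only [verifyCode, Cmd.run, List.map, System.scHandler, System.pub, PMF.pure_bind,
      Store.setRegs, System.omufHandler, List.headD_cons, Store.reg_set, and_true, if_true,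
      eq_add_iff_false hb, if_false, htest, expect_pure]
    refine hF _ _ _ _ _ ?_ ⟨by simp, fun j hj => ?_⟩ (hinv.congr (by omega) ?_)
    · intro c hc i
      simp [Store.set_apply, eq_add_iff_false hc]
    · have := h0 j hj
      interval_cases j <;> simp_all [Store.reg_set]
    · intro c hc i
      simp [Store.set_apply, eq_add_iff_false_of_le hc]

theorem hashCode_simulates (S : System w q G) (hG : Nat.card G = q) {g : G} {esk : ZMod q}
    {pk : BitVec w} {T N t : ℕ} {args : List ℕ} (hargs : ∀ a ∈ args, a < N) {st : ScState w q}
    {κ : ℕ → Option (BitVec w × BitVec w)} {m : Store w} {n : ℕ}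
    (hinv : ScInv S g esk pk T N (t + 1) st κ m n) (h0 : ∀ j < 6, m.reg (N + 20 + j) = 0)
    (Ψ : Store w × ℕ → ℝ≥0∞) (F : ZMod q × HashTable w q → ℝ≥0∞)
    (hF : ∀ c H' m', AgreeBelow N m m' → HoldsAnswer (N + 20) 6 [scalarWord w c] m' →
      ScInv S g esk pk T N t { st with table := H' } κ m' n → Ψ (m', n) ≤ F (c, H')) :
    expect ((hashCode N args).run S.pub (S.omufHandler esk) (m, n)) Ψ ≤
      expect (hashQuery (args.map m.reg) st.table) F := by
  refine hashCode_run S hG esk hargs n hinv.table Ψ F fun c H' m' hm' hc hag hD => ?_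
  refine hF c H' m' (fun a ha => hag a (by omega) (by omega) (by omega) (by omega))
    ⟨by simp, fun j hj => ?_⟩ (hinv.update_table hm' hD
      fun a ha h4 h5 => hag a (by omega) h4 h5 (by omega))
  cases j with
  | zero => simpa using hc
  | succ j =>
    have := h0 (j + 1) hj
    rw [show m'.reg (N + 20 + (j + 1)) = m.reg (N + 20 + (j + 1)) from
      hag _ (by omega) (by omega) (by omega) (by omega) _, this]
    simp

theorem getElem?_append_single {l : List (Session w)} (hl : l.length < 2 ^ w) (se : Session w)
    (i : BitVec w) : (l ++ [se])[i.toNat]? =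
      if i = BitVec.ofNat w l.length then some se else l[i.toNat]? := by
  split_ifs with h
  · subst h
    simp [BitVec.toNat_ofNat, Nat.mod_eq_of_lt hl]
  · have hne : i.toNat ≠ l.length :=
      fun h' => h (by rw [← h', BitVec.ofNat_toNat, BitVec.setWidth_eq])
    rcases lt_or_gt_of_ne hne with hlt | hgt
    · rw [List.getElem?_append_left hlt]
    · rw [List.getElem?_eq_none (by simp; omega), List.getElem?_eq_none (by omega)]

theorem openSessionCode_run (S : System w q G) (hG : Nat.card G = q) {g : G} {esk : ZMod q}
    {pk : BitVec w} {T N t : ℕ} (hT : T < 2 ^ w) {j r : ℕ} (hr : r < N)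
    {st : ScState w q}
    {κ : ℕ → Option (BitVec w × BitVec w)} {m : Store w} {n : ℕ} {v : BitVec w × BitVec w}
    (hinv : ScInv S g esk pk T N (t + 1) st κ m n) (h0 : ∀ j < 6, m.reg (N + 20 + j) = 0)
    (hv : κ (m.reg j).toNat = some v)
    (Ψ : Store w × ℕ → ℝ≥0∞) (F : List (BitVec w) × ScState w q → ℝ≥0∞)
    (hF : ∀ st' m' n' ans, AgreeBelow N m m' → HoldsAnswer (N + 20) 6 ans m' →
      ScInv S g esk pk T N t st' κ m' n' → Ψ (m', n') ≤ F (ans, st')) :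
    expect ((openSessionCode N j r).run S.pub (S.omufHandler esk) (m, n)) Ψ ≤
      expect (S.tagIssueFirst v.2 (m.reg r)) fun se =>
        F ([se.comS, se.comR, BitVec.ofNat w st.sessions.length],
          { st with sessions := st.sessions ++ [se] }) := by
  have hw := S.width_pos hG
  have hkey := hinv.keys.value _ _ hv
  have hcnt : m (N + 8) [] = _ := hinv.sessions.count
  have hlen := hinv.sessions_length
  have hget := getElem?_append_single (l := st.sessions) (by omega)
  simp only [openSessionCode, Cmd.run, List.map, System.pub, Store.setRegs, PMF.pure_bind,
    expect_bind, expect_pure, System.tagIssueFirst, Store.reg_set, hkey, and_self, if_true,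
    List.headD_cons, List.tail_cons, eq_add_iff_false hr, false_and, if_false]
  refine expect_mono fun a => expect_mono fun b => ?_
  simp [Store.set_apply, hcnt, WordOp.eval]
  refine hF _ _ _ _ ?_ ⟨by simp, fun k hk => ?_⟩
    { consts := hinv.consts.congr fun c hc i => ?_
      table := hinv.table.congr ?_ ?_
      keys := hinv.keys.congr fun c hc hc' i => ?_
      sessions := ?_
      table_finite := ?_
      sessions_length := by simp only [List.length_append, List.length_singleton]; omega
      ctr := hinv.ctr
      alive := hinv.alive }
  · intro c hc i
    simp [Store.set_apply, eq_add_iff_false hc]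
  · have := h0 k hk
    interval_cases k <;> simp_all [Store.reg_set]
  · have hne : ∀ k, 4 ≤ k → k ≠ 14 → c ≠ N + k := by omega
    simp [Store.set_apply, hne]
  · intro x; simp [Store.set_apply]
  · intro x; simp [Store.set_apply]
  · have hne : ∀ k, k < 6 ∨ 8 ≤ k → c ≠ N + k := by omega
    simp [Store.set_apply, hne]
  · refine ⟨?_, fun i => ?_, fun i se => ?_, fun i se => ?_, fun i se => ?_, fun i se => ?_⟩
    · have hcnt' : m.reg (N + 8) = _ := hinv.sessions.count
      simp [Store.reg_set, hcnt', BitVec.ofNat_add]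
    · rw [hget]
      have := hinv.sessions.live i
      by_cases h : i = BitVec.ofNat w st.sessions.length <;> simp [Store.set_apply, h, bit]
      simpa [bit] using this
    · rw [hget]
      have := hinv.sessions.comS i se
      by_cases h : i = BitVec.ofNat w st.sessions.length <;> simp [Store.set_apply, h]
      · rintro rfl; rfl
      · exact this
    · rw [hget]
      have := hinv.sessions.comR i se
      by_cases h : i = BitVec.ofNat w st.sessions.length <;> simp [Store.set_apply, h]
      · rintro rfl; rfl
      · exact this
    · rw [hget]
      have := hinv.sessions.opS i se
      by_cases h : i = BitVec.ofNat w st.sessions.length <;> simp [Store.set_apply, h]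
      · rintro rfl; rfl
      · exact this
    · rw [hget]
      have := hinv.sessions.opR i se
      by_cases h : i = BitVec.ofNat w st.sessions.length <;> simp [Store.set_apply, h]
      · rintro rfl; rfl
      · exact this
  · obtain ⟨D, hD, hD'⟩ := hinv.table_finite
    exact ⟨D, by omega, hD'⟩

theorem keyIndexCode_run (S : System w q G) (esk : ZMod q) {N j : ℕ} (hj : j < N)
    (m : Store w) (n : ℕ) :
    ∃ m', (keyIndexCode S N j).run S.pub (S.omufHandler esk) (m, n) = PMF.pure (m', n) ∧
      m'.reg (N + 30) = bit (decide ((m.reg j).toNat < S.numKeys)) ∧ AgreeBelow (N + 30) m m' := by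
  unfold keyIndexCode
  split_ifs with h
  · refine ⟨_, rfl, ?_, fun a ha i => ?_⟩
    · have : (m.reg j).toNat < S.numKeys := (m.reg j).isLt.trans_le h
      simp [Store.reg_set, this, bit]
    · simp [Store.set_apply, eq_add_iff_false_of_le ha]
  · simp only [Cmd.run, PMF.pure_bind]
    refine ⟨_, rfl, ?_, fun a ha i => ?_⟩
    · simp [Store.reg_set, WordOp.eval, bit, eq_add_iff_false hj, BitVec.toNat_ofNat,
        Nat.mod_eq_of_lt (not_le.1 h)]
    · simp [Store.set_apply, eq_add_iff_false_of_le ha]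

/-- Sampling a key in the simulation corresponds to revealing a key of the genuine game, all of whose
keys are sampled at the beginning. -/
theorem sampleKeyCode_run (S : System w q G) (hG : Nat.card G = q) {g : G} {esk : ZMod q}
    {pk : BitVec w} {T N t : ℕ} {j : ℕ} (hj : j < N)
    {st : ScState w q} {κ : ℕ → Option (BitVec w × BitVec w)} {m : Store w} {n : ℕ}
    (hinv : ScInv S g esk pk T N t st κ m n) (h0 : ∀ j < 6, m.reg (N + 20 + j) = 0)
    (hlt : (m.reg j).toNat < S.numKeys) (Ψ : Store w × ℕ → ℝ≥0∞)
    (F : List (BitVec w × BitVec w) → ℝ≥0∞) (ε : ℝ≥0∞)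
    (hF : ∀ κ' v m', κ' (m.reg j).toNat = some v → ScInv S g esk pk T N t st κ' m' n →
      AgreeBelow N m m' → (∀ j < 6, m'.reg (N + 20 + j) = 0) →
      Ψ (m', n) ≤ expect (S.lazyKeys S.numKeys κ') F + ε) :
    expect ((sampleKeyCode N j).run S.pub (S.omufHandler esk) (m, n)) Ψ ≤
      expect (S.lazyKeys S.numKeys κ) F + ε := by
  have hw := S.width_pos hG
  simp only [sampleKeyCode, Cmd.run, List.map, PMF.pure_bind,
    hinv.keys.isDefined, Store.reg_set, and_self, if_true, ne_eq, bit_eq_zero hw]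
  cases hκ : κ (m.reg j).toNat with
  | some v =>
    simp only [Option.isSome_some, Bool.true_eq_false, not_false_eq_true, if_true, expect_pure]
    refine hF κ v _ hκ (hinv.congr le_rfl fun a ha i => ?_) (fun a ha i => ?_)
      fun k hk => ?_
    · simp [Store.set_apply, eq_add_iff_false_of_le ha]
    · simp [Store.set_apply, eq_add_iff_false ha]
    · simp [Store.reg_set, h0 k hk, show N + 20 + k ≠ N + 31 by omega]
  | none =>
    simp only [Option.isSome_none, not_true_eq_false, if_false, System.pub, Store.setRegs,
      expect_bind, expect_pure, List.headD_cons, List.tail_cons]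
    rw [S.expect_lazyKeys_sample _ κ _ hlt hκ, ← expect_const S.sig.keyGen ε, ← expect_add]
    refine expect_mono fun v => ?_
    simp only [Store.reg_set, eq_add_iff_false hj, false_and, if_false, and_true, if_true]
    refine hF (Function.update κ (m.reg j).toNat (some v)) v _ (Function.update_self _ _ _)
      { consts := hinv.consts.congr fun c hc i => ?_
        table := hinv.table.congr ?_ ?_
        keys := ⟨fun i => ?_, fun i u hu => ?_⟩
        sessions := hinv.sessions.congr fun c hc hc' i => ?_
        table_finite := hinv.table_finite
        sessions_length := hinv.sessions_length
        ctr := hinv.ctr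
        alive := hinv.alive } (fun a ha i => ?_) fun k hk => ?_
    · have hne : ∀ k, 4 ≤ k → k ≠ 14 → c ≠ N + k := by omega
      simp [Store.set_apply, hne]
    · intro x; simp [Store.set_apply]
    · intro x; simp [Store.set_apply]
    · have := hinv.keys.isDefined i
      by_cases h : i = m.reg j
      · simp [Store.set_apply, h, bit]
      · have h' : i.toNat ≠ (m.reg j).toNat := fun h' => h (BitVec.eq_of_toNat_eq h')
        simp [Store.set_apply, h, h', this]
    · have := hinv.keys.value i u
      by_cases h : i = m.reg j
      · subst h
        rw [Function.update_self] at hu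
        simp [Store.set_apply, ← Option.some.inj hu]
      · have h' : i.toNat ≠ (m.reg j).toNat := fun h' => h (BitVec.eq_of_toNat_eq h')
        rw [Function.update_of_ne h'] at hu
        simp [Store.set_apply, h, this hu]
    · have hne : ∀ k, k < 8 ∨ 14 ≤ k → c ≠ N + k := by omega
      simp [Store.set_apply, hne]
    · simp [Store.set_apply, eq_add_iff_false ha]
    · have hne : ∀ l, 26 ≤ l → N + 20 + k ≠ N + l := by omega
      have hne' : ∀ l, l < 20 → N + 20 + k ≠ N + l := by omega
      simp [Store.reg_set, h0 k hk, hne, hne']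

theorem issueCode_run (S : System w q G) (hG : Nat.card G = q) {g : G} {esk : ZMod q}
    {pk : BitVec w} {T N t : ℕ} (hT : T < 2 ^ w) {args : List ℕ} (hargs : ∀ a ∈ args, a < N)
    {st : ScState w q} {κ : ℕ → Option (BitVec w × BitVec w)} {m : Store w} {n : ℕ}
    (hinv : ScInv S g esk pk T N (t + 1) st κ m n) (h0 : ∀ j < 6, m.reg (N + 20 + j) = 0)
    (Ψ : Store w × ℕ → ℝ≥0∞) (F : List (BitVec w × BitVec w) → List (BitVec w) × ScState w q → ℝ≥0∞)
    (ε : ℝ≥0∞)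
    (hF : ∀ κ' st' m' n' ans, AgreeBelow N m m' → HoldsAnswer (N + 20) 6 ans m' →
      ScInv S g esk pk T N t st' κ' m' n' →
      Ψ (m', n') ≤ expect (S.lazyKeys S.numKeys κ') (fun i => F i (ans, st')) + ε) :
    expect ((issueCode S N args).run S.pub (S.omufHandler esk) (m, n)) Ψ ≤
      expect (S.lazyKeys S.numKeys κ) (fun i =>
        expect (S.scHandler pk esk i .issueTag (args.map m.reg) st) (F i)) + ε := by
  have hw := S.width_pos hG
  match args with
  | [] | [_] | _ :: _ :: _ :: _ =>
    simp only [issueCode, Cmd.run, expect_pure, List.map, System.scHandler, System.issueTag]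
    exact hF _ _ _ _ _ (AgreeBelow.refl _ _) ⟨by simp, by simpa using h0⟩
      (hinv.congr (by omega) (AgreeBelow.refl _ _))
  | [j, r] =>
    have hj : j < N := hargs j (by simp)
    have hr : r < N := hargs r (by simp)
    obtain ⟨m₁, hrun₁, hreg₁, hag₁⟩ := keyIndexCode_run S esk hj m n
    have hinv₁ := hinv.congr le_rfl (hag₁.mono (by omega))
    have h0₁ : ∀ j < 6, m₁.reg (N + 20 + j) = 0 := fun k hk => by
      rw [hag₁.reg (by omega), h0 k hk]
    have hj₁ : m₁.reg j = m.reg j := hag₁.reg (by omega)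
    have hr₁ : m₁.reg r = m.reg r := hag₁.reg (by omega)
    simp only [issueCode, Cmd.run, hrun₁, PMF.pure_bind, hreg₁, ne_eq, bit_eq_zero hw, List.map,
      decide_eq_false_iff_not, not_not, System.scHandler]
    by_cases hlt : (m.reg j).toNat < S.numKeys
    · have hstart : ∀ (κ : ℕ → Option (BitVec w × BitVec w)) (v : BitVec w × BitVec w)
          (m₂ : Store w), κ (m.reg j).toNat = some v → ScInv S g esk pk T N (t + 1) st κ m₂ n →
          AgreeBelow N m m₂ → (∀ j < 6, m₂.reg (N + 20 + j) = 0) →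
          expect ((openSessionCode N j r).run S.pub (S.omufHandler esk) (m₂, n)) Ψ ≤
          expect (S.lazyKeys S.numKeys κ)
            (fun i => expect (S.issueTag i [m.reg j, m.reg r] st) (F i)) + ε := by
        intro κ v m₂ hv hinv₂ hag₂ h0₂
        have hj₂ : m₂.reg j = m.reg j := hag₂.reg hj
        have hr₂ : m₂.reg r = m.reg r := hag₂.reg hr
        refine (openSessionCode_run S hG hT hr hinv₂ h0₂ (by rw [hj₂]; exact hv) Ψ
          (fun x => expect (S.lazyKeys S.numKeys κ) (fun i => F i x) + ε)
          fun st' m' n' ans hag hans hi => hF κ st' m' n' ans (hag₂.trans hag) hans hi).trans ?_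
        rw [expect_add, expect_const, hr₂]
        gcongr
        exact expect_issueTag S st hlt hv F
      simp only [hlt, if_true, expect_bind]
      refine sampleKeyCode_run S hG hj hinv₁ h0₁ (by rwa [hj₁]) _ _ ε
        fun κ' v m₂ hv hi hag h0 => ?_
      rw [hj₁] at hv
      exact hstart κ' v m₂ hv hi ((hag₁.mono (by omega)).trans hag) h0
    · simp only [hlt, if_false, expect_pure]
      refine (hF κ st m₁ n [] (hag₁.mono (by omega)) ⟨by simp, by simpa using h0₁⟩
        (hinv₁.congr (by omega) (AgreeBelow.refl _ _))).trans ?_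
      gcongr
      refine expect_mono_support fun i hi => ?_
      have : i[(m.reg j).toNat]? = none :=
        List.getElem?_eq_none (by rw [(S.mem_support_lazyKeys hi).1]; omega)
      simp [System.issueTag, this]

end Oracles

/-! ### Simulation of the reports -/

section

variable {w q : ℕ} {G : Type} [AddCommGroup G]

theorem AttemptInput.congr {S : System w q G} {esk : ZMod q} {g P₁ P₂ : G} {deg : Bool}
    {N gen X Q : ℕ} {m m' : Store w} (h : AttemptInput S esk g P₁ P₂ deg N gen X Q m)
    (hgen : gen < N) (hX : X < N) (hQ : Q < N)
    (hm : ∀ a < N + 33, a ≠ N + 23 → a ≠ N + 24 → ∀ i, m' a i = m a i) :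
    AttemptInput S esk g P₁ P₂ deg N gen X Q m' := by
  have hreg : ∀ a < N + 33, a ≠ N + 23 → a ≠ N + 24 → m'.reg a = m.reg a :=
    fun a h1 h2 h3 => hm a h1 h2 h3 []
  exact
    ⟨(hreg _ (by omega) (by omega) (by omega)).trans h.base,
      (hreg _ (by omega) (by omega) (by omega)).trans h.order,
      (hreg _ (by omega) (by omega) (by omega)).trans h.epk,
      (hreg _ (by omega) (by omega) (by omega)).trans h.gen,
      (hreg _ (by omega) (by omega) (by omega)).trans h.X,
      (hreg _ (by omega) (by omega) (by omega)).trans h.Q,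
      (hreg _ (by omega) (by omega) (by omega)).trans h.R,
      (hreg _ (by omega) (by omega) (by omega)).trans h.deg⟩

end

section Report

variable {w q : ℕ} [Fact q.Prime] {G : Type} [AddCommGroup G]

/-- Put into the register `N + 30` whether the tag in the registers `comS`, …, `sigma` is accepted
for the session with the index in `i`. -/
def acceptCode (N i comS comR time rep ct ppQ ppG Q gen X sigma : ℕ) : Cmd w OmufOracle :=
  .seq (.pub .groupValid [N + 30] [Q]) <|
  .seq (.pub .timeFresh [N + 31] [time]) <|
  .seq (.word .and (N + 30) (N + 30) (N + 31)) <|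
  .seq (.load (N + 31) (N + 10) [i]) <|
  .seq (.word .eq (N + 31) (N + 31) comS) <|
  .seq (.word .and (N + 30) (N + 30) (N + 31)) <|
  .seq (.load (N + 31) (N + 11) [i]) <|
  .seq (.word .eq (N + 31) (N + 31) comR) <|
  .seq (.word .and (N + 30) (N + 30) (N + 31)) <|
  .seq (.pub .sigVerify [N + 31]
    [N + 14, sigma, comS, comR, time, rep, ct, ppQ, ppG, Q, gen, X]) <|
  .seq (.word .and (N + 30) (N + 30) (N + 31)) <|
  .seq (.call .ver [N + 31] [gen, X]) (.word .and (N + 30) (N + 30) (N + 31))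

/-- Three attempts to simulate a proof, of which those after a success are skipped. -/
def proofCode (S : System w q G) (N gen X Q : ℕ) : Cmd w OmufOracle :=
  .seq (attemptCode S N gen X Q) <|
  .seq (.ite (N + 33) .skip (attemptCode S N gen X Q))
    (.ite (N + 33) .skip (attemptCode S N gen X Q))

/-- Put into the register `N + 32` whether the elements in `gen` and `Q` are both zero.  In this case
all nonces lead to the same point of the random oracle, and `A` may have queried it. -/
def degenerateCode (S : System w q G) (N gen Q : ℕ) : Cmd w OmufOracle :=
  .seq (.const (N + 30) (S.enc 0)) <|
  .seq (.word .eq (N + 31) gen (N + 30)) <|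
  .seq (.word .eq (N + 32) Q (N + 30)) (.word .and (N + 32) (N + 31) (N + 32))

/-- Mark the session with the index in `i` as reported and return the openings. -/
def closeSessionCode (N i : ℕ) : Cmd w OmufOracle :=
  .seq (.const (N + 34) 0) <|
  .seq (.store (N + 9) [i] (N + 34)) <|
  .seq (.const (N + 20) 1) <|
  .seq (.load (N + 21) (N + 12) [i]) (.load (N + 22) (N + 13) [i])

/-- Simulation of the oracle `OReport`.  Nothing needs to be done where the game is aborted. -/
def reportCode (S : System w q G) (N : ℕ) : List ℕ → Cmd w OmufOracle
  | [i, comS, comR, time, rep, ct, ppQ, ppG, Q, gen, X, sigma] =>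
    .seq (.load (N + 30) (N + 9) [i]) <|
    .ite (N + 30)
      (.seq (acceptCode N i comS comR time rep ct ppQ ppG Q gen X sigma) <|
       .ite (N + 30)
        (.seq (.call .sign [N + 25] [Q]) <|
         .seq (degenerateCode S N gen Q) <|
         .seq (proofCode S N gen X Q) (closeSessionCode N i))
        .skip)
      .skip
  | _ => .skip

theorem wordEq_eval (a b : BitVec w) : WordOp.eq.eval a b = bit (decide (a = b)) := by
  simp [WordOp.eval, bit]

theorem wordAnd_eval (a b : Bool) : WordOp.and.eval (bit a : BitVec w) (bit b) = bit (a && b) :=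
  bit_and_bit a b

/-- The conditions under which the sender answers a report. -/
def System.accepts (S : System w q G) (pk : BitVec w) (esk : ZMod q) (se : Session w) (t : Tag w) :
    Bool :=
  (S.decode t.Q).isSome && S.fresh t.time && decide (se.comS = t.comS) &&
    decide (se.comR = t.comR) && S.sig.verify pk t.sigma t.message && S.testKey esk t.gen t.X

theorem acceptCode_run (S : System w q G) {g : G} {esk : ZMod q} {pk : BitVec w} {T N t : ℕ}
    {i comS comR time rep ct ppQ ppG Q gen X sigma : ℕ}
    (hargs : ∀ a ∈ [i, comS, comR, time, rep, ct, ppQ, ppG, Q, gen, X, sigma], a < N)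
    {st : ScState w q} {κ : ℕ → Option (BitVec w × BitVec w)} {m : Store w} {n : ℕ}
    (hinv : ScInv S g esk pk T N t st κ m n) {se : Session w}
    (hse : st.sessions[(m.reg i).toNat]? = some se) :
    ∃ m', (acceptCode N i comS comR time rep ct ppQ ppG Q gen X sigma).run S.pub
        (S.omufHandler esk) (m, n) = PMF.pure (m', n) ∧
      m'.reg (N + 30) = bit (S.accepts pk esk se ⟨m.reg comS, m.reg comR, m.reg time, m.reg rep,
        m.reg ct, m.reg ppQ, m.reg ppG, m.reg Q, m.reg gen, m.reg X, m.reg sigma⟩) ∧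
      AgreeBelow (N + 30) m m' := by
  simp only [List.forall_mem_cons] at hargs
  obtain ⟨h1, h2, h3, h4, h5, h6, h7, h8, h9, h10, h11, h12, -⟩ := hargs
  have hc := hinv.sessions.comS _ _ hse
  have hc' := hinv.sessions.comR _ _ hse
  have hpk := hinv.consts.pk
  simp only [acceptCode, Cmd.run, List.map, System.pub, Store.setRegs, PMF.pure_bind,
    System.omufHandler]
  refine ⟨_, rfl, ?_, fun a ha j => ?_⟩
  · simp [Store.reg_set, Store.set_apply, eq_add_iff_false, h1, h2, h3, h4, h5, h6, h7, h8, h9,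
      h10, h11, h12, hc, hc', hpk, wordEq_eval, wordAnd_eval, System.accepts, Tag.message]
  · simp [Store.set_apply, eq_add_iff_false_of_le ha]

theorem degenerateCode_run (S : System w q G) (esk : ZMod q) {N gen Q : ℕ} (hgen : gen < N)
    (hQ : Q < N) {m : Store w} (n : ℕ) {P₁ P₂ : G} (h₁ : m.reg gen = S.enc P₁)
    (h₂ : m.reg Q = S.enc P₂) :
    ∃ m', (degenerateCode S N gen Q).run S.pub (S.omufHandler esk) (m, n) = PMF.pure (m', n) ∧
      m'.reg (N + 32) = bit (decide (S.enc P₁ = S.enc 0) && decide (S.enc P₂ = S.enc 0)) ∧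
      AgreeBelow (N + 30) m m' := by
  simp only [degenerateCode, Cmd.run, PMF.pure_bind]
  refine ⟨_, rfl, ?_, fun a ha j => ?_⟩
  · simp only [Store.reg_set, eq_add_iff_false, hgen, hQ, h₁, h₂, if_false, and_true,
      if_true, wordEq_eval, show ¬ N + 30 = N + 31 by omega]
    simp [wordAnd_eval]
  · simp [Store.set_apply, eq_add_iff_false_of_le ha]

/-- The point depends injectively on the nonce unless both elements are zero. -/
theorem pointSpec_nizkPoint (S : System w q G) (hG : Nat.card G = q) (esk : ZMod q) (P₁ P₂ : G) :
    PointSpec (nizkPoint S esk P₁ P₂)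
      (decide (S.enc P₁ = S.enc 0) && decide (S.enc P₂ = S.enc 0)) := by
  unfold PointSpec
  by_cases h₁ : P₁ = 0
  · by_cases h₂ : P₂ = 0
    · simp [h₁, h₂, nizkPoint, mulG_zero_right]
    · have : Function.Injective (nizkPoint S esk P₁ P₂) := fun k k' h => by
        simp only [nizkPoint, List.cons.injEq, S.enc.injective.eq_iff] at h
        exact mulG_injective hG h₂ h.2.2.2.2.2.2.1
      simpa [h₂] using this
  · have : Function.Injective (nizkPoint S esk P₁ P₂) := fun k k' h => by
      simp only [nizkPoint, List.cons.injEq, S.enc.injective.eq_iff] at h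
      exact mulG_injective hG h₁ h.2.2.2.2.2.1
    simpa [h₁] using this

theorem proofCode_run (S : System w q G) (hG : Nat.card G = q) {esk : ZMod q} {g P₁ P₂ : G}
    (hg : g ≠ 0) {deg : Bool} {N gen X Q : ℕ} (hgen : gen < N) (hX : X < N) (hQ : Q < N)
    {H : HashTable w q} {m : Store w} (n : ℕ)
    (hm : MemTable N H m) (hin : AttemptInput S esk g P₁ P₂ deg N gen X Q m)
    (Ψ : Store w × ℕ → ℝ≥0∞) (hΨ : ∀ x, Ψ x ≤ 1)
    (a : (ZMod q × ZMod q) × HashTable w q → ℝ≥0∞)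
    (ha : ∀ c s H' m', MemTable N H' m' → m'.reg (N + 23) = scalarWord w c →
      m'.reg (N + 24) = scalarWord w s →
      (∀ a < N + 33, a ≠ N + 4 → a ≠ N + 5 → a ≠ N + 23 → a ≠ N + 24 → ∀ i, m' a i = m a i) →
      (∀ D : Finset (List (BitVec w)), (∀ x ∉ D, H x = none) →
        ∃ D' : Finset (List (BitVec w)), D'.card ≤ D.card + 1 ∧ ∀ x ∉ D', H' x = none) →
      Ψ (m', n) ≤ a ((c, s), H')) :
    expect ((proofCode S N gen X Q).run S.pub (S.omufHandler esk) (m, n)) Ψ ≤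
      attemptValue (nizkPoint S esk P₁ P₂) deg esk H a
        (attemptValue (nizkPoint S esk P₁ P₂) deg esk H a
          (attemptValue (nizkPoint S esk P₁ P₂) deg esk H a 1)) := by
  have hw := S.width_pos hG
  have h10 : (1 : BitVec w) ≠ 0 := one_ne_zero_word hw
  simp only [proofCode, Cmd.run, expect_bind]
  -- after a failure, the next attempt starts from the same table
  refine attemptCode_run S hG hg hgen hX hQ n hm hin _ a _ (fun c s H' m₁ h1 h2 h3 h4 h5 h6 => ?_)
    fun m₁ hm₁ h0₁ hag₁ => ?_
  · simp only [h4, h10, ne_eq, not_false_eq_true, if_true, expect_pure]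
    exact ha c s H' m₁ h1 h2 h3 h5 h6
  simp only [h0₁, ne_eq, not_true_eq_false, if_false]
  refine attemptCode_run S hG hg hgen hX hQ n hm₁ (hin.congr hgen hX hQ hag₁) _ a _
    (fun c s H' m₂ h1 h2 h3 h4 h5 h6 => ?_) fun m₂ hm₂ h0₂ hag₂ => ?_
  · simp only [h4, h10, not_false_eq_true, if_true, expect_pure]
    exact ha c s H' m₂ h1 h2 h3 (fun a k1 k2 k3 k4 k5 i =>
      (h5 a k1 k2 k3 k4 k5 i).trans (hag₁ a k1 k4 k5 i)) h6
  simp only [h0₂, not_true_eq_false, if_false]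
  have hag : ∀ a < N + 33, a ≠ N + 23 → a ≠ N + 24 → ∀ i, m₂ a i = m a i :=
    fun a h1 h2 h3 i => (hag₂ a h1 h2 h3 i).trans (hag₁ a h1 h2 h3 i)
  exact attemptCode_run S hG hg hgen hX hQ n hm₂ (hin.congr hgen hX hQ hag) _ a _
    (fun c s H' m₃ h1 h2 h3 h4 h5 h6 => ha c s H' m₃ h1 h2 h3 (fun a k1 k2 k3 k4 k5 i =>
      (h5 a k1 k2 k3 k4 k5 i).trans (hag a k1 k4 k5 i)) h6) fun m₃ _ _ _ => hΨ _

theorem getElem?_set_session {l : List (Session w)} {i : BitVec w} {se : Session w}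
    (hse : l[i.toNat]? = some se) (se' : Session w) (j : BitVec w) :
    (l.set i.toNat se')[j.toNat]? = if j = i then some se' else l[j.toNat]? := by
  have hlt : i.toNat < l.length := (List.getElem?_eq_some_iff.1 hse).1
  split_ifs with h
  · subst h
    simp [hlt]
  · rw [List.getElem?_set_ne fun h' => h (BitVec.eq_of_toNat_eq h'.symm)]

theorem closeSessionCode_run (S : System w q G) (esk : ZMod q) {g : G} {pk : BitVec w}
    {T N t i : ℕ} (hi : i < N) {st : ScState w q}
    {κ : ℕ → Option (BitVec w × BitVec w)} {m : Store w} {n n' : ℕ}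
    (hinv : ScInv S g esk pk T N t st κ m n) {se : Session w}
    (hse : st.sessions[(m.reg i).toNat]? = some se) :
    ∃ m', (closeSessionCode N i).run S.pub (S.omufHandler esk) (m, n') = PMF.pure (m', n') ∧
      AgreeBelow N m m' ∧ m'.reg (N + 20) = 1 ∧ m'.reg (N + 21) = se.opS ∧
      m'.reg (N + 22) = se.opR ∧ (∀ j, 23 ≤ j → j < 26 → m'.reg (N + j) = m.reg (N + j)) ∧
      ScInv S g esk pk T N t
        { st with sessions := st.sessions.set (m.reg i).toNat { se with reported := true }
                  ctr := st.ctr + 1 } κ m' (n + 1) := by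
  have hS := hinv.sessions.opS _ _ hse
  have hR := hinv.sessions.opR _ _ hse
  have hget := getElem?_set_session hse
  simp only [closeSessionCode, Cmd.run, PMF.pure_bind, List.map]
  refine ⟨_, rfl, fun a ha j => ?_, ?_, ?_, ?_, fun j hj hj' => ?_,
    { consts := hinv.consts.congr fun c hc i => ?_
      table := hinv.table.congr ?_ ?_
      keys := hinv.keys.congr fun c hc hc' i => ?_
      sessions := ?_
      table_finite := hinv.table_finite
      sessions_length := by simpa using hinv.sessions_length
      ctr := by rw [hinv.ctr]
      alive := hinv.alive }⟩
  · simp [Store.set_apply, eq_add_iff_false ha]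
  · simp [Store.reg_set]
  · simp [Store.reg_set, Store.set_apply, eq_add_iff_false hi, hS]
  · simp [Store.reg_set, Store.set_apply, eq_add_iff_false hi, hR]
  · have hne : ∀ k, k < 23 ∨ 26 ≤ k → j ≠ k := by omega
    simp [Store.reg_set, hne]
  · have hne : ∀ k, 4 ≤ k → k ≠ 14 → c ≠ N + k := by omega
    simp [Store.set_apply, hne]
  · intro x; simp [Store.set_apply]
  · intro x; simp [Store.set_apply]
  · have hne : ∀ k, k < 6 ∨ 8 ≤ k → c ≠ N + k := by omega
    simp [Store.set_apply, hne]
  · refine ⟨?_, fun j => ?_, fun j se' => ?_, fun j se' => ?_, fun j se' => ?_, fun j se' => ?_⟩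
    · have := hinv.sessions.count
      simpa [Store.reg_set] using this
    · rw [hget]
      have := hinv.sessions.live j
      by_cases h : j = m.reg i
      · simp [Store.set_apply, Store.reg_set, eq_add_iff_false hi, h, bit]
      · simpa [Store.set_apply, Store.reg_set, eq_add_iff_false hi, h] using this
    · rw [hget]
      by_cases h : j = m.reg i
      · have := hinv.sessions.comS _ _ hse
        simp only [h, if_true, Option.some.injEq]
        rintro rfl
        simpa [Store.set_apply] using this
      · have := hinv.sessions.comS j se'
        simpa [Store.set_apply, h] using this
    · rw [hget]
      by_cases h : j = m.reg i
      · have := hinv.sessions.comR _ _ hse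
        simp only [h, if_true, Option.some.injEq]
        rintro rfl
        simpa [Store.set_apply] using this
      · have := hinv.sessions.comR j se'
        simpa [Store.set_apply, h] using this
    · rw [hget]
      by_cases h : j = m.reg i
      · have := hinv.sessions.opS _ _ hse
        simp only [h, if_true, Option.some.injEq]
        rintro rfl
        simpa [Store.set_apply] using this
      · have := hinv.sessions.opS j se'
        simpa [Store.set_apply, h] using this
    · rw [hget]
      by_cases h : j = m.reg i
      · have := hinv.sessions.opR _ _ hse
        simp only [h, if_true, Option.some.injEq]
        rintro rfl
        simpa [Store.set_apply] using this
      · have := hinv.sessions.opR j se'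
        simpa [Store.set_apply, h] using this

theorem tagIssueSecond_of_accepts (S : System w q G) {pk : BitVec w} {esk : ZMod q}
    {se : Session w} {t : Tag w} (h : S.accepts pk esk se t = true) (H : HashTable w q) :
    ∃ P₁ P₂, t.gen = S.enc P₁ ∧ t.X = S.enc (mulG esk P₁) ∧ t.Q = S.enc P₂ ∧
      S.tagIssueSecond pk esk se t H = (S.nizkDleq P₁ (mulG esk P₁) P₂ (mulG esk P₂) esk H).bind
        fun r => PMF.pure (some (r.1, mulG esk P₂), r.2) := by
  simp only [System.accepts, Bool.and_eq_true, decide_eq_true_eq, System.testKey] at h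
  obtain ⟨⟨⟨⟨⟨hQ, h1⟩, h2⟩, h3⟩, h4⟩, h5⟩ := h
  obtain ⟨P₂, hQ⟩ := Option.isSome_iff_exists.1 hQ
  cases hgen : S.decode t.gen with
  | none => simp [hgen] at h5
  | some P₁ =>
    simp only [hgen, decide_eq_true_eq] at h5
    refine ⟨P₁, P₂, S.enc_of_decode hgen, h5, S.enc_of_decode hQ, ?_⟩
    have hX : S.decode t.X = some (mulG esk P₁) := by rw [h5, S.decode_enc]
    simp [System.tagIssueSecond, hQ, hgen, hX, h1, h2, h3, h4]

theorem tagIssueSecond_of_not_accepts (S : System w q G) {pk : BitVec w} {esk : ZMod q}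
    {se : Session w} {t : Tag w} (h : S.accepts pk esk se t = false) (H : HashTable w q) :
    S.tagIssueSecond pk esk se t H = PMF.pure (none, H) := by
  unfold System.tagIssueSecond
  split
  next Q P X hQ hgen hX =>
    rw [if_neg]
    rintro ⟨h1, h2, h3, h4, h5⟩
    have : S.accepts pk esk se t = true := by
      simp [System.accepts, System.testKey, hQ, hgen, h1, h2, h3, h4, S.enc_of_decode hX, h5]
    rw [h] at this
    exact Bool.false_ne_true this
  · rfl

theorem expect_nizkDleq (S : System w q G) (P₁ P₂ : G) (esk : ZMod q) (H : HashTable w q)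
    (a : (ZMod q × ZMod q) × HashTable w q → ℝ≥0∞) :
    expect (S.nizkDleq P₁ (mulG esk P₁) P₂ (mulG esk P₂) esk H) a =
      expect (PMF.uniformOfFintype (ZMod q)ˣ) fun k =>
        proofValue (nizkPoint S esk P₁ P₂) esk H a k := by
  simp only [System.nizkDleq, expect_bind, expect_pure]
  rfl

/-- The signing query of the simulation corresponds to the increment of the counter in the genuine
game.  Where the genuine game is aborted, `A` loses in any case. -/
theorem reportCode_run (S : System w q G) (hG : Nat.card G = q) {g : G} (hg : g ≠ 0) {esk : ZMod q}
    {pk : BitVec w} {T N t : ℕ} {args : List ℕ} (hargs : ∀ a ∈ args, a < N)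
    {st : ScState w q} {κ : ℕ → Option (BitVec w × BitVec w)} {m : Store w} {n : ℕ}
    (hinv : ScInv S g esk pk T N (t + 1) st κ m n) (h0 : ∀ j < 6, m.reg (N + 20 + j) = 0)
    (Ψ : Store w × ℕ → ℝ≥0∞) (F : List (BitVec w × BitVec w) → List (BitVec w) × ScState w q → ℝ≥0∞)
    (ε : ℝ≥0∞) (hΨ : ∀ x, Ψ x ≤ 1) (hdead : ∀ i a s', s'.aborted = true → 1 ≤ F i (a, s'))
    (hF : ∀ κ' st' m' n' ans, AgreeBelow N m m' → HoldsAnswer (N + 20) 6 ans m' →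
      ScInv S g esk pk T N t st' κ' m' n' →
      Ψ (m', n') ≤ expect (S.lazyKeys S.numKeys κ') (fun i => F i (ans, st')) + ε) :
    reportFactor q T * expect ((reportCode S N args).run S.pub (S.omufHandler esk) (m, n)) Ψ ≤
      expect (S.lazyKeys S.numKeys κ) (fun i =>
        expect (S.scHandler pk esk i .report (args.map m.reg) st) (F i)) + ε +
      reportError q T := by
  have hw := S.width_pos hG
  have hlam := reportFactor_le_one q T
  -- without a change of the game, the answer is the word `0`
  have hsame : ∀ m', AgreeBelow (N + 30) m m' → reportFactor q T * Ψ (m', n) ≤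
      expect (S.lazyKeys S.numKeys κ) (fun i => F i ([0], st)) + ε + reportError q T := by
    intro m' hag
    refine (mul_le_mul' hlam le_rfl).trans ?_
    rw [one_mul]
    refine le_add_right (hF κ st m' n [0] (hag.mono (by omega)) ⟨by simp, fun j hj => ?_⟩
      (hinv.congr (by omega) (hag.mono (by omega))))
    rw [hag.reg (by omega), h0 j hj]
    cases j <;> simp
  -- in an aborted game there is nothing to lose
  have habort : ∀ (x : ℝ≥0∞) (a : List (BitVec w)) (s' : ScState w q), x ≤ 1 →
      s'.aborted = true → reportFactor q T * x ≤
      expect (S.lazyKeys S.numKeys κ) (fun i => F i (a, s')) + ε + reportError q T := by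
    intro x a s' hx hs'
    rw [add_assoc]
    exact (mul_le_one' hlam hx).trans (le_add_right (one_le_expect fun i => hdead i a s' hs'))
  match args with
  | [] | [_] | [_, _] | [_, _, _] | [_, _, _, _] | [_, _, _, _, _] | [_, _, _, _, _, _]
  | [_, _, _, _, _, _, _] | [_, _, _, _, _, _, _, _] | [_, _, _, _, _, _, _, _, _]
  | [_, _, _, _, _, _, _, _, _, _] | [_, _, _, _, _, _, _, _, _, _, _] |
    _ :: _ :: _ :: _ :: _ :: _ :: _ :: _ :: _ :: _ :: _ :: _ :: _ :: _ =>
    simp only [reportCode, Cmd.run, expect_pure, List.map, System.scHandler, System.report]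
    exact hsame _ (AgreeBelow.refl _ _)
  | [i, comS, comR, time, rep, ct, ppQ, ppG, Q, gen, X, sigma] =>
    simp only [reportCode, Cmd.run, PMF.pure_bind, List.map, System.scHandler, System.report,
      Store.reg_set, and_self, if_true, hinv.sessions.live, ne_eq, bit_eq_zero hw]
    cases hse : st.sessions[(m.reg i).toNat]? with
    | none =>
      simp only [expect_pure]
      refine habort _ _ _ ?_ rfl
      split_ifs <;> exact expect_le_one hΨ
    | some se =>
    by_cases hrep : se.reported = true
    · simp only [hrep, if_true, expect_pure]
      refine habort _ _ _ ?_ rfl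
      split_ifs <;> exact expect_le_one hΨ
    simp only [hrep, Option.elim_some, Bool.not_false, Bool.true_eq_false, not_false_eq_true,
      if_true, if_false, Bool.false_eq_true]
    set m₁ := m.set (N + 30) [] (bit true) with hm₁
    have hag₁ : AgreeBelow (N + 30) m m₁ := fun a ha j => by
      simp [hm₁, Store.set_apply, eq_add_iff_false_of_le ha]
    have hinv₁ : ScInv S g esk pk T N (t + 1) st κ m₁ n := hinv.congr le_rfl (hag₁.mono (by omega))
    have hreg₁ : ∀ a < N, m₁.reg a = m.reg a := fun a ha => hag₁.reg (by omega)
    have hargs' := hargs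
    simp only [List.forall_mem_cons] at hargs'
    obtain ⟨hi, hcs, hcr, hti, hre, hct, hpq, hpg, hQ, hgen, hX, hsi, -⟩ := hargs'
    obtain ⟨m₂, hrun₂, hreg₂, hag₂⟩ := acceptCode_run S hargs hinv₁
      (by rw [hreg₁ i hi]; exact hse)
    simp only [hreg₁, hcs, hcr, hti, hre, hct, hpq, hpg, hQ, hgen, hX, hsi] at hreg₂
    rw [hrun₂, PMF.pure_bind]
    simp only [hreg₂, bit_eq_zero hw]
    set tag : Tag w := ⟨m.reg comS, m.reg comR, m.reg time, m.reg rep, m.reg ct, m.reg ppQ,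
      m.reg ppG, m.reg Q, m.reg gen, m.reg X, m.reg sigma⟩ with htag
    have hag₂' := hag₁.trans hag₂
    cases hacc : S.accepts pk esk se tag with
    | false =>
      simp only [not_true_eq_false, if_false, expect_pure, PMF.pure_bind,
        tagIssueSecond_of_not_accepts S hacc]
      exact hsame _ hag₂'
    | true =>
      obtain ⟨P₁, P₂, hP₁, hPX, hP₂, hsecond⟩ := tagIssueSecond_of_accepts S hacc st.table
      simp only [htag] at hP₁ hPX hP₂
      have hreg₂' : ∀ a < N, m₂.reg a = m.reg a := fun a ha => hag₂'.reg (by omega)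
      simp only [hsecond, Bool.true_eq_false, not_false_eq_true, if_true, PMF.bind_bind,
        PMF.pure_bind, Store.setRegs, List.headD_cons, hreg₂' Q hQ, hP₂, System.omufHandler,
        S.decode_enc]
      set m₃ := m₂.set (N + 25) [] (S.enc (mulG esk P₂)) with hm₃
      have hag₃ : ∀ a < N + 30, a ≠ N + 25 → ∀ j, m₃ a j = m a j := fun a ha ha' j => by
        simp [hm₃, Store.set_apply, ha', hag₂' a ha j]
      have hreg₃ : ∀ a < N, m₃.reg a = m.reg a := fun a ha => hag₃ a (by omega) (by omega) []
      obtain ⟨m₄, hrun₄, hdeg, hag₄⟩ := degenerateCode_run S esk hgen hQ (m := m₃) (n + 1)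
        ((hreg₃ gen hgen).trans hP₁) ((hreg₃ Q hQ).trans hP₂)
      rw [hrun₄, PMF.pure_bind, expect_bind]
      have hag₄' : ∀ a < N + 30, a ≠ N + 25 → ∀ j, m₄ a j = m a j := fun a ha ha' j =>
        (hag₄ a ha j).trans (hag₃ a ha ha' j)
      have hinv₄ : ScInv S g esk pk T N (t + 1) st κ m₄ n :=
        hinv.congr le_rfl fun a ha j => hag₄' a (by omega) (by omega) j
      have hreg₄ : ∀ a < N, m₄.reg a = m.reg a := fun a ha => hag₄' a (by omega) (by omega) []
      have hR₄ : m₄.reg (N + 25) = S.enc (mulG esk P₂) := by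
        rw [hag₄.reg (by omega)]; simp [hm₃, Store.reg_set]
      have hin : AttemptInput S esk g P₁ P₂
          (decide (S.enc P₁ = S.enc 0) && decide (S.enc P₂ = S.enc 0)) N gen X Q m₄ :=
        { base := hinv₄.consts.base
          order := hinv₄.consts.order
          epk := hinv₄.consts.epk
          gen := (hreg₄ gen hgen).trans hP₁
          X := (hreg₄ X hX).trans hPX
          Q := (hreg₄ Q hQ).trans hP₂
          R := hR₄
          deg := hdeg }
      -- value of a proof, whether simulated or not
      let a : (ZMod q × ZMod q) × HashTable w q → ℝ≥0∞ := fun r =>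
        expect (S.lazyKeys S.numKeys κ) (fun ks => F ks ([1, se.opS, se.opR, scalarWord w r.1.1,
          scalarWord w r.1.2, S.enc (mulG esk P₂)],
          { st with
              table := r.2
              sessions := st.sessions.set (m.reg i).toNat { se with reported := true }
              ctr := st.ctr + 1 })) + ε
      obtain ⟨D, hDT, hD⟩ := hinv.table_finite
      have hproof := proofCode_run S hG hg hgen hX hQ (n + 1) hinv₄.table hin
        (fun x => expect ((closeSessionCode N i).run S.pub (S.omufHandler esk) x) Ψ)
        (fun x => expect_le_one hΨ) a ?_
      · refine (mul_le_mul' le_rfl hproof).trans ((three_attempts_le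
          (pointSpec_nizkPoint S hG esk P₁ P₂) D (by omega) hD a).trans_eq ?_)
        rw [← expect_nizkDleq]
        simp only [a]
        rw [expect_add, expect_const, expect_comm]
        simp only [expect_bind, expect_pure]
      · intro c s H' m₅ hH' hc hs hag₅ hD'
        have hag₅' : ∀ a < N + 20, a ≠ N + 4 → a ≠ N + 5 → ∀ j, m₅ a j = m a j :=
          fun a ha h4 h5 j => (hag₅ a (by omega) h4 h5 (by omega) (by omega) j).trans
            (hag₄' a (by omega) (by omega) j)
        have hinv₅ := hinv.update_table hH' hD' hag₅'
        have hi₅ : m₅.reg i = m.reg i := hag₅' i (by omega) (by omega) (by omega) []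
        obtain ⟨m₆, hrun₆, hag₆, h20, h21, h22, h23, hinv₆⟩ :=
          closeSessionCode_run S esk hi hinv₅ (n' := n + 1) (by rw [hi₅]; exact hse)
        simp only [hrun₆, expect_pure]
        rw [hi₅] at hinv₆
        refine hF κ _ m₆ (n + 1) _ (fun b hb j => ?_) ⟨by simp, fun j hj => ?_⟩ hinv₆
        · rw [hag₆ b hb j, hag₅' b (by omega) (by omega) (by omega) j]
        · have h25 : m₅.reg (N + 25) = S.enc (mulG esk P₂) :=
            (hag₅ _ (by omega) (by omega) (by omega) (by omega) (by omega) []).trans hR₄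
          interval_cases j
          · simpa using h20
          · simpa using h21
          · simpa using h22
          · simpa [hc] using h23 23 (by omega) (by omega)
          · simpa [hs] using h23 24 (by omega) (by omega)
          · simpa [h25] using h23 25 (by omega) (by omega)

end Report

/-! ### Simulation of all oracles -/

section Cores

variable {w q : ℕ} {G : Type} [AddCommGroup G]

/-- Clear the registers for the answer of an oracle. -/
def clearCode (N : ℕ) : Cmd w OmufOracle :=
  .seq (.const (N + 20) 0) <| .seq (.const (N + 21) 0) <| .seq (.const (N + 22) 0) <|
  .seq (.const (N + 23) 0) <| .seq (.const (N + 24) 0) (.const (N + 25) 0)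

/-- Simulation of the oracle in the first phase of the score integrity game. -/
def hashCore (N : ℕ) (_ : HashOracle) (args : List ℕ) : Cmd w OmufOracle :=
  .seq (clearCode N) (hashCode N args)

/-- Simulation of the oracles in the second phase of the score integrity game. -/
def scCore (S : System w q G) (N : ℕ) : ScOracle → List ℕ → Cmd w OmufOracle
  | .hash, args => .seq (clearCode N) (hashCode N args)
  | .verify, args => .seq (clearCode N) (verifyCode N args)
  | .issueTag, args => .seq (clearCode N) (issueCode S N args)
  | .report, args => .seq (clearCode N) (reportCode S N args)

theorem hashCore_loopFree (N : ℕ) (o : HashOracle) (args : List ℕ) :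
    (hashCore (w := w) N o args).LoopFree := by
  simp [hashCore, hashCode, clearCode, Cmd.LoopFree]

theorem scCore_loopFree (S : System w q G) (N : ℕ) (o : ScOracle) (args : List ℕ) :
    (scCore S N o args).LoopFree := by
  cases o
  · simp [scCore, hashCode, clearCode, Cmd.LoopFree]
  · simp only [scCore, verifyCode]
    split <;> simp [clearCode, Cmd.LoopFree]
  · simp only [scCore, issueCode, keyIndexCode]
    split <;> [split_ifs; skip] <;>
      simp [clearCode, sampleKeyCode, openSessionCode, Cmd.LoopFree]
  · simp only [scCore, reportCode]
    split <;> simp [clearCode, acceptCode, degenerateCode, proofCode, attemptCode,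
      closeSessionCode, Cmd.LoopFree]

theorem hashCore_size (N : ℕ) (o : HashOracle) (args : List ℕ) :
    (hashCore (w := w) N o args).size + 4 ≤ 500 * (1 + args.length) := by
  simp only [hashCore, hashCode, clearCode, Cmd.size, List.length_cons, List.length_nil]
  omega

theorem scCore_size (S : System w q G) (N : ℕ) (o : ScOracle) (args : List ℕ) :
    (scCore S N o args).size + 4 ≤ 500 * (1 + args.length) := by
  cases o
  · simp only [scCore, hashCode, clearCode, Cmd.size, List.length_cons, List.length_nil]
    omega
  · simp only [scCore, verifyCode]
    split <;> simp only [clearCode, Cmd.size, List.length_cons, List.length_nil] <;> omega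
  · simp only [scCore, issueCode, keyIndexCode]
    split <;> [split_ifs; skip] <;>
      simp only [clearCode, sampleKeyCode, openSessionCode, Cmd.size, List.length_cons,
        List.length_nil] <;> omega
  · simp only [scCore, reportCode]
    split <;> simp only [clearCode, acceptCode, degenerateCode, proofCode, attemptCode,
      closeSessionCode, Cmd.size, List.length_cons, List.length_nil] <;> omega

variable [Fact q.Prime]

theorem clearCode_run (S : System w q G) (esk : ZMod q) (N : ℕ) (m : Store w) (n : ℕ) :
    ∃ m', (clearCode N).run S.pub (S.omufHandler esk) (m, n) = PMF.pure (m', n) ∧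
      AgreeBelow (N + 20) m m' ∧ ∀ j < 6, m'.reg (N + 20 + j) = 0 := by
  simp only [clearCode, Cmd.run, PMF.pure_bind]
  refine ⟨_, rfl, fun a ha i => ?_, fun j hj => ?_⟩
  · simp [Store.set_apply, eq_add_iff_false_of_le ha]
  · interval_cases j <;> simp [Store.reg_set]

theorem persistent_aborted (S : System w q G) (pk : BitVec w) (esk : ZMod q) :
    Persistent (fun ks => S.scHandler pk esk ks) fun st => st.aborted = true := by
  intro ks o x st F hst hF
  cases o with
  | hash =>
    simp only [System.scHandler, expect_bind, expect_pure]
    exact one_le_expect fun r => hF _ _ hst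
  | verify =>
    change 1 ≤ expect (S.scHandler pk esk ks .verify x st) F
    unfold System.scHandler
    split <;> simp_all
  | issueTag =>
    simp only [System.scHandler]
    unfold System.issueTag
    split
    · split
      · simpa using hF _ _ hst
      · simp only [expect_bind, expect_pure]
        exact one_le_expect fun se => hF _ _ hst
    · simpa using hF _ _ hst
  | report =>
    simp only [System.scHandler]
    unfold System.report
    split
    · split
      · simpa using hF _ _ rfl
      · split_ifs
        · simpa using hF _ _ rfl
        · simp only [expect_bind]
          refine one_le_expect fun r => ?_
          split
          · rw [expect_pure]
            exact hF _ _ hst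
          · rw [expect_pure]
            exact hF _ _ hst
    · simpa using hF _ _ hst

/-- The state of the score integrity game after the first phase. -/
abbrev initialState (H : HashTable w q) : ScState w q :=
  { table := H, sessions := [], ctr := 0, aborted := false }

theorem simulates_first (S : System w q G) (hG : Nat.card G = q) (g : G) (esk : ZMod q) (T N : ℕ) :
    Simulates S.pub (fun _ : Unit => System.hashHandler w q) (S.omufHandler esk)
      (fun _ : Unit => PMF.pure ()) N (fun t H _ m n => ScInv S g esk 0 T N t (initialState H) (fun _ => none) m n)
      (fun _ => False) (hashCore N) (reportFactor q T) (reportError q T) := by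
  intro o args hargs t H k m n hinv Ψ F ε hΨ _ hF
  obtain ⟨m₁, hrun, hag, h0⟩ := clearCode_run S esk N m n
  have hmap : args.map m₁.reg = args.map m.reg := (hag.mono (by omega)).map_reg hargs
  simp only [hashCore, Cmd.run, hrun, PMF.pure_bind, expect_pure]
  refine (mul_le_mul' (reportFactor_le_one q T) le_rfl).trans ?_
  rw [one_mul]
  refine le_add_right ((hashCode_simulates S hG hargs (hinv.congr le_rfl hag) h0 Ψ
    (fun r => F () ([scalarWord w r.1], r.2) + ε) fun c H' m' hag' hans hinv' => ?_).trans ?_)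
  · simpa using hF () H' m' n _ ((hag.mono (by omega)).trans hag') hans hinv'
  · rw [expect_add, expect_const, hmap]
    simp [System.hashHandler]

theorem simulates_second (S : System w q G) (hG : Nat.card G = q) {g : G} (hg : g ≠ 0)
    (esk : ZMod q) (pk : BitVec w) {T : ℕ} (hT : T < 2 ^ w) (N : ℕ) :
    Simulates S.pub (fun ks => S.scHandler pk esk ks) (S.omufHandler esk) (S.lazyKeys S.numKeys)
      N (ScInv S g esk pk T N) (fun st => st.aborted = true) (scCore S N)
      (reportFactor q T) (reportError q T) := by
  intro o args hargs t st κ m n hinv Ψ F ε hΨ hdead hF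
  obtain ⟨m₁, hrun, hag, h0⟩ := clearCode_run S esk N m n
  have hinv₁ := hinv.congr le_rfl hag
  have hag' : AgreeBelow N m m₁ := hag.mono (by omega)
  have hmap : args.map m₁.reg = args.map m.reg := hag'.map_reg hargs
  have hF' : ∀ κ' st' m' n' ans, AgreeBelow N m₁ m' → HoldsAnswer (N + 20) 6 ans m' →
      ScInv S g esk pk T N t st' κ' m' n' →
      Ψ (m', n') ≤ expect (S.lazyKeys S.numKeys κ') (fun i => F i (ans, st')) + ε :=
    fun κ' st' m' n' ans h1 h2 h3 => hF κ' st' m' n' ans (hag'.trans h1) h2 h3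
  have hexact : ∀ {x y : ℝ≥0∞}, x ≤ y → reportFactor q T * x ≤ y + reportError q T := by
    intro x y hxy
    refine (mul_le_mul' (reportFactor_le_one q T) hxy).trans ?_
    rw [one_mul]
    exact le_self_add
  rw [← hmap]
  cases o with
  | hash =>
    simp only [scCore, Cmd.run, hrun, PMF.pure_bind]
    refine hexact ((hashCode_simulates S hG hargs hinv₁ h0 Ψ
      (fun r => expect (S.lazyKeys S.numKeys κ) (fun ks => F ks ([scalarWord w r.1],
        { st with table := r.2 })) + ε)
      fun c H' m' hag' hans hinv' => hF' _ _ m' n _ hag' hans hinv').trans ?_)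
    rw [expect_add, expect_const, expect_comm]
    simp [System.scHandler]
  | verify =>
    simp only [scCore, Cmd.run, hrun, PMF.pure_bind]
    exact hexact (verifyCode_run S hargs hinv₁ h0 Ψ F ε hF')
  | issueTag =>
    simp only [scCore, Cmd.run, hrun, PMF.pure_bind]
    exact hexact (issueCode_run S hG hT hargs hinv₁ h0 Ψ F ε hF')
  | report =>
    simp only [scCore, Cmd.run, hrun, PMF.pure_bind]
    exact reportCode_run S hG hg hargs hinv₁ h0 Ψ F ε hΨ hdead hF'

end Cores

/-! ### Search for the secret key -/

section Search

variable {w q : ℕ} {G : Type} [AddCommGroup G]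

/-- The program `f 0`, …, `f (n - 1)`. -/
def iterateCode (f : ℕ → Cmd w OmufOracle) : ℕ → Cmd w OmufOracle
  | 0 => .skip
  | n + 1 => .seq (iterateCode f n) (f n)

/-- Record the multiple `i · g` of the generator and its discrete logarithm in the arrays `N + 46`
and `N + 47`. -/
def babyCode (q N i : ℕ) : Cmd w OmufOracle :=
  .seq (.const (N + 44) (scalarWord w (i : ZMod q))) <|
  .seq (.pub .groupSmul [N + 45] [N + 44, N + 1]) <|
  .seq (.store (N + 46) [N + 45] (N + 42)) (.store (N + 47) [N + 45] (N + 44))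

/-- Look up the element in `N + 41` minus `c · g` in the table.  If it is there, then the secret key
goes to the register `N + 50`, and `N + 43` is set. -/
def giantCode (N : ℕ) (c : ZMod q) : Cmd w OmufOracle :=
  .seq (.const (N + 44) (scalarWord w (-c))) <|
  .seq (.pub .groupSmul [N + 45] [N + 44, N + 1]) <|
  .seq (.pub .groupAdd [N + 45] [N + 41, N + 45]) <|
  .seq (.load (N + 48) (N + 46) [N + 45]) <|
  .ite (N + 48)
    (.seq (.load (N + 49) (N + 47) [N + 45]) <|
     .seq (.const (N + 44) (scalarWord w c)) <|
     .seq (.pub .scalarAdd [N + 49] [N + 49, N + 44]) <|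
     .seq (.pub .scalarNeg [N + 44] [N + 40]) <|
     .seq (.pub .scalarAdd [N + 50] [N + 49, N + 44]) (.load (N + 43) (N + 42) []))
    .skip

/-- Shift the public key at random, and search for its discrete logarithm among `M ^ 2` values by
baby steps and giant steps. -/
def searchCode (q N M : ℕ) : Cmd w OmufOracle :=
  .seq (.pub .randScalar [N + 40] []) <|
  .seq (.pub .groupSmul [N + 41] [N + 40, N + 1]) <|
  .seq (.pub .groupAdd [N + 41] [N + 3, N + 41]) <|
  .seq (.const (N + 42) 1) <|
  .seq (iterateCode (babyCode q N) M)
    (iterateCode (fun j => giantCode N ((j * M : ℕ) : ZMod q)) M)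

/-- The memory during the search with the shift `r`, when the multiples `i · g` with `i < l` have
been recorded. -/
structure SearchInv (S : System w q G) (g : G) (esk r : ZMod q) (N l : ℕ) (m₀ m : Store w) :
    Prop where
  agree : AgreeBelow (N + 40) m₀ m
  base : m.reg (N + 1) = S.enc g
  shift : m.reg (N + 40) = scalarWord w r
  target : m.reg (N + 41) = S.enc (mulG (esk + r) g)
  one : m.reg (N + 42) = 1
  sound : ∀ P, m (N + 46) [S.enc P] ≠ 0 → ∃ a : ZMod q, P = mulG a g ∧
    m (N + 47) [S.enc P] = scalarWord w a
  complete : ∀ i < l, m (N + 46) [S.enc (mulG (i : ZMod q) g)] ≠ 0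

variable [Fact q.Prime]

theorem babyCode_run (S : System w q G) (hG : Nat.card G = q) {g : G} {esk r : ZMod q} {N : ℕ}
    {m₀ m : Store w} (n : ℕ) (h0 : m.reg (N + 43) = 0) (hm : SearchInv S g esk r N 0 m₀ m) (l : ℕ) :
    ∃ m', (iterateCode (babyCode q N) l).run S.pub (S.omufHandler esk) (m, n) =
      PMF.pure (m', n) ∧ m'.reg (N + 43) = 0 ∧ SearchInv S g esk r N l m₀ m' := by
  have h1 : (1 : BitVec w) ≠ 0 := one_ne_zero_word (S.width_pos hG)
  induction l with
  | zero => exact ⟨m, rfl, h0, hm⟩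
  | succ l ih =>
    obtain ⟨m₁, hrun, h0₁, hm₁⟩ := ih
    have hone : m₁.reg (N + 42) = 1 := hm₁.one
    simp only [iterateCode, Cmd.run, hrun, PMF.pure_bind, babyCode, List.map, System.pub,
      Store.reg_set, and_true, if_true, Nat.add_left_cancel_iff,
      Nat.reduceEqDiff, if_false, false_and, hm₁.base, S.decode_enc, S.wordScalar_scalarWord hG,
      Store.setRegs, List.headD_cons, hone]
    refine ⟨_, rfl, ?_, ⟨fun a ha i => ?_, ?_, ?_, ?_, ?_, fun P => ?_, fun i hi => ?_⟩⟩
    · simpa [Store.reg_set] using h0₁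
    · simp [Store.set_apply, eq_add_iff_false_of_le ha, hm₁.agree a ha i]
    · simpa [Store.reg_set] using hm₁.base
    · simpa [Store.reg_set] using hm₁.shift
    · simpa [Store.reg_set] using hm₁.target
    · simpa [Store.reg_set] using hm₁.one
    · by_cases hP : P = mulG (l : ZMod q) g
      · intro _
        exact ⟨l, hP, by simp [Store.set_apply, hP]⟩
      · simpa [Store.set_apply, hP] using hm₁.sound P
    · by_cases hP : mulG (i : ZMod q) g = mulG (l : ZMod q) g
      · simpa [Store.set_apply, hP] using h1
      · have hil : i ≠ l := fun h => hP (by rw [h])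
        simpa [Store.set_apply, hP] using hm₁.complete i (by omega)

theorem giantCode_run (S : System w q G) (hG : Nat.card G = q) {g : G} (hg : g ≠ 0) {esk r : ZMod q}
    {N M : ℕ} {m₀ m : Store w} (n : ℕ) (h0 : m.reg (N + 43) = 0)
    (hm : SearchInv S g esk r N M m₀ m) (c : ℕ → ZMod q) (l : ℕ) :
    ∃ m', (iterateCode (fun j => giantCode N (c j)) l).run S.pub (S.omufHandler esk) (m, n) =
      PMF.pure (m', n) ∧ SearchInv S g esk r N M m₀ m' ∧
      (m'.reg (N + 43) ≠ 0 → m'.reg (N + 50) = scalarWord w esk) ∧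
      ((∃ j < l, ∃ i < M, esk + r = i + c j) → m'.reg (N + 43) ≠ 0) := by
  have h1 : (1 : BitVec w) ≠ 0 := one_ne_zero_word (S.width_pos hG)
  induction l with
  | zero =>
    refine ⟨m, rfl, hm, fun h => absurd h0 h, ?_⟩
    rintro ⟨j, hj, -⟩
    exact absurd hj (Nat.not_lt_zero j)
  | succ l ih =>
    obtain ⟨m₁, hrun, hm₁, hsound, hcomplete⟩ := ih
    have hone : m₁ (N + 42) [] = 1 := hm₁.one
    set P := mulG (esk + r + -c l) g with hP
    rw [iterateCode, Cmd.run, hrun, PMF.pure_bind]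
    simp only [Cmd.run, PMF.pure_bind, giantCode, List.map, System.pub,
      Store.reg_set, Store.set_apply, and_true, if_true, Nat.add_left_cancel_iff,
      Nat.reduceEqDiff, if_false, false_and, hm₁.base, hm₁.target, hm₁.shift, S.decode_enc,
      S.wordScalar_scalarWord hG, Store.setRegs, List.headD_cons, hone, mulG_add_mulG hG, ← hP]
    by_cases hfound : m₁ (N + 46) [S.enc P] = 0
    · simp only [hfound, ne_eq, not_true_eq_false, if_false]
      refine ⟨_, rfl, ⟨fun a ha i => ?_, ?_, ?_, ?_, ?_, fun P => ?_, fun i hi => ?_⟩, ?_, ?_⟩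
      · simp [Store.set_apply, eq_add_iff_false_of_le ha, hm₁.agree a ha i]
      · simpa [Store.reg_set] using hm₁.base
      · simpa [Store.reg_set] using hm₁.shift
      · simpa [Store.reg_set] using hm₁.target
      · simpa [Store.reg_set] using hm₁.one
      · simpa [Store.set_apply] using hm₁.sound P
      · simpa [Store.set_apply] using hm₁.complete i hi
      · simpa [Store.reg_set] using hsound
      · rintro ⟨j, hj, i, hi, hij⟩
        rcases Nat.lt_succ_iff_lt_or_eq.1 hj with hj | rfl
        · simpa [Store.reg_set] using hcomplete ⟨j, hj, i, hi, hij⟩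
        · have h2 := hm₁.complete i hi
          rw [show (i : ZMod q) = esk + r + -c j by rw [hij]; ring, ← hP] at h2
          exact absurd hfound h2
    · obtain ⟨a, ha, hval⟩ := hm₁.sound P hfound
      have ha' : esk + r + -c l = a := mulG_injective hG hg ha
      have hesk : a + c l + -r = esk := by rw [← ha']; ring
      simp only [hfound, ne_eq, not_false_eq_true, if_true, hval, S.wordScalar_scalarWord hG, hesk]
      refine ⟨_, rfl, ⟨fun a ha i => ?_, ?_, ?_, ?_, ?_, fun P => ?_, fun i hi => ?_⟩, ?_, ?_⟩
      · simp [Store.set_apply, eq_add_iff_false_of_le ha, hm₁.agree a ha i]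
      · simpa [Store.reg_set] using hm₁.base
      · simpa [Store.reg_set] using hm₁.shift
      · simpa [Store.reg_set] using hm₁.target
      · simpa [Store.reg_set] using hm₁.one
      · simpa [Store.set_apply] using hm₁.sound P
      · simpa [Store.set_apply] using hm₁.complete i hi
      · simp [Store.reg_set]
      · intro _
        simpa [Store.reg_set] using h1

/-- The search fails with probability at most `1 - M ^ 2 / q`; if it succeeds, then it finds the
secret key. -/
theorem searchCode_run (S : System w q G) (hG : Nat.card G = q) {g : G} (hg : g ≠ 0)
    {esk : ZMod q} {N M : ℕ} {m : Store w} (n : ℕ) (hbase : m.reg (N + 1) = S.enc g)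
    (hepk : m.reg (N + 3) = S.enc (mulG esk g)) (h43 : m.reg (N + 43) = 0)
    (h46 : ∀ x, m (N + 46) x = 0) (Ψ : Store w × ℕ → ℝ≥0∞) (L : ℝ≥0∞)
    (hfound : ∀ m', AgreeBelow (N + 40) m m' → m'.reg (N + 43) ≠ 0 →
      m'.reg (N + 50) = scalarWord w esk → Ψ (m', n) = 0)
    (hlost : ∀ m', AgreeBelow (N + 40) m m' → m'.reg (N + 43) = 0 → Ψ (m', n) ≤ L) :
    expect ((searchCode q N M).run S.pub (S.omufHandler esk) (m, n)) Ψ ≤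
      ((q - M ^ 2 : ℕ) : ℝ≥0∞) / q * L := by
  classical
  have hstep : ∀ r : ZMod q, expect ((Cmd.seq (.pub .groupSmul [N + 41] [N + 40, N + 1])
      (.seq (.pub .groupAdd [N + 41] [N + 3, N + 41])
      (.seq (.const (N + 42) 1) (.seq (iterateCode (babyCode q N) M)
      (iterateCode (fun j => giantCode N ((j * M : ℕ) : ZMod q)) M))))).run S.pub
        (S.omufHandler esk) (m.set (N + 40) [] (scalarWord w r), n)) Ψ ≤
      if (esk + r).val < M ^ 2 then 0 else L := by
    intro r
    simp only [Cmd.run, List.map, System.pub, Store.reg_set, and_true, if_true,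
      Nat.add_left_cancel_iff, Nat.reduceEqDiff, if_false, hbase, hepk, S.decode_enc,
      PMF.pure_bind, Store.setRegs, List.headD_cons, S.wordScalar_scalarWord hG,
      mulG_add_mulG hG]
    have hinv : SearchInv S g esk r N 0 m ((((m.set (N + 40) [] (scalarWord w r)).set (N + 41) []
        (S.enc (mulG r g))).set (N + 41) [] (S.enc (mulG (esk + r) g))).set (N + 42) [] 1) := by
      refine ⟨fun a ha i => ?_, ?_, ?_, ?_, ?_, fun P => ?_, fun i hi => ?_⟩
      · simp [Store.set_apply, eq_add_iff_false_of_le ha]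
      · simpa [Store.reg_set] using hbase
      · simp [Store.reg_set]
      · simp [Store.reg_set]
      · simp [Store.reg_set]
      · simp [Store.set_apply, h46]
      · exact absurd hi (Nat.not_lt_zero i)
    obtain ⟨m₁, hrun₁, h0₁, hm₁⟩ := babyCode_run S hG n
      (by simpa [Store.reg_set] using h43) hinv M
    obtain ⟨m₂, hrun₂, hm₂, hsound, hcomplete⟩ := giantCode_run S hG hg n h0₁ hm₁
      (fun j => ((j * M : ℕ) : ZMod q)) M
    rw [hrun₁, PMF.pure_bind, hrun₂, expect_pure]
    by_cases h43' : m₂.reg (N + 43) = 0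
    · rw [if_neg]
      · exact hlost m₂ hm₂.agree h43'
      · intro hlt
        have hM : 0 < M := Nat.pos_of_ne_zero (by rintro rfl; simp at hlt)
        refine hcomplete ⟨(esk + r).val / M, Nat.div_lt_of_lt_mul (by rwa [← sq]),
          (esk + r).val % M, Nat.mod_lt _ hM, ?_⟩ h43'
        rw [← Nat.cast_add, mul_comm, Nat.mod_add_div, ZMod.natCast_zmod_val]
    · rw [hfound m₂ hm₂.agree h43' (hsound h43')]
      exact zero_le
  have hcount : (Finset.univ.filter fun x : ZMod q => ¬ x.val < M ^ 2).card ≤ q - M ^ 2 := by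
    rw [← Nat.card_Ico]
    refine Finset.card_le_card_of_injOn ZMod.val (fun x hx => ?_) (ZMod.val_injective q).injOn
    have := ZMod.val_lt x
    simp only [Finset.coe_filter, Finset.mem_univ, true_and, Set.mem_ofPred_eq, not_lt] at hx
    simp [hx, this]
  calc expect ((searchCode q N M).run S.pub (S.omufHandler esk) (m, n)) Ψ
      ≤ expect (PMF.uniformOfFintype (ZMod q)) fun r => if (esk + r).val < M ^ 2 then 0 else L := by
        rw [searchCode, Cmd.run]
        simp only [Cmd.run.eq_6, List.map_nil, System.pub, PMF.bind_bind, PMF.pure_bind,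
          Store.setRegs, List.headD_cons]
        rw [expect_bind]
        exact expect_mono hstep
    _ = (q : ℝ≥0∞)⁻¹ * ∑ x : ZMod q, if x.val < M ^ 2 then 0 else L := by
        rw [expect_uniform, ZMod.card]
        congr 1
        exact Equiv.sum_comp (Equiv.addLeft esk) fun x : ZMod q => if x.val < M ^ 2 then 0 else L
    _ ≤ _ := by
        rw [Finset.sum_ite, Finset.sum_const_zero, zero_add, Finset.sum_const, nsmul_eq_mul,
          ← mul_assoc, ← ENNReal.div_eq_inv_mul]
        gcongr

end Search

/-! ### Numerical estimates -/

section Numerics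

variable {q T : ℕ}

/-- The probability that the search fails makes up for the loss of factors in the simulation; this is
Bernoulli's inequality. -/
theorem search_failure_le (hq : (2 * T) ^ 2 < q) :
    ((q - (2 * T) ^ 2 : ℕ) : ℝ≥0∞) / q ≤ reportFactor q T ^ T := by
  rcases Nat.eq_zero_or_pos T with rfl | hT
  · simp [ENNReal.div_self_le_one]
  have hq1 : T + 1 < q := by nlinarith
  have hqR : ((2 * T) ^ 2 : ℝ) + 1 ≤ q := by exact_mod_cast hq
  have hTR : (1 : ℝ) ≤ T := by exact_mod_cast hT
  have hq0 : (0 : ℝ) < q := by nlinarith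
  have hq2 : (0 : ℝ) < q - 1 := by nlinarith
  have h1 : ((q - (2 * T) ^ 2 : ℕ) : ℝ≥0∞) / q = ENNReal.ofReal ((q - (2 * T) ^ 2) / q) := by
    rw [ENNReal.ofReal_div_of_pos hq0, ENNReal.ofReal_natCast, ← ENNReal.ofReal_natCast,
      Nat.cast_sub hq.le]
    push_cast
    rfl
  have h2 : reportFactor q T = ENNReal.ofReal ((q - 1 - T) / (q - 1)) := by
    rw [reportFactor, ENNReal.ofReal_div_of_pos hq2, ← ENNReal.ofReal_natCast,
      ← ENNReal.ofReal_natCast, Nat.cast_sub (by omega), Nat.cast_sub (by omega)]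
    push_cast
    rfl
  have hfrac : ((q : ℝ) - 1 - T) / (q - 1) = 1 + -(T / (q - 1)) := by
    field_simp
    ring
  have hle1 : (T : ℝ) / (q - 1) ≤ 1 := by
    rw [div_le_one hq2]
    nlinarith
  rw [h1, h2, ← ENNReal.ofReal_pow (div_nonneg (by nlinarith) hq2.le), hfrac]
  refine ENNReal.ofReal_le_ofReal
    (le_trans ?_ (one_add_mul_le_pow (by linarith : (-2 : ℝ) ≤ -(T / (q - 1))) T))
  have h3 : (T : ℝ) * (T / (q - 1)) ≤ (2 * T) ^ 2 / q := by
    rw [← mul_div_assoc, div_le_div_iff₀ hq2 hq0]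
    have h4 : (0 : ℝ) ≤ 3 * q - 4 := by nlinarith
    nlinarith [mul_nonneg (sq_nonneg (T : ℝ)) h4]
  rw [sub_div, div_self hq0.ne']
  linarith

theorem reportFactor_pow_ne_zero (hq : (2 * T) ^ 2 < q) : reportFactor q T ^ T ≠ 0 := by
  rcases Nat.eq_zero_or_pos T with rfl | hT
  · simp
  have hq1 : T + 1 < q := by nlinarith
  refine pow_ne_zero _ (ENNReal.div_ne_zero.2 ⟨?_, ENNReal.natCast_ne_top _⟩)
  exact_mod_cast (by omega : q - 1 - T ≠ 0)

theorem reportError_mul_le (hq : (2 * T) ^ 2 < q) : reportError q T * T ≤ 1 / q := by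
  rcases Nat.eq_zero_or_pos T with rfl | hT
  · simp
  have h1 : (T + 1) ^ 3 * T ≤ q ^ 2 := by
    calc (T + 1) ^ 3 * T ≤ (2 * T) ^ 3 * T := by gcongr; omega
      _ ≤ (2 * T) ^ 2 * (2 * T) ^ 2 := by nlinarith [pow_pos hT 4]
      _ ≤ q ^ 2 := by rw [← sq]; gcongr
  have hq0 : (q : ℝ≥0∞) ≠ 0 := by exact_mod_cast (by omega : q ≠ 0)
  have hqt : (q : ℝ≥0∞) ≠ ⊤ := ENNReal.natCast_ne_top q
  rw [reportError, ENNReal.le_div_iff_mul_le (Or.inl hq0) (Or.inl hqt), div_eq_mul_inv, mul_pow]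
  calc ((T + 1 : ℕ) : ℝ≥0∞) ^ 3 * ((q : ℝ≥0∞)⁻¹) ^ 3 * T * q
      = (((T + 1) ^ 3 * T : ℕ) : ℝ≥0∞) * ((q : ℝ≥0∞)⁻¹) ^ 2 * ((q : ℝ≥0∞)⁻¹ * q) := by
        push_cast; ring
    _ ≤ ((q ^ 2 : ℕ) : ℝ≥0∞) * ((q : ℝ≥0∞)⁻¹) ^ 2 * ((q : ℝ≥0∞)⁻¹ * q) := by gcongr
    _ = ((q : ℝ≥0∞)⁻¹ * q) ^ 3 := by push_cast; ring
    _ ≤ 1 := by rw [ENNReal.inv_mul_cancel hq0 hqt, one_pow]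

end Numerics

/-! ### The reduction -/

section Codes

variable {w q : ℕ} {G : Type} [AddCommGroup G]

/-- Move the input to the private registers `N + 1`, `N + 2` and `N + 3`, so that the memory below
`N` is as at the start of the score integrity game. -/
def setupCode (N : ℕ) : Cmd w OmufOracle :=
  .seq (.load (N + 3) 2 []) <| .seq (.const 2 0) <| .seq (.load (N + 1) 0 []) (.load (N + 2) 1 [])

/-- Put out a token for the nonce `0`, which is what the second array holds at the beginning, by
means of the secret key in `N + 50`. -/
def outputCode (N : ℕ) : Cmd w OmufOracle :=
  .seq (.const (N + 51) 0) <| .seq (.pub .hashToGroup [N + 44] [N + 51]) <|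
  .seq (.pub .groupSmul [N + 44] [N + 50, N + 44]) <| .seq (.store 2 [N + 51] (N + 44)) (.const 0 1)

/-- Passage to the second phase: the register `0` holds the verification key of the server, and then
the public key of the sender. -/
def secondCode (S : System w q G) (N : ℕ) (c : Cmd w ScOracle) : Cmd w OmufOracle :=
  .seq (.load (N + 14) 0 []) <| .seq (.load 0 (N + 3) []) (c.translate N (scCore S N))

/-- Simulation of the score integrity game. -/
def simulateCode (S : System w q G) (N : ℕ) (A : ScAdversary w) : Cmd w OmufOracle :=
  .seq (A.first.translate N (hashCore N)) (secondCode S N A.second)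

/-- The adversary in the one-more unforgeability game: search for the secret key in a time
proportional to that of `A`, and simulate the score integrity game if the search has failed. -/
def reduction (S : System w q G) (N : ℕ) (A : ScAdversary w) : OmufAdversary w where
  main := .seq (.seq (setupCode N) (searchCode q N (2 * A.time)))
    (.ite (N + 43) (outputCode N) (simulateCode S N A))
  time := ((setupCode N).seq (searchCode (w := w) q N (2 * A.time))).size + 1 +
    (500 * A.time + 20)

theorem Cmd.size_pos {O : Type} (c : Cmd w O) : 0 < c.size := by
  cases c <;> simp only [Cmd.size] <;> omega

theorem Cmd.translate_size_le {O O' : Type} {N K : ℕ} {core : O → List ℕ → Cmd w O'}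
    (hK : 2 ≤ K) (hsize : ∀ o args, (core o args).size + 4 ≤ K * (1 + args.length))
    (c : Cmd w O) : (c.translate N core).size ≤ K * c.size := by
  have hself : ∀ n, n ≤ K * n := fun n => Nat.le_mul_of_pos_left n (by omega)
  induction c with
  | call o out args =>
    have h1 := hsize o args
    have h2 : 2 * out.length ≤ K * out.length := Nat.mul_le_mul_right _ hK
    simp only [Cmd.translate, Cmd.size, copyOut_size]
    calc _ ≤ K * (1 + args.length) + K * out.length := by omega
      _ = _ := by ring
  | seq c d ihc ihd =>
    simp only [Cmd.translate, Cmd.size, mul_add]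
    omega
  | ite r c d ihc ihd =>
    simp only [Cmd.translate, Cmd.size, mul_add]
    omega
  | loop r c ih =>
    simp only [Cmd.translate, Cmd.size, mul_add]
    omega
  | _ => exact hself _

theorem iterateCode_size {f : ℕ → Cmd w OmufOracle} {k : ℕ} (hf : ∀ i, (f i).size = k) (n : ℕ) :
    (iterateCode f n).size = 1 + n * (k + 1) := by
  induction n with
  | zero => simp [iterateCode, Cmd.size]
  | succ n ih =>
    simp only [iterateCode, Cmd.size, ih, hf]
    ring

theorem iterateCode_loopFree {f : ℕ → Cmd w OmufOracle} (hf : ∀ i, (f i).LoopFree) (n : ℕ) :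
    (iterateCode f n).LoopFree := by
  induction n with
  | zero => trivial
  | succ n ih => exact ⟨ih, hf n⟩

theorem prefix_loopFree (N M : ℕ) :
    ((setupCode N).seq (searchCode (w := w) q N M)).LoopFree := by
  have h1 := iterateCode_loopFree (f := babyCode (w := w) q N)
    (fun i => by simp [babyCode, Cmd.LoopFree]) M
  have h2 := iterateCode_loopFree
    (f := fun j => giantCode (w := w) N ((j * M : ℕ) : ZMod q))
    (fun i => by simp [giantCode, Cmd.LoopFree]) M
  simp only [setupCode, searchCode, Cmd.LoopFree, h1, h2, and_self]

theorem outputCode_loopFree (N : ℕ) : (outputCode (w := w) N).LoopFree := by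
  simp [outputCode, Cmd.LoopFree]

theorem outputCode_size (N : ℕ) : (outputCode (w := w) N).size ≤ 20 := by
  simp [outputCode, Cmd.size]

theorem reduction_complexity_le (S : System w q G) (N : ℕ) (A : ScAdversary w) :
    (reduction S N A).complexity ≤ 2000 * A.complexity := by
  have h1 := Cmd.translate_size_le (N := N) (by norm_num) (hashCore_size (w := w) N) A.first
  have h2 := Cmd.translate_size_le (N := N) (by norm_num) (scCore_size S N) A.second
  have h3 := A.first.size_pos
  have h4 := A.second.size_pos
  have h5 := iterateCode_size (f := babyCode (w := w) q N) (k := 12)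
    (fun i => by simp [babyCode, Cmd.size]) (2 * A.time)
  have h6 := iterateCode_size
    (f := fun j => giantCode (w := w) N ((j * (2 * A.time) : ℕ) : ZMod q)) (k := 37)
    (fun i => by simp [giantCode, Cmd.size]) (2 * A.time)
  have h7 := outputCode_size (w := w) N
  simp only [OmufAdversary.complexity, ScAdversary.complexity, reduction, simulateCode, secondCode,
    setupCode, searchCode, Cmd.size, h5, h6, List.length_cons, List.length_nil]
  omega

end Codes

section Reduction

variable {w q : ℕ} {G : Type} [AddCommGroup G]

theorem System.wins_congr (S : System w q G) {N : ℕ} (hN : 3 ≤ N) {m m' : Store w}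
    (h : AgreeBelow N m m') (esk : ZMod q) (n : ℕ) : S.Wins esk n m' ↔ S.Wins esk n m := by
  simp only [System.Wins, System.outNonce, System.outToken, h.reg (show 0 < N by omega),
    h 1 (by omega), h 2 (by omega)]

open Classical in
/-- Indicator of a loss in the one-more unforgeability game. -/
def System.omufLoss (S : System w q G) (esk : ZMod q) : Option (ℕ × Store w × ℕ) → ℝ≥0∞
  | none => 1
  | some (_, m, n) => if S.Wins esk n m then 0 else 1

open Classical in
/-- Indicator of a loss in the score integrity game. -/
def System.scLoss (S : System w q G) (esk : ZMod q) : Option (ℕ × Store w × ScState w q) → ℝ≥0∞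
  | none => 1
  | some (_, m, st) => if st.aborted = false ∧ S.Wins esk st.ctr m then 0 else 1

theorem System.omufLoss_le_one (S : System w q G) (esk : ZMod q) (x : Option (ℕ × Store w × ℕ)) :
    S.omufLoss esk x ≤ 1 := by
  rcases x with _ | ⟨t, m, n⟩
  · exact le_rfl
  · simp only [omufLoss]
    split_ifs <;> simp

variable [Fact q.Prime]

/-- Probability of a loss in the second phase of the score integrity game. -/
def System.secondLoss (S : System w q G) (A : ScAdversary w) (g : G) (esk : ZMod q) :
    Option (ℕ × Store w × HashTable w q) → ℝ≥0∞
  | none => 1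
  | some (t, m, H) => expect (S.sigKeys S.numKeys) fun keys =>
      expect (A.second.exec S.pub (S.scHandler (m.reg 0) esk keys) t
        (m.set 0 [] (S.enc (mulG esk g)), initialState H)) (S.scLoss esk)

/-- The memory at the start of the score integrity game. -/
def System.scStore (S : System w q G) (g : G) : Store w :=
  (Store.zero w).setRegs [0, 1] [S.enc g, BitVec.ofNat w q]

/-- The memory at the start of the one-more unforgeability game. -/
def System.omufStore (S : System w q G) (g : G) (esk : ZMod q) : Store w :=
  (Store.zero w).setRegs [0, 1, 2] [S.enc g, BitVec.ofNat w q, S.enc (mulG esk g)]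

theorem outputCode_run (S : System w q G) (hG : Nat.card G = q) {esk : ZMod q} {N : ℕ}
    {m : Store w} (h50 : m.reg (N + 50) = scalarWord w esk) (h1 : m 1 [0] = 0) :
    ∃ m', (outputCode N).run S.pub (S.omufHandler esk) (m, 0) = PMF.pure (m', 0) ∧
      S.Wins esk 0 m' := by
  have hone : (1 : BitVec w).toNat = 1 := by
    have := S.width_pos hG
    simp [this]
  simp only [outputCode, Cmd.run, PMF.pure_bind, List.map, System.pub, Store.reg_set, and_true,
    if_true, Nat.add_left_cancel_iff, Nat.reduceEqDiff, if_false, S.decode_enc, Store.setRegs,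
    List.headD_cons, h50, S.wordScalar_scalarWord hG]
  refine ⟨_, rfl, ?_⟩
  simp only [System.Wins, System.outNonce, System.outToken, Store.reg_set, and_self, if_true, hone]
  refine ⟨one_pos, fun i hi j hj hij => absurd (by omega) hij, fun i hi => ?_⟩
  obtain rfl : i = 0 := by omega
  have h1' : m 1 [0#w] = 0#w := h1
  simp [System.ppVerify, Store.set_apply, h1']

/-- Simulation of the second phase.  The keys of the genuine game are sampled at its beginning, which
is the case of the lazy sampler without sampled keys. -/
theorem secondCode_le (S : System w q G) (hG : Nat.card G = q) {g : G} (hg : g ≠ 0) {esk : ZMod q}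
    {A : ScAdversary w} {N : ℕ} (hN : 3 ≤ N) (h2 : A.second.Below N) (hT : A.time < 2 ^ w)
    {t tB n : ℕ} {m mB : Store w} {H : HashTable w q} (ht : 500 * t + 4 ≤ tB)
    (hag : AgreeBelow N m mB)
    (hinv : ScInv S g esk 0 A.time N t (initialState H) (fun _ => none) mB n) :
    reportFactor q A.time ^ t * expect ((secondCode S N A.second).exec S.pub (S.omufHandler esk) tB
        (mB, n)) (S.omufLoss esk) ≤
      S.secondLoss A g esk (some (t, m, H)) + reportError q A.time * t := by
  have hinv' : ScInv S g esk (m.reg 0) A.time N t (initialState H) (fun _ => none)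
      ((mB.set (N + 14) [] (mB 0 [])).set 0 []
        ((mB.set (N + 14) [] (mB 0 [])) (N + 3) [])) n := by
    refine privateInv_scInv S g esk _ _ N (m := mB.set (N + 14) [] (mB 0 [])) ?_
      (fun a ha _ i => Store.set_above (by omega)) le_rfl
    exact
      { consts :=
          { base := by simpa [Store.reg_set] using hinv.consts.base
            order := by simpa [Store.reg_set] using hinv.consts.order
            epk := by simpa [Store.reg_set] using hinv.consts.epk
            pk := by
              rw [Store.reg_set, if_pos ⟨rfl, rfl⟩]
              exact hag 0 (by omega) [] }
        table := hinv.table.congr (fun x => Store.set_above (by omega))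
          fun x => Store.set_above (by omega)
        keys := hinv.keys.congr fun a _ _ i => Store.set_above (by omega)
        sessions := hinv.sessions.congr fun a _ _ i => Store.set_above (by omega)
        table_finite := hinv.table_finite
        sessions_length := hinv.sessions_length
        ctr := hinv.ctr
        alive := hinv.alive }
  have hepk : (mB.set (N + 14) [] (mB 0 [])) (N + 3) [] = S.enc (mulG esk g) :=
    (Store.set_above (by omega)).trans hinv.consts.epk
  rw [hepk] at hinv'
  have key := (simulates_second S hG hg esk (m.reg 0) hT N).expect_exec_le (K := 500) (e := 0)
    (privateInv_scInv S g esk _ _ N) (persistent_aborted S _ esk) (reportFactor_le_one q _)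
    (by norm_num) (scCore_loopFree S N) (scCore_size S N) (by norm_num) A.second h2 t (tB - 1 - 1)
    (initialState H) (fun _ => none) (m.set 0 [] (S.enc (mulG esk g))) _ n (S.omufLoss esk)
    (fun _ => S.scLoss esk) (by omega)
    ((hag.trans fun a ha i => Store.set_above (by omega)).set 0 [] _) hinv'
    ⟨S.omufLoss_le_one esk, fun _ => le_rfl, fun _ t m s hs => by simp [System.scLoss, hs], ?_⟩
  · rw [S.lazyKeys_none] at key
    simp only [secondCode, Cmd.exec, List.length_nil, List.map_nil]
    rw [expect_bind, expect_spend (by omega), expect_pure]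
    dsimp only
    rw [expect_bind, expect_spend (by omega), expect_pure]
    dsimp only
    rw [hepk]
    exact key
  · intro t tB s k m mB n _ hag hinv
    refine (mul_le_of_le_one_left zero_le
      (pow_le_one₀ zero_le (reportFactor_le_one q _))).trans (le_add_right ?_)
    have hw : S.Wins esk n mB ↔ S.Wins esk s.ctr m := by
      rw [hinv.ctr]
      exact S.wins_congr hN hag esk _
    rw [expect_const]
    by_cases h : S.Wins esk s.ctr m <;>
      simp [System.omufLoss, System.scLoss, hw, hinv.alive, h]

/-- Simulation of both phases.  The slack of `4` time units pays for the passage between them. -/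
theorem simulateCode_le (S : System w q G) (hG : Nat.card G = q) {g : G} (hg : g ≠ 0) {esk : ZMod q}
    {A : ScAdversary w} {N : ℕ} (hN : 3 ≤ N) (h1 : A.first.Below N) (h2 : A.second.Below N)
    (hT : A.time < 2 ^ w) {tB : ℕ} {m mB : Store w} (ht : 500 * A.time + 4 ≤ tB)
    (hag : AgreeBelow N m mB)
    (hinv : ScInv S g esk 0 A.time N A.time (initialState fun _ => none) (fun _ => none) mB 0) :
    reportFactor q A.time ^ A.time * expect ((simulateCode S N A).exec S.pub (S.omufHandler esk) tB
        (mB, 0)) (S.omufLoss esk) ≤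
      expect (A.first.exec S.pub (System.hashHandler w q) A.time (m, fun _ => none))
        (S.secondLoss A g esk) + reportError q A.time * A.time := by
  have key := (simulates_first S hG g esk A.time N).expect_exec_le (K := 500) (e := 4)
    (fun h => privateInv_scInv S g esk _ _ N h) (fun _ _ _ _ _ h => h.elim)
    (reportFactor_le_one q _) (by norm_num) (hashCore_loopFree N) (hashCore_size N) (by norm_num)
    A.first h1 A.time tB (fun _ => none) () m mB 0
    (fun
      | none => 1
      | some (t, s) => expect ((secondCode S N A.second).exec S.pub (S.omufHandler esk) t s)
          (S.omufLoss esk))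
    (fun _ => S.secondLoss A g esk) ht hag hinv ⟨?_, fun _ => le_rfl, fun _ _ _ _ h => h.elim, ?_⟩
  · rw [expect_const] at key
    refine le_trans (le_of_eq ?_) key
    simp only [simulateCode, Cmd.exec, expect_bind]
    congr 2
    funext x
    rcases x with _ | ⟨t, s⟩
    · simp [System.omufLoss]
    · rfl
  · rintro (_ | ⟨t, s⟩)
    · exact le_rfl
    · exact expect_le_one (S.omufLoss_le_one esk)
  · intro t tB H _ m mB n ht hag hinv
    rw [expect_const]
    exact secondCode_le S hG hg hN h2 hT ht hag hinv

theorem setupCode_run (S : System w q G) {g : G} {esk : ZMod q} {T N : ℕ} (hN : 3 ≤ N) :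
    ∃ m, (setupCode N).run S.pub (S.omufHandler esk) (S.omufStore g esk, 0) = PMF.pure (m, 0) ∧
      AgreeBelow N (S.scStore g) m ∧
      ScInv S g esk 0 T N T (initialState fun _ => none) (fun _ => none) m 0 ∧
      m.reg (N + 43) = 0 ∧ ∀ x, m (N + 46) x = 0 := by
  simp only [setupCode, Cmd.run, PMF.pure_bind]
  have hN0 : N ≠ 0 := by omega
  have hN1' : ∀ k, (N + k = 1) ↔ False := fun k => by simp; omega
  have hN2' : ∀ k, (N + k = 2) ↔ False := fun k => by simp; omega
  refine ⟨_, rfl, fun a ha i => ?_, ?_, ?_, fun x => ?_⟩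
  · by_cases ha2 : a = 2
    · subst ha2
      by_cases hi : i = [] <;>
        simp [Store.set_apply, System.scStore, Store.setRegs, Store.zero, System.omufStore,
          eq_add_iff_false ha, hi, hN0]
    · simp [Store.set_apply, System.scStore, Store.setRegs, Store.zero, System.omufStore,
        eq_add_iff_false ha, ha2]
  · exact
      { consts := by
          constructor <;>
          simp [Store.reg, Store.set_apply, System.omufStore, Store.setRegs, Store.zero, hN0, hN1',
            hN2']
        table := by
          constructor <;>
          simp [Store.set_apply, System.omufStore, Store.setRegs, Store.zero, bit, hN1', hN2']
        keys := by
          constructor <;>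
          simp [Store.set_apply, System.omufStore, Store.setRegs, Store.zero, bit, hN1', hN2']
        sessions := by
          constructor <;>
          simp [Store.reg, Store.set_apply, System.omufStore, Store.setRegs, Store.zero, bit, hN1',
            hN2']
        table_finite := ⟨∅, by simp, fun _ _ => rfl⟩
        sessions_length := by simp
        ctr := rfl
        alive := rfl }
  · simp [Store.reg, Store.set_apply, System.omufStore, Store.setRegs, Store.zero, hN1',
      hN2']
  · simp [Store.set_apply, System.omufStore, Store.setRegs, Store.zero, hN1', hN2']

/-- For every generator and secret key, the reduction loses with a probability at most `1 / q` above
that with which `A` loses. -/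
theorem reduction_loss_le (S : System w q G) (hG : Nat.card G = q) {g : G} (hg : g ≠ 0)
    (esk : ZMod q) {A : ScAdversary w} {N : ℕ} (hN : 3 ≤ N) (h1 : A.first.Below N)
    (h2 : A.second.Below N) :
    expect ((reduction S N A).main.exec S.pub (S.omufHandler esk) (reduction S N A).time
        (S.omufStore g esk, 0)) (S.omufLoss esk) ≤
      expect (A.first.exec S.pub (System.hashHandler w q) A.time (S.scStore g, fun _ => none))
        (S.secondLoss A g esk) + 1 / q := by
  obtain ⟨m, hrun, hag, hinv, h43, h46⟩ := setupCode_run S (g := g) (esk := esk) (T := A.time) hN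
  set T := A.time with hTdef
  set D := 1 + (500 * T + 20) with hD
  set rest : Cmd w OmufOracle := .ite (N + 43) (outputCode N) (simulateCode S N A) with hrest
  set real := expect (A.first.exec S.pub (System.hashHandler w q) A.time
    (S.scStore g, fun _ => none)) (S.secondLoss A g esk) with hreal
  -- the least favourable amount of time that is left after the search
  let Ψ : Store w × ℕ → ℝ≥0∞ := fun x => ⨆ t : {t : ℕ // D ≤ t},
    expect (rest.exec S.pub (S.omufHandler esk) t.1 x) (S.omufLoss esk)
  have hsearch : ∀ L : ℝ≥0∞,
      (∀ m', AgreeBelow (N + 40) m m' → m'.reg (N + 43) = 0 → Ψ (m', 0) ≤ L) →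
      expect ((reduction S N A).main.exec S.pub (S.omufHandler esk) (reduction S N A).time
        (S.omufStore g esk, 0)) (S.omufLoss esk) ≤ ((q - (2 * T) ^ 2 : ℕ) : ℝ≥0∞) / q * L := by
    intro L hL
    rw [reduction, Cmd.exec, expect_bind]
    refine (Cmd.expect_exec_le_run S.pub (S.omufHandler esk) _ (prefix_loopFree N _) _ _ _ Ψ
      (by dsimp only; omega) fun t' s' ht' => ?_).trans ?_
    · dsimp only at ht'
      exact le_iSup (fun t : {t : ℕ // D ≤ t} =>
        expect (rest.exec S.pub (S.omufHandler esk) t.1 s') (S.omufLoss esk)) ⟨t', by omega⟩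
    · rw [Cmd.run, hrun, PMF.pure_bind]
      refine searchCode_run S hG hg 0 hinv.consts.base hinv.consts.epk h43 h46 Ψ L
        (fun m' hag' hfound hkey => ?_) hL
      refine le_antisymm (iSup_le fun t => ?_) zero_le
      have ht := t.2
      rw [hrest, Cmd.exec, expect_spend (by omega), if_pos hfound]
      have h10 : m' 1 [0] = 0 := by
        rw [hag' 1 (by omega), hag 1 (by omega)]
        simp [System.scStore, Store.setRegs, Store.set_apply, Store.zero]
      obtain ⟨m₂, hrun₂, hwins⟩ := outputCode_run S hG hkey h10
      have hsz := outputCode_size (w := w) N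
      refine (Cmd.expect_exec_le_run S.pub (S.omufHandler esk) _ (outputCode_loopFree N) _ _ _
        (fun x => S.omufLoss esk (some (0, x))) (by omega) fun t' s' _ => le_rfl).trans ?_
      rw [hrun₂, expect_pure]
      simp [System.omufLoss, hwins]
  rcases le_or_gt q ((2 * T) ^ 2) with hq | hq
  · -- the search covers all residues
    refine (hsearch 1 fun m' _ _ => iSup_le fun t =>
      expect_le_one (S.omufLoss_le_one esk)).trans ?_
    rw [Nat.sub_eq_zero_of_le hq]
    simp
  · have hTw : T < 2 ^ w := by
      have := S.order_le hG
      nlinarith [Nat.le_self_pow two_ne_zero T]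
    have h0 := reportFactor_pow_ne_zero hq
    have htop : reportFactor q T ^ T ≠ ⊤ :=
      ne_top_of_le_ne_top ENNReal.one_ne_top (pow_le_one₀ zero_le (reportFactor_le_one q T))
    calc _ ≤ ((q - (2 * T) ^ 2 : ℕ) : ℝ≥0∞) / q *
          ((real + reportError q T * T) / reportFactor q T ^ T) := by
          refine hsearch _ fun m' hag' hlost => iSup_le fun t => ?_
          have ht := t.2
          rw [ENNReal.le_div_iff_mul_le (Or.inl h0) (Or.inl htop), mul_comm, hrest, Cmd.exec,
            expect_spend (by omega), if_neg (not_not.2 hlost)]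
          exact simulateCode_le S hG hg hN h1 h2 hTw (by omega)
            (hag.trans (hag'.mono (by omega))) (hinv.congr le_rfl (hag'.mono (by omega)))
      _ ≤ reportFactor q T ^ T * ((real + reportError q T * T) / reportFactor q T ^ T) := by
          gcongr
          exact search_failure_le hq
      _ = real + reportError q T * T := ENNReal.mul_div_cancel h0 htop
      _ ≤ real + 1 / q := by
          gcongr
          exact reportError_mul_le hq

/-- The probabilities of winning and of losing. -/
theorem apply_true_add_expect (p : PMF Bool) :
    p true + expect p (fun b => if b then 0 else 1) = 1 := by
  have h := p.tsum_coe
  rw [tsum_bool] at h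
  rw [expect, tsum_bool]
  simpa [add_comm] using h

theorem System.expect_omuf (S : System w q G) (B : OmufAdversary w) :
    expect (S.omuf B) (fun b => if b then 0 else 1) =
      expect S.setup fun g => expect (PMF.uniformOfFintype (ZMod q)ˣ) fun k =>
        expect (B.main.exec S.pub (S.omufHandler k) B.time (S.omufStore g k, 0))
          (S.omufLoss k) := by
  simp only [omuf, expect_bind, ppKeyGen, expect_pure]
  congr 1; funext g; congr 1; funext k
  refine congrArg (expect _) (funext fun x => ?_)
  rcases x with _ | ⟨t, m, n⟩ 
  · simp [omufLoss]
  · by_cases h : S.Wins k n m <;> simp [omufLoss, h]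

theorem System.expect_scIntegrity (S : System w q G) (A : ScAdversary w) :
    expect (S.scIntegrity A) (fun b => if b then 0 else 1) =
      expect S.setup fun g => expect (PMF.uniformOfFintype (ZMod q)ˣ) fun k =>
        expect (A.first.exec S.pub (hashHandler w q) A.time (S.scStore g, fun _ => none))
          (S.secondLoss A g k) := by
  simp only [scIntegrity, expect_bind]
  congr 1; funext g
  rw [expect_comm]
  refine congrArg (expect _) (funext fun x => ?_)
  rcases x with _ | ⟨t, m, H⟩
  · simp [secondLoss]
  · simp only [expect_bind, ppKeyGen, expect_pure, secondLoss]
    congr 1; funext k; congr 1; funext keys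
    refine congrArg (expect _) (funext fun x => ?_)
    rcases x with _ | ⟨t, m, st⟩ 
    · simp [scLoss]
    · by_cases h : st.aborted = false ∧ S.Wins k st.ctr m <;> simp [scLoss, h]

theorem System.scIntegrityAdv_le (S : System w q G) (hG : Nat.card G = q) {A : ScAdversary w}
    {N : ℕ} (hN : 3 ≤ N) (h1 : A.first.Below N) (h2 : A.second.Below N) :
    S.scIntegrityAdv A ≤ S.omufAdv (reduction S N A) + 1 / q := by
  have hloss : expect (S.omuf (reduction S N A)) (fun b => if b then 0 else 1) ≤
      expect (S.scIntegrity A) (fun b => if b then 0 else 1) + 1 / q := by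
    rw [S.expect_omuf, S.expect_scIntegrity, ← expect_const S.setup (1 / (q : ℝ≥0∞)),
      ← expect_add]
    refine expect_mono_support fun g hg => ?_
    rw [← expect_const (PMF.uniformOfFintype (ZMod q)ˣ) (1 / (q : ℝ≥0∞)), ← expect_add]
    exact expect_mono fun k =>
      reduction_loss_le S hG (ne_zero_of_generates hG (S.setup_generates g hg)) k hN h1 h2
  have htop : expect (S.scIntegrity A) (fun b => if b then 0 else 1) ≠ ⊤ :=
    ne_top_of_le_ne_top ENNReal.one_ne_top (expect_le_one fun b => by split_ifs <;> simp)
  refine (ENNReal.add_le_add_iff_right htop).1 ?_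
  calc S.scIntegrityAdv A + expect (S.scIntegrity A) (fun b => if b then 0 else 1)
      = S.omufAdv (reduction S N A) +
          expect (S.omuf (reduction S N A)) (fun b => if b then 0 else 1) :=
        (apply_true_add_expect _).trans (apply_true_add_expect _).symm
    _ ≤ S.omufAdv (reduction S N A) +
          (expect (S.scIntegrity A) (fun b => if b then 0 else 1) + 1 / q) := by gcongr
    _ = _ := by ring

end Reduction

end Sandi

end

theorem theorem3 :
    ∃ C : ℕ, ∀ (w q : ℕ) [Fact q.Prime] (G : Type) [AddCommGroup G] (_ : Nat.card G = q)
      (S : Sandi.System w q G) (A : Sandi.ScAdversary w),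
      ∃ B : Sandi.OmufAdversary w,
        B.complexity ≤ C * A.complexity ∧
        S.scIntegrityAdv A ≤ S.omufAdv B + 1 / (q : ENNReal) := by
  refine ⟨2000, fun w q _ G _ hG S A => ?_⟩
  obtain ⟨N₁, h1⟩ := A.first.exists_below
  obtain ⟨N₂, h2⟩ := A.second.exists_below
  exact ⟨Sandi.reduction S (N₁ + N₂ + 3) A, Sandi.reduction_complexity_le S _ A,
    S.scIntegrityAdv_le hG (by omega) (h1.mono (by omega)) (h2.mono (by omega))⟩
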